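/- Work over $\mathbb{C}$, with the Zariski topology and Krull dimension throughout. **Notation.** For integers $m,k\ge 0$ put $h_m(0)=0$ and, for $k>0$, write $k+1=2^{\lambda_1}+\dots+2^{\lambda_a}+\varepsilon$ with $\lambda_1>\dots>\lambda_a\ge 1$, $\varepsilon\in\{0,1\}$, and set $h_m(k)=m^{\lambda_1-1}+\dots+m^{\lambda_a-1}$. For $r$-tuples $\mathbf n,\mathbf d$ of positive integers, $SV^{\mathbf n}_{\mathbf d}\subset\mathbb{P}^{N}$, $N=\prod_{i}\binom{n_i+d_i}{d_i}-1$, denotes the Segre–Veronese variety, i.e. $\mathbb{P}^{n_1}\times\dots\times\mathbb{P}^{n_r}$ embedded by the complete linear system $|\mathcal{O}(d_1,\dots,d_r)|$. Let $X\subset\mathbb{P}^N$ be a smooth irreducible non-degenerate projective variety and $h\ge 1$. * Let $\mathcal S_h(X)\subset\mathbb{G}(h-1,N)$ be the closure of the set of spans $\langle x_1,\dots,x_h\rangle$ of $h$ linearly independent points of $X$, let $\mathrm{Sec}_h(X)=\{(p,\Lambda)\mid p\in\Lambda\in\mathcal S_h(X)\}$, let $\pi_h:\mathrm{Sec}_h(X)\to\mathbb{P}^N$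 be the projection, and let $\sec_h(X)$ be its image. $X$ is *$h$-defective* if $\dim\sec_h(X)<\min\{h\dim X+h-1,N\}$. * A point $p$ is *$h$-identifiable* if it has rank $h$ (it lies in the span of $h$ distinct points of $X$, but not in the span of $k$ distinct points of $X$ for any $k<h$) and $\pi_h^{-1}(p)$ is a single point. $X$ is *$h$-identifiable* if the general point of $\sec_h(X)$ is $h$-identifiable. * For $x_1,\dots,x_h\in X$ let $\Gamma_{x_1,\dots,x_h}$ be the closure in $X$ of the union of those irreducible components of $\{x\in X\mid T_xX\subseteq\langle T_{x_1}X,\dots,T_{x_h}X\rangle\}$ that contain at least one of the $x_i$. $X$ is *$h$-tangentially weakly defective* if $\dim\Gamma_{x_1,\dots,x_h}>0$ for general $x_1,\dots,x_h\in X$. **Statement.** Let $r\ge 2$, let $\mathbf n=(1,n_2,\dots,n_r)$ and $\mathbf d=(1,d_2,\dots,d_r)$ be tuples of positive integers with $n_2\le n_3\le\dots\le n_r$, and set $d:=\min\{d_2,\dots,d_r\}-1$. If $h\ge 1$ and $$h<h_{n_2+1}(d),$$ then $SV^{\mathbf n}_{\mathbf d}$ is not $h$-tangentially weakly defective; more precisely,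 $\dim\Gamma_{x_1,\dots,x_h}=0$ for general $x_1,\dots,x_h\in SV^{\mathbf n}_{\mathbf d}$. Moreover $SV^{\mathbf n}_{\mathbf d}$ is $h$-identifiable and it is not $h$-defective. The bound satisfies, for fixed $d\ge 1$ and $n_2\to\infty$, $$h_{n_2+1}(d)\sim n_2^{\lfloor\log_2(d+1)\rfloor-1}.$$ -/

import Mathlib

open scoped LinearAlgebra.Projectivization Asymptotics
open Filter Topology

noncomputable section

namespace SecantGeometry

/-! ### Zariski topologies

Projective space, its powers and the Grassmannian are geometric quotients of open subsets of
affine space (by `ℂˣ`, `(ℂˣ)ʰ` and `GL_k`), so their Zariski topologies are the quotient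
topologies of the Zariski topology of affine space. -/

/-- The Zariski topology on the affine space `ℂ^τ`: the closed sets are the common zero loci of
sets of polynomials. -/
abbrev affineZariski (τ : Type) : TopologicalSpace (τ → ℂ) :=
  TopologicalSpace.induced
    (MvPolynomial.pointToPoint : (τ → ℂ) → PrimeSpectrum (MvPolynomial τ ℂ)) inferInstance

variable {σ : Type}

/-- The projective space with homogeneous coordinates indexed by `σ`; a set is Zariski closed if
and only if the cone over it is Zariski closed in `ℂ^σ \ {0}`. -/
instance projZariski : TopologicalSpace (ℙ ℂ (σ → ℂ)) :=
  TopologicalSpace.coinduced (fun v : {v : σ → ℂ // v ≠ 0} => Projectivization.mk ℂ v.1 v.2)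
    (TopologicalSpace.induced Subtype.val (affineZariski σ))

/-- The Zariski topology on the `h`-fold product `ℙ^N × ⋯ × ℙ^N` (finer than the product
topology). -/
abbrev projPowZariski (σ : Type) (h : ℕ) : TopologicalSpace (Fin h → ℙ ℂ (σ → ℂ)) :=
  TopologicalSpace.coinduced
    (fun (v : {v : Fin h → σ → ℂ // ∀ i, v i ≠ 0}) (i : Fin h) =>
      Projectivization.mk ℂ (v.1 i) (v.2 i))
    (TopologicalSpace.induced (fun v (ij : Fin h × σ) => v.1 ij.1 ij.2)
      (affineZariski (Fin h × σ)))

/-- The Grassmannian of `k`-dimensional linear subspaces of `ℂ^σ`, that is, of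
`(k-1)`-dimensional linear subspaces of the projective space. -/
def Grass (σ : Type) (k : ℕ) : Type :=
  {L : Submodule ℂ (σ → ℂ) // Module.finrank ℂ L = k}

/-- The Zariski topology on the Grassmannian: the quotient topology of the Zariski topology on
the space of `k`-frames (linearly independent `k`-tuples of vectors). -/
instance grassZariski {k : ℕ} : TopologicalSpace (Grass σ k) :=
  TopologicalSpace.coinduced
    (fun v : {v : Fin k → σ → ℂ // LinearIndependent ℂ v} =>
      (⟨Submodule.span ℂ (Set.range v.1), by
        simpa using finrank_span_eq_card v.2⟩ : Grass σ k))
    (TopologicalSpace.induced (fun v (ij : Fin k × σ) => v.1 ij.1 ij.2)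
      (affineZariski (Fin k × σ)))

/-- `P` holds for `h` general points of `X`: it holds on a nonempty Zariski open subset
of `X × ⋯ × X`. -/
def ForGeneralPoints (X : Set (ℙ ℂ (σ → ℂ))) (h : ℕ)
    (P : (Fin h → ℙ ℂ (σ → ℂ)) → Prop) : Prop :=
  ∃ U : Set (Fin h → ℙ ℂ (σ → ℂ)), IsOpen[projPowZariski σ h] U ∧
    (∃ x ∈ U, ∀ i, x i ∈ X) ∧ ∀ x ∈ U, (∀ i, x i ∈ X) → P x

/-! ### Secant varieties, defectiveness and identifiability -/

/-- The closure `𝒮_h(X)` in the Grassmannian of the set of linear spans of `h` linearly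
independent points of `X` (that the span has vector space dimension `h` is part of being an
element of `Grass σ h`). -/
def secantPlanes (X : Set (ℙ ℂ (σ → ℂ))) (h : ℕ) : Set (Grass σ h) :=
  closure {L | ∃ x : Fin h → ℙ ℂ (σ → ℂ), (∀ i, x i ∈ X) ∧ L.1 = ⨆ i, (x i).submodule}

/-- The abstract `h`-secant variety `Sec_h(X)`. -/
def abstractSecant (X : Set (ℙ ℂ (σ → ℂ))) (h : ℕ) : Set (ℙ ℂ (σ → ℂ) × Grass σ h) :=
  {pL | pL.1.submodule ≤ pL.2.1 ∧ pL.2 ∈ secantPlanes X h}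

/-- The `h`-secant variety, the image of `Sec_h(X)` in the projective space. -/
def secantVariety (X : Set (ℙ ℂ (σ → ℂ))) (h : ℕ) : Set (ℙ ℂ (σ → ℂ)) :=
  Prod.fst '' abstractSecant X h

/-- `X` is `h`-defective if `dim sec_h(X) < min {h dim X + h - 1, N}`. Dimensions are Krull
dimensions in the Zariski topology, both sides are increased by one, and `N + 1` is the number of
homogeneous coordinates. -/
def IsDefective [Fintype σ] (X : Set (ℙ ℂ (σ → ℂ))) (h : ℕ) : Prop :=
  topologicalKrullDim (secantVariety X h) + 1 <
    min ((h : WithBot ℕ∞) * (topologicalKrullDim X + 1)) (Fintype.card σ : WithBot ℕ∞)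

/-- `p` lies in the linear span of some set of `h` distinct points of `X`. -/
def InSpanOfPoints (X : Set (ℙ ℂ (σ → ℂ))) (p : ℙ ℂ (σ → ℂ)) (h : ℕ) : Prop :=
  ∃ y : Finset (ℙ ℂ (σ → ℂ)), y.card = h ∧ (∀ q ∈ y, q ∈ X) ∧
    p.submodule ≤ ⨆ q ∈ y, q.submodule

/-- `p` has rank `h` with respect to `X`. -/
def HasRank (X : Set (ℙ ℂ (σ → ℂ))) (p : ℙ ℂ (σ → ℂ)) (h : ℕ) : Prop :=
  InSpanOfPoints X p h ∧ ∀ k < h, ¬ InSpanOfPoints X p k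

/-- `p` is `h`-identifiable with respect to `X`: it has rank `h`, and the fibre over `p` of the
projection `Sec_h(X) → ℙ^N` is a single point. -/
def IsIdentifiableAt (X : Set (ℙ ℂ (σ → ℂ))) (h : ℕ) (p : ℙ ℂ (σ → ℂ)) : Prop :=
  HasRank X p h ∧ ∃! z : ℙ ℂ (σ → ℂ) × Grass σ h, z ∈ abstractSecant X h ∧ z.1 = p

/-- `X` is `h`-identifiable: the general point of `sec_h(X)` is `h`-identifiable. -/
def IsIdentifiable (X : Set (ℙ ℂ (σ → ℂ))) (h : ℕ) : Prop :=
  ∃ U : Set (ℙ ℂ (σ → ℂ)), IsOpen U ∧ (U ∩ secantVariety X h).Nonempty ∧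
    ∀ p ∈ U ∩ secantVariety X h, IsIdentifiableAt X h p

/-! ### Tangent spaces and tangential weak defectiveness -/

/-- The homogeneous polynomials vanishing on `X`. -/
def homogeneousEquations (X : Set (ℙ ℂ (σ → ℂ))) : Set (MvPolynomial σ ℂ) :=
  {f | (∃ k, f.IsHomogeneous k) ∧ ∀ q ∈ X, MvPolynomial.eval q.rep f = 0}

/-- The embedded projective tangent space of `X` at `p`, as a linear subspace of `ℂ^σ`:
`∑ₛ ∂f/∂xₛ(p) vₛ = 0` for every homogeneous equation `f` of `X`. -/
def tangentSpace [Fintype σ] (X : Set (ℙ ℂ (σ → ℂ))) (p : ℙ ℂ (σ → ℂ)) :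
    Submodule ℂ (σ → ℂ) :=
  ⨅ f ∈ homogeneousEquations X, LinearMap.ker
    (∑ s, MvPolynomial.eval p.rep (MvPolynomial.pderiv s f) •
      (LinearMap.proj s : (σ → ℂ) →ₗ[ℂ] ℂ))

/-- The locus of points of the (smooth) variety `X` at which the linear space `L` is tangent
to `X`. -/
def tangencyLocus [Fintype σ] (X : Set (ℙ ℂ (σ → ℂ))) (L : Submodule ℂ (σ → ℂ)) :
    Set (ℙ ℂ (σ → ℂ)) :=
  {q | q ∈ X ∧ tangentSpace X q ≤ L}

/-- The irreducible components of a subset of the projective space. -/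
def componentsOf (S : Set (ℙ ℂ (σ → ℂ))) : Set (Set (ℙ ℂ (σ → ℂ))) :=
  {C | Maximal (fun T => IsIrreducible T ∧ T ⊆ S) C}

/-- The `h`-tangential contact locus `Γ_{x₁,…,x_h}`: the closure in `X` of the union of those
irreducible components of the locus where `⟨T_{x₁}X, …, T_{x_h}X⟩` is tangent to `X` that contain
at least one of the `xᵢ`. -/
def contactLocus [Fintype σ] (X : Set (ℙ ℂ (σ → ℂ))) {h : ℕ} (x : Fin h → ℙ ℂ (σ → ℂ)) :
    Set (ℙ ℂ (σ → ℂ)) :=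
  closure (⋃₀ {C | C ∈ componentsOf (tangencyLocus X (⨆ i, tangentSpace X (x i))) ∧
    ∃ i, x i ∈ C}) ∩ X

/-- `X` is `h`-tangentially weakly defective: the tangential contact locus of `h` general points
of `X` has positive dimension. -/
def IsTangentiallyWeaklyDefective [Fintype σ] (X : Set (ℙ ℂ (σ → ℂ))) (h : ℕ) : Prop :=
  ForGeneralPoints X h fun x => 0 < topologicalKrullDim (contactLocus X x)

/-! ### Segre-Veronese varieties -/

/-- The index set of the monomials of multidegree `d` in `r` groups of variables, the `i`-th group
having `n i + 1` variables: the `i`-th component is a multiset of size `d i` of variables. -/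
abbrev MonomialIndex {r : ℕ} (n d : Fin r → ℕ) : Type :=
  ∀ i, Sym (Fin (n i + 1)) (d i)

/-- All monomials of multidegree `d`, evaluated at `x`. -/
def monomials {r : ℕ} (n d : Fin r → ℕ) (x : ∀ i, Fin (n i + 1) → ℂ) :
    MonomialIndex n d → ℂ :=
  fun J => ∏ i, ((J i : Multiset (Fin (n i + 1))).map (x i)).prod

theorem monomials_ne_zero {r : ℕ} (n d : Fin r → ℕ) (x : ∀ i, Fin (n i + 1) → ℂ)
    (hx : ∀ i, x i ≠ 0) : monomials n d x ≠ 0 := by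
  choose j hj using fun i => Function.ne_iff.1 (hx i)
  intro h0
  have h1 := congrFun h0 fun i => Sym.replicate (d i) (j i)
  simp only [monomials, Pi.zero_apply, Finset.prod_eq_zero_iff] at h1
  obtain ⟨i, -, hi⟩ := h1
  rw [Sym.coe_replicate, Multiset.map_replicate, Multiset.prod_replicate] at hi
  exact pow_ne_zero _ (hj i) hi

/-- The embedding of `ℙ^{n₁} × ⋯ × ℙ^{n_r}` by the complete linear system `|𝒪(d₁, …, d_r)|`. -/
def segreVeroneseMap {r : ℕ} (n d : Fin r → ℕ) (x : ∀ i, ℙ ℂ (Fin (n i + 1) → ℂ)) :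
    ℙ ℂ (MonomialIndex n d → ℂ) :=
  Projectivization.mk ℂ (monomials n d fun i => (x i).rep)
    (monomials_ne_zero n d _ fun i => (x i).rep_nonzero)

/-- The Segre-Veronese variety. -/
def segreVeronese {r : ℕ} (n d : Fin r → ℕ) : Set (ℙ ℂ (MonomialIndex n d → ℂ)) :=
  Set.range (segreVeroneseMap n d)

/-- The function `h_m`: if `k + 1 = 2^{λ₁} + ⋯ + 2^{λ_a} + ε` with `λ₁ > ⋯ > λ_a ≥ 1` and
`ε ∈ {0, 1}`, then `h_m(k) = m^{λ₁ - 1} + ⋯ + m^{λ_a - 1}`. The `λⱼ` are the nonzero elements of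
the list of exponents in the binary expansion of `k + 1`; for `k = 0` there are none. -/
def hFun (m k : ℕ) : ℕ :=
  (((k + 1).bitIndices.filter fun l => 1 ≤ l).map fun l => m ^ (l - 1)).sum

end SecantGeometry

end

noncomputable section

namespace SecantGeometry

open MvPolynomial

/-! ### The Zariski topology in terms of polynomials -/

theorem aeval_apply_eq_eval {τ : Type*} (t : τ → ℂ) (f : MvPolynomial τ ℂ) :
    aeval t f = eval t f := by
  rw [← coe_aeval_eq_eval]
  rfl

theorem isOpen_affineZariski_iff {τ : Type} {U : Set (τ → ℂ)} :
    IsOpen[affineZariski τ] U ↔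
      ∀ t ∈ U, ∃ f : MvPolynomial τ ℂ, eval t f ≠ 0 ∧ ∀ s, eval s f ≠ 0 → s ∈ U := by
  have hmem : ∀ (t : τ → ℂ) (f : MvPolynomial τ ℂ),
      (pointToPoint t : PrimeSpectrum (MvPolynomial τ ℂ)) ∈ PrimeSpectrum.basicOpen f ↔
        eval t f ≠ 0 := by
    intro t f
    rw [PrimeSpectrum.mem_basicOpen]
    change f ∉ vanishingIdeal ℂ {t} ↔ _
    rw [mem_vanishingIdeal_singleton_iff, aeval_apply_eq_eval]
  constructor
  · intro hU t ht
    obtain ⟨V, hV, rfl⟩ := isOpen_induced_iff.1 hU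
    obtain ⟨_, ⟨f, rfl⟩, hf, hfV⟩ :=
      PrimeSpectrum.isTopologicalBasis_basic_opens.exists_subset_of_mem_open ht hV
    exact ⟨f, (hmem t f).1 hf, fun s hs => hfV ((hmem s f).2 hs)⟩
  · intro H
    choose f hf hfU using H
    refine isOpen_induced_iff.2 ⟨⋃ t : U, (PrimeSpectrum.basicOpen (f t t.2)).1,
      isOpen_iUnion fun t => (PrimeSpectrum.basicOpen _).2, ?_⟩
    ext s
    simp only [Set.preimage_iUnion, Set.mem_iUnion, Set.mem_preimage]
    exact ⟨fun ⟨t, ht⟩ => hfU t t.2 s ((hmem s _).1 ht),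
      fun hs => ⟨⟨s, hs⟩, (hmem s _).2 (hf s hs)⟩⟩

/-- Open sets of a quotient of a subspace of affine space. -/
theorem isOpen_coinduced_affineZariski_iff {τ S Y : Type} (q : S → Y) (i : S → τ → ℂ)
    {U : Set Y} :
    IsOpen[TopologicalSpace.coinduced q (TopologicalSpace.induced i (affineZariski τ))] U ↔
      ∀ s, q s ∈ U → ∃ f : MvPolynomial τ ℂ, eval (i s) f ≠ 0 ∧
        ∀ s', eval (i s') f ≠ 0 → q s' ∈ U := by
  refine isOpen_coinduced.trans ((@isOpen_induced_iff _ _ (affineZariski τ) _ i).trans ?_)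
  constructor
  · rintro ⟨V, hV, hVU⟩ s hs
    have hs' : i s ∈ V := by
      have : s ∈ q ⁻¹' U := hs
      rwa [← hVU] at this
    obtain ⟨f, hf, hfV⟩ := isOpen_affineZariski_iff.1 hV _ hs'
    refine ⟨f, hf, fun s' hs' => ?_⟩
    have : s' ∈ i ⁻¹' V := hfV _ hs'
    rwa [hVU] at this
  · intro H
    choose f hf hfU using H
    refine ⟨{t | ∃ s, ∃ hs : q s ∈ U, eval t (f s hs) ≠ 0}, ?_, ?_⟩
    · rw [isOpen_affineZariski_iff]
      rintro t ⟨s, hs, ht⟩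
      exact ⟨f s hs, ht, fun t' ht' => ⟨s, hs, ht'⟩⟩
    · ext s
      exact ⟨fun ⟨s', hs', h⟩ => hfU s' hs' s h, fun hs => ⟨s, hs, hf s hs⟩⟩

variable {σ : Type}

theorem isOpen_proj_iff {U : Set (ℙ ℂ (σ → ℂ))} :
    IsOpen U ↔ ∀ (v : σ → ℂ) (hv : v ≠ 0), Projectivization.mk ℂ v hv ∈ U →
      ∃ f : MvPolynomial σ ℂ, eval v f ≠ 0 ∧
        ∀ (w : σ → ℂ) (hw : w ≠ 0), eval w f ≠ 0 → Projectivization.mk ℂ w hw ∈ U := by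
  refine (isOpen_coinduced_affineZariski_iff
    (fun v : {v : σ → ℂ // v ≠ 0} => Projectivization.mk ℂ v.1 v.2) Subtype.val).trans ?_
  simp only [Subtype.forall]

theorem isOpen_projPow_iff {h : ℕ} {U : Set (Fin h → ℙ ℂ (σ → ℂ))} :
    IsOpen[projPowZariski σ h] U ↔ ∀ (v : Fin h → σ → ℂ) (hv : ∀ i, v i ≠ 0),
      (fun i => Projectivization.mk ℂ (v i) (hv i)) ∈ U →
      ∃ f : MvPolynomial (Fin h × σ) ℂ, eval (fun ij => v ij.1 ij.2) f ≠ 0 ∧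
        ∀ (w : Fin h → σ → ℂ) (hw : ∀ i, w i ≠ 0), eval (fun ij => w ij.1 ij.2) f ≠ 0 →
          (fun i => Projectivization.mk ℂ (w i) (hw i)) ∈ U := by
  refine (isOpen_coinduced_affineZariski_iff
    (fun (v : {v : Fin h → σ → ℂ // ∀ i, v i ≠ 0}) (i : Fin h) =>
      Projectivization.mk ℂ (v.1 i) (v.2 i)) (fun v (ij : Fin h × σ) => v.1 ij.1 ij.2)).trans ?_
  simp only [Subtype.forall]

/-- A homogeneity-free way to describe open subsets of the projective space. -/
theorem isOpen_setOf_exists_eval_ne_zero {ι : Type*} (F : ι → MvPolynomial σ ℂ) :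
    IsOpen {q : ℙ ℂ (σ → ℂ) | ∃ i, ∃ c : ℂ, c ≠ 0 ∧ eval (c • q.rep) (F i) ≠ 0} := by
  rw [isOpen_proj_iff]
  rintro v hv ⟨i, c, hc, hF⟩
  obtain ⟨a, ha⟩ := Projectivization.exists_smul_eq_mk_rep ℂ v hv
  have hcomp : ∀ (b : ℂ) (w : σ → ℂ),
      eval w (bind₁ (fun s => C b * X s) (F i)) = eval (b • w) (F i) := by
    intro b w
    rw [← aeval_apply_eq_eval, ← aeval_apply_eq_eval, aeval_bind₁]
    congr 1
    ext s
    simp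
  refine ⟨bind₁ (fun s => C (c * a) * X s) (F i), ?_, fun w hw hwF => ?_⟩
  · rw [hcomp, mul_smul]
    rw [← ha] at hF
    exact hF
  · obtain ⟨b, hb⟩ := Projectivization.exists_smul_eq_mk_rep ℂ w hw
    refine ⟨i, c * a * (b : ℂ)⁻¹, by simp [hc], ?_⟩
    rw [hcomp] at hwF
    rw [← hb, Units.smul_def, smul_smul]
    simpa using hwF

/-- The zero locus of a polynomial in the projective space, in the sense that all multiples of
representatives are zeros. -/
theorem isClosed_setOf_forall_eval_eq_zero {ι : Type*} (F : ι → MvPolynomial σ ℂ) :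
    IsClosed {q : ℙ ℂ (σ → ℂ) | ∀ i, ∀ c : ℂ, c ≠ 0 → eval (c • q.rep) (F i) = 0} := by
  rw [← isOpen_compl_iff]
  convert isOpen_setOf_exists_eval_ne_zero F using 1
  ext q
  simp

theorem exists_eval_ne_zero {τ : Type*} {f : MvPolynomial τ ℂ} (hf : f ≠ 0) :
    ∃ t, eval t f ≠ 0 := by
  by_contra! H
  exact hf (MvPolynomial.funext fun t => by simpa using H t)

/-- A point is cut out by the `2 × 2` minors of its coordinates against those of the variable point.
This makes finite contact loci closed and discrete. -/
instance projT1Space : T1Space (ℙ ℂ (σ → ℂ)) := by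
  refine ⟨fun p => ?_⟩
  convert isClosed_setOf_forall_eval_eq_zero
    (fun ij : σ × σ => C (p.rep ij.1) * X ij.2 - C (p.rep ij.2) * X ij.1 :
      σ × σ → MvPolynomial σ ℂ) using 1
  ext q
  simp only [Set.mem_singleton_iff, Set.mem_ofPred_eq, Prod.forall]
  constructor
  · rintro rfl i j c -
    simp
    ring
  · intro H
    obtain ⟨i, hi⟩ := Function.ne_iff.1 p.rep_nonzero
    rw [Pi.zero_apply] at hi
    have key : ∀ j, p.rep i * q.rep j = p.rep j * q.rep i := by
      intro j
      have := H i j 1 one_ne_zero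
      simpa [sub_eq_zero] using this
    have hqi : q.rep i ≠ 0 := by
      intro h0
      refine q.rep_nonzero (funext fun j => ?_)
      have := key j
      rw [h0, mul_zero] at this
      exact (mul_eq_zero.1 this).resolve_left hi
    rw [← p.mk_rep, ← q.mk_rep, Projectivization.mk_eq_mk_iff']
    refine ⟨q.rep i / p.rep i, funext fun j => ?_⟩
    have := key j
    simp only [Pi.smul_apply, smul_eq_mul]
    field_simp
    linear_combination -this

/-! ### Images of polynomial maps -/

/-- The points of the closure of the image of a polynomial map that satisfy a suitable
inequality `u ≠ 0` are images of points satisfying a given inequality `g ≠ 0`. -/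
theorem exists_open_subset_image {ρ : Type} [Finite σ] [Finite ρ]
    (φ : σ → MvPolynomial ρ ℂ) {g : MvPolynomial ρ ℂ} (hg : g ≠ 0) :
    ∃ u : MvPolynomial σ ℂ, aeval φ u ≠ 0 ∧ ∀ v : σ → ℂ,
      (∀ P : MvPolynomial σ ℂ, aeval φ P = 0 → eval v P = 0) → eval v u ≠ 0 →
      ∃ t, eval t g ≠ 0 ∧ ∀ s, eval t (φ s) = v s := by
  let f : MvPolynomial σ ℂ →+* MvPolynomial ρ ℂ := (aeval φ).toRingHom
  have hfin : f.FinitePresentation := by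
    have h1 : f.FiniteType := by
      refine RingHom.FiniteType.of_comp_finiteType (f := (C : ℂ →+* MvPolynomial σ ℂ)) ?_
      have : f.comp C = algebraMap ℂ (MvPolynomial ρ ℂ) := by
        ext1 c
        simp [f, algebraMap_eq]
      rw [this, RingHom.finiteType_algebraMap]
      infer_instance
    exact (RingHom.FinitePresentation.of_finiteType).1 h1
  have hc := PrimeSpectrum.isConstructible_comap_image hfin
    (s := (PrimeSpectrum.basicOpen g : Set _))
    (PrimeSpectrum.isConstructible_basicOpen)
  obtain ⟨S, hS⟩ := PrimeSpectrum.exists_constructibleSetData_iff.2 hc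
  -- The image of `D(g)` is constructible by Chevalley and contains the image of the generic point.
  -- The locally closed piece containing that image is `V(ker f)` minus a hypersurface near the
  -- generic point; the equation of the hypersurface is the required `u`.
  have hbot : PrimeSpectrum.comap f ⟨⊥, Ideal.isPrime_bot⟩ ∈ S.toSet := by
    rw [hS]
    exact ⟨_, by simpa [PrimeSpectrum.mem_basicOpen] using hg, rfl⟩
  simp only [PrimeSpectrum.ConstructibleSetData.toSet, Set.mem_iUnion] at hbot
  obtain ⟨D, hD, hbot⟩ := hbot
  refine ⟨D.f, ?_, fun v hv hu => ?_⟩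
  · have := hbot.2
    intro h0
    apply this
    simpa [PrimeSpectrum.mem_zeroLocus, f] using h0
  · have hmem : (pointToPoint v : PrimeSpectrum (MvPolynomial σ ℂ)) ∈ S.toSet := by
      simp only [PrimeSpectrum.ConstructibleSetData.toSet, Set.mem_iUnion]
      refine ⟨D, hD, ?_, ?_⟩
      · intro P hP
        have : P ∈ (PrimeSpectrum.comap f ⟨⊥, Ideal.isPrime_bot⟩).asIdeal := hbot.1 hP
        have h2 : aeval φ P = 0 := by simpa [f] using this
        change P ∈ vanishingIdeal ℂ {v}
        rw [mem_vanishingIdeal_singleton_iff, aeval_apply_eq_eval]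
        exact hv P h2
      · intro H
        have : D.f ∈ vanishingIdeal ℂ {v} := H rfl
        rw [mem_vanishingIdeal_singleton_iff, aeval_apply_eq_eval] at this
        exact hu this
    rw [hS] at hmem
    obtain ⟨Q, hQg, hQ⟩ := hmem
    -- The preimage of the closed point `v` is only a prime `Q` not containing `g`. By the
    -- Nullstellensatz the zero locus of `Q` has a closed point with `g ≠ 0`, and it still maps to
    -- `v`.
    have hQz : g ∉ vanishingIdeal ℂ (zeroLocus ℂ Q.asIdeal) := by
      rw [vanishingIdeal_zeroLocus_eq_radical, Q.2.radical]
      exact hQg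
    rw [mem_vanishingIdeal_iff] at hQz
    push Not at hQz
    obtain ⟨t, htQ, htg⟩ := hQz
    rw [aeval_apply_eq_eval] at htg
    refine ⟨t, htg, fun s => ?_⟩
    have h1 : X s - C (v s) ∈ (PrimeSpectrum.comap f Q).asIdeal := by
      rw [hQ]
      change _ ∈ vanishingIdeal ℂ {v}
      rw [mem_vanishingIdeal_singleton_iff]
      simp
    have h2 := htQ _ (show f (X s - C (v s)) ∈ Q.asIdeal from h1)
    simp only [f, AlgHom.toRingHom_eq_coe, RingHom.coe_coe, map_sub, aeval_X, algHom_C,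
      algebraMap_eq] at h2
    rw [aeval_apply_eq_eval, sub_eq_zero] at h2
    simpa using h2

end SecantGeometry

end

noncomputable section

namespace SecantGeometry

/-! ### The function `h_m` -/

theorem sum_bitIndices_two_mul (m k : ℕ) :
    ((2 * k).bitIndices.map (m ^ ·)).sum = m * (k.bitIndices.map (m ^ ·)).sum := by
  rw [Nat.bitIndices_two_mul, List.map_map, ← List.sum_map_mul_left]
  congr 1
  exact List.map_congr_left fun i _ => by simp [pow_succ, mul_comm]

theorem sum_bitIndices_two_mul_add_one (m k : ℕ) :
    ((2 * k + 1).bitIndices.map (m ^ ·)).sum = m * (k.bitIndices.map (m ^ ·)).sum + 1 := by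
  rw [← sum_bitIndices_two_mul, Nat.bitIndices_two_mul_add_one, Nat.bitIndices_two_mul,
    List.map_cons, List.sum_cons, pow_zero, add_comm]

/-- Discarding the bit `ε` of `e + 1` and lowering the other exponents by one yields the binary
expansion of `⌊(e + 1) / 2⌋`. -/
theorem hFun_eq_sum_bitIndices (m e : ℕ) :
    hFun m e = (((e + 1) / 2).bitIndices.map (m ^ ·)).sum := by
  have key : ∀ L : List ℕ,
      (((L.map (· + 1)).filter fun l => 1 ≤ l).map fun l => m ^ (l - 1)) = L.map (m ^ ·) := by
    intro L
    rw [List.filter_eq_self.2 (by simp), List.map_map]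
    exact List.map_congr_left fun i _ => by simp
  unfold hFun
  obtain ⟨k, hk⟩ := Nat.even_or_odd' (e + 1)
  rcases hk with hk | hk
  · rw [hk, Nat.bitIndices_two_mul, key]
    simp
  · rw [hk, Nat.bitIndices_two_mul_add_one, List.filter_cons_of_neg (by simp), key]
    congr 4
    omega

/-! ### Comparison of `h_m` with the number of monomials, and its growth -/

/-- The map `(x_a, u) ↦ x_a u²` on monomials is injective: `x_a` is the only variable of odd
exponent, and then `u` is recovered by halving. -/
theorem mul_card_sym_le (m s : ℕ) :
    m * Fintype.card (Sym (Fin m) s) ≤ Fintype.card (Sym (Fin m) (2 * s + 1)) := by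
  have : Fintype.card (Fin m × Sym (Fin m) s) ≤ Fintype.card (Sym (Fin m) (2 * s + 1)) := by
    refine Fintype.card_le_of_injective
      (fun p => ⟨p.1 ::ₘ (2 • (p.2 : Multiset (Fin m))), by simp⟩) ?_
    rintro ⟨a, s⟩ ⟨b, u⟩ H
    have hc := congrArg Subtype.val H
    dsimp only at hc
    have hab : a = b := by
      by_contra hne
      have := congrArg (Multiset.count a) hc
      rw [Multiset.count_cons_self, Multiset.count_cons_of_ne hne, Multiset.count_nsmul,
        Multiset.count_nsmul] at this
      omega
    subst hab
    refine Prod.ext rfl (Subtype.ext (Multiset.ext.2 fun c => ?_))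
    have := congrArg (Multiset.count c) ((Multiset.cons_inj_right a).1 hc)
    rw [Multiset.count_nsmul, Multiset.count_nsmul] at this
    change Multiset.count c (s : Multiset (Fin m)) = Multiset.count c (u : Multiset (Fin m))
    omega
  simpa using this

/-- Multiplication by the first variable is injective on monomials and misses the powers of the
second. -/
theorem card_sym_lt_card_sym_succ {m : ℕ} (hm : 2 ≤ m) (s : ℕ) :
    Fintype.card (Sym (Fin m) s) < Fintype.card (Sym (Fin m) (s + 1)) := by
  refine Fintype.card_lt_of_injective_of_notMem (fun u => (⟨0, by omega⟩ : Fin m) ::ₛ u)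
    (fun u v => Sym.cons_inj_right _ _ _ |>.1) (b := Sym.replicate (s + 1) ⟨1, by omega⟩) ?_
  rintro ⟨u, hu⟩
  have : (⟨0, by omega⟩ : Fin m) ∈ Sym.replicate (s + 1) (⟨1, by omega⟩ : Fin m) := by
    rw [← hu]
    exact Sym.mem_cons_self _ _
  rw [Sym.mem_replicate] at this
  simp at this

/-- Induction along the binary expansion: doubling `s + 1` multiplies the left side by `m`, covered
by `mul_card_sym_le`; an additional last bit adds `1`, covered by the strict growth of the number of
monomials. -/
theorem sum_bitIndices_le_card_sym {m : ℕ} (hm : 2 ≤ m) (s : ℕ) :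
    ((s + 1).bitIndices.map (m ^ ·)).sum ≤ Fintype.card (Sym (Fin m) s) := by
  induction s using Nat.strong_induction_on with
  | _ s ih =>
    obtain ⟨k, hk⟩ := Nat.even_or_odd' (s + 1)
    rcases hk with hk | hk
    · obtain ⟨j, rfl⟩ : ∃ j, k = j + 1 := ⟨k - 1, by omega⟩
      obtain rfl : s = 2 * j + 1 := by omega
      rw [hk, sum_bitIndices_two_mul]
      exact (Nat.mul_le_mul_left m (ih j (by omega))).trans (mul_card_sym_le m j)
    · rcases Nat.eq_zero_or_pos k with rfl | hk0
      · obtain rfl : s = 0 := by omega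
        simp
      · obtain ⟨j, rfl⟩ : ∃ j, k = j + 1 := ⟨k - 1, by omega⟩
        obtain rfl : s = 2 * j + 1 + 1 := by omega
        rw [hk, sum_bitIndices_two_mul_add_one]
        have h1 := (Nat.mul_le_mul_left m (ih j (by omega))).trans (mul_card_sym_le m j)
        have h2 := card_sym_lt_card_sym_succ hm (2 * j + 1)
        omega

/-- The same binary recursion as for the upper bound: each doubling contributes a factor `x + 1 ~
x`, and the added `1` is negligible against a power of positive exponent. -/
theorem sum_bitIndices_isEquivalent (s : ℕ) :
    (fun x : ℕ => ((((s + 1).bitIndices.map ((x + 1) ^ ·)).sum : ℕ) : ℝ)) ~[atTop]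
      (fun x : ℕ => (x : ℝ) ^ Nat.log 2 (s + 1)) := by
  have hx : (fun x : ℕ => ((x + 1 : ℕ) : ℝ)) ~[atTop] (fun x : ℕ => (x : ℝ)) := by
    have : (fun x : ℕ => (x : ℝ) + 1) ~[atTop] (fun x : ℕ => (x : ℝ)) := by
      refine Asymptotics.IsEquivalent.refl.add_isLittleO ?_
      rw [Asymptotics.isLittleO_const_left]
      exact Or.inr (tendsto_norm_atTop_atTop.comp tendsto_natCast_atTop_atTop)
    simpa using this
  induction s using Nat.strong_induction_on with
  | _ s ih =>
    have step : ∀ j, j < s → (fun x : ℕ => (((x + 1) *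
        ((j + 1).bitIndices.map ((x + 1) ^ ·)).sum : ℕ) : ℝ)) ~[atTop]
        (fun x : ℕ => (x : ℝ) ^ (Nat.log 2 (j + 1) + 1)) := by
      intro j hj
      have := hx.mul (ih j hj)
      refine (this.congr_left ?_).congr_right ?_
      · filter_upwards with x
        simp
      · filter_upwards with x
        simp [pow_succ, mul_comm]
    obtain ⟨k, hk⟩ := Nat.even_or_odd' (s + 1)
    rcases hk with hk | hk
    · obtain ⟨j, rfl⟩ : ∃ j, k = j + 1 := ⟨k - 1, by omega⟩
      simp only [hk, sum_bitIndices_two_mul]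
      rw [mul_comm 2 (j + 1), Nat.log_mul_base (by norm_num) (by omega)]
      exact step j (by omega)
    · rcases Nat.eq_zero_or_pos k with rfl | hk0
      · obtain rfl : s = 0 := by omega
        simp
        rfl
      · obtain ⟨j, rfl⟩ : ∃ j, k = j + 1 := ⟨k - 1, by omega⟩
        simp only [hk, sum_bitIndices_two_mul_add_one]
        have hlog : Nat.log 2 (2 * (j + 1) + 1) = Nat.log 2 (j + 1) + 1 := by
          rw [Nat.log_of_one_lt_of_le (by norm_num) (by omega)]
          congr 2
          omega
        rw [hlog]
        push_cast
        have h1 := step j (by omega)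
        push_cast at h1
        refine h1.add_isLittleO ?_
        rw [Asymptotics.isLittleO_const_left]
        refine Or.inr (tendsto_norm_atTop_atTop.comp ?_)
        exact (tendsto_pow_atTop (by omega)).comp tendsto_natCast_atTop_atTop

theorem hFun_isEquivalent {e : ℕ} (he : 1 ≤ e) :
    (fun x : ℕ => (hFun (x + 1) e : ℝ)) ~[atTop]
      (fun x : ℕ => (x : ℝ) ^ (Nat.log 2 (e + 1) - 1)) := by
  obtain ⟨s, hs⟩ : ∃ s, (e + 1) / 2 = s + 1 := ⟨(e + 1) / 2 - 1, by omega⟩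
  have hlog : Nat.log 2 (e + 1) - 1 = Nat.log 2 (s + 1) := by
    rw [← hs, Nat.log_div_base]
  simp only [hFun_eq_sum_bitIndices, hlog, hs]
  exact sum_bitIndices_isEquivalent s

end SecantGeometry

end

noncomputable section

namespace SecantGeometry

open MvPolynomial

/-! ### Algebraic independence and a lower bound for the Krull dimension -/

theorem pderiv_aeval {τ ρ : Type*} [Fintype τ] (θ : τ → MvPolynomial ρ ℂ) (b : ρ)
    (P : MvPolynomial τ ℂ) :
    pderiv b (aeval θ P) = ∑ a, aeval θ (pderiv a P) * pderiv b (θ a) := by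
  classical
  induction P using MvPolynomial.induction_on with
  | C c => simp [algebraMap_eq]
  | add p q hp hq => simp only [map_add, hp, hq, add_mul, Finset.sum_add_distrib]
  | mul_X p i hp =>
    simp only [map_mul, aeval_X, Derivation.leibniz, smul_eq_mul, hp, map_add, pderiv_X, add_mul,
      Finset.sum_add_distrib, Finset.mul_sum]
    congr 1
    · rw [Finset.sum_eq_single i]
      · simp
      · intro a _ ha
        simp [ha.symm]
      · simp
    · refine Finset.sum_congr rfl fun a _ => by ring

/-- Differentiating `P(θ) = 0` shows that the vector of all `(∂P/∂x_a)(θ)` is killed by the Jacobian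
matrix, whose determinant is nonzero because it is `1` at `s`. Thus every partial derivative of `P`
is a relation of smaller degree, hence zero by induction; in characteristic zero `P` is constant,
and so zero. -/
theorem eq_zero_of_aeval_eq_zero_of_jacobian {N : ℕ} (θ : Fin N → MvPolynomial (Fin N) ℂ)
    (s : Fin N → ℂ) (hJ : ∀ a b, eval s (pderiv b (θ a)) = if a = b then 1 else 0)
    (P : MvPolynomial (Fin N) ℂ) (hP : aeval θ P = 0) : P = 0 := by
  induction hn : P.totalDegree using Nat.strong_induction_on generalizing P with
  | _ k ih =>
    by_contra hP0
    let J : Matrix (Fin N) (Fin N) (MvPolynomial (Fin N) ℂ) := fun a b => pderiv b (θ a)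
    have hdet : J.det ≠ 0 := by
      intro h0
      have h1 := congrArg (eval s) h0
      rw [RingHom.map_det, map_zero] at h1
      have : (eval s).mapMatrix J = 1 := by
        ext a b
        rw [Matrix.one_apply, ← hJ a b]
        rfl
      rw [this, Matrix.det_one] at h1
      exact one_ne_zero h1
    have hvec : (fun a => aeval θ (pderiv a P)) = 0 := by
      refine Matrix.eq_zero_of_vecMul_eq_zero hdet ?_
      ext1 b
      have := pderiv_aeval θ b P
      rw [hP, map_zero] at this
      rw [Pi.zero_apply, this]
      rfl
    have hdeg : ∀ a, pderiv a P = 0 := by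
      intro a
      by_contra hne
      refine hne (ih _ ?_ (pderiv a P) (congrFun hvec a) rfl)
      obtain ⟨m, hm, hmd⟩ := Finset.exists_mem_eq_sup (pderiv a P).support
        (by simpa [Finset.nonempty_iff_ne_empty] using hne) fun u => u.sum fun _ e => e
      have h1 : m + Finsupp.single a 1 ∈ P.support := by
        rw [mem_support_iff] at hm ⊢
        rw [coeff_pderiv] at hm
        exact left_ne_zero_of_mul hm
      have h2 := le_totalDegree h1
      rw [Finsupp.sum_add_index' (by simp) (by simp)] at h2
      simp only [Finsupp.sum_single_index] at h2
      have h3 : (pderiv a P).totalDegree = m.sum fun _ e => e := hmd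
      omega
    have hC : ∀ m, m ≠ 0 → coeff m P = 0 := by
      intro m hm
      obtain ⟨a, ha⟩ := Finsupp.ne_iff.1 hm
      have ha' : Finsupp.single a 1 ≤ m := by
        rw [Finsupp.single_le_iff]
        simp at ha
        omega
      have := congrArg (coeff (m - Finsupp.single a 1)) (hdeg a)
      rw [coeff_pderiv, tsub_add_cancel_of_le ha', coeff_zero] at this
      refine (mul_eq_zero.1 this).resolve_right ?_
      exact Nat.cast_add_one_ne_zero _
    have hPC : P = C (coeff 0 P) := by
      ext m
      rw [coeff_C]
      split_ifs with h
      · rw [h]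
      · exact hC m (Ne.symm h)
    rw [hPC, aeval_C, algebraMap_eq] at hP
    rw [hPC] at hP0
    exact hP0 (by rw [C_eq_zero.1 hP, C_0])

/-- The transcendence degree of a polynomial ring in `N` variables is `N`. -/
theorem exists_aeval_eq_zero_of_succ (N : ℕ) (θ : Fin (N + 1) → MvPolynomial (Fin N) ℂ) :
    ∃ P : MvPolynomial (Fin (N + 1)) ℂ, P ≠ 0 ∧ aeval θ P = 0 := by
  by_contra! H
  have hind : AlgebraicIndependent ℂ θ := by
    rw [algebraicIndependent_iff]
    intro P hP
    by_contra hne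
    exact H P hne hP
  have := hind.cardinalMk_le_trdeg
  rw [MvPolynomial.trdeg_of_isDomain] at this
  simp only [Cardinal.mk_fin, Cardinal.lift_natCast] at this
  have := Nat.cast_le.1 this
  omega

theorem eval_aeval {τ ρ : Type*} (t : ρ → ℂ) (θ : τ → MvPolynomial ρ ℂ) (P : MvPolynomial τ ℂ) :
    eval t (aeval θ P) = eval (fun a => eval t (θ a)) P := by
  rw [← aeval_apply_eq_eval t, ← AlgHom.comp_apply, ← aeval_apply_eq_eval]
  congr 1
  ext a
  simp only [AlgHom.comp_apply, aeval_X, aeval_apply_eq_eval]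

variable {σ : Type}

/-- The set is the image of a nonempty open subset of an affine space: open sets meeting it pull
back to sets containing a nonempty principal open set, and a product of nonzero polynomials is
nonzero. -/
theorem isIrreducible_setOf_exists_eq_mk {τ : Type} (S : Set (ℙ ℂ (σ → ℂ)))
    (ψ : σ → MvPolynomial τ ℂ) {g : MvPolynomial τ ℂ} (hg : g ≠ 0)
    (hS : ∀ t, eval t g ≠ 0 →
      ∃ hv : (fun s => eval t (ψ s)) ≠ 0, Projectivization.mk ℂ _ hv ∈ S) :
    IsIrreducible {q : S | ∃ t, eval t g ≠ 0 ∧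
      ∃ hv : (fun s => eval t (ψ s)) ≠ 0, q.1 = Projectivization.mk ℂ _ hv} := by
  refine ⟨?_, ?_⟩
  · obtain ⟨t, ht⟩ := exists_eval_ne_zero hg
    obtain ⟨hv, hvS⟩ := hS t ht
    exact ⟨⟨_, hvS⟩, t, ht, hv, rfl⟩
  · have hopen : ∀ u : Set S, IsOpen u → ({q : S | ∃ t, eval t g ≠ 0 ∧
          ∃ hv : (fun s => eval t (ψ s)) ≠ 0, q.1 = Projectivization.mk ℂ _ hv} ∩ u).Nonempty →
        ∃ F : MvPolynomial τ ℂ, F ≠ 0 ∧ ∀ t, eval t F ≠ 0 →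
          ∀ hv : (fun s => eval t (ψ s)) ≠ 0,
          ∀ q : S, q.1 = Projectivization.mk ℂ _ hv → q ∈ u := by
      rintro u hu ⟨q, ⟨t, htg, hv, hq⟩, hqu⟩
      obtain ⟨V, hV, rfl⟩ := isOpen_induced_iff.1 hu
      have hqV : q.1 ∈ V := hqu
      rw [hq] at hqV
      obtain ⟨f, hf, hfV⟩ := isOpen_proj_iff.1 hV _ hv hqV
      refine ⟨aeval ψ f, fun h0 => hf ?_, fun t ht hv' q' hq' => ?_⟩
      · rw [← eval_aeval, h0, map_zero]
      · change q'.1 ∈ V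
        rw [hq']
        rw [eval_aeval] at ht
        exact hfV _ _ ht
    intro u w hu hw hEu hEw
    obtain ⟨F, hF, hFu⟩ := hopen u hu hEu
    obtain ⟨G, hG, hGw⟩ := hopen w hw hEw
    obtain ⟨t, ht⟩ := exists_eval_ne_zero (mul_ne_zero (mul_ne_zero hF hG) hg)
    rw [map_mul, map_mul] at ht
    have htg := right_ne_zero_of_mul ht
    obtain ⟨hv, hvS⟩ := hS _ htg
    exact ⟨⟨_, hvS⟩, ⟨_, htg, hv, rfl⟩,
      hFu t (left_ne_zero_of_mul (left_ne_zero_of_mul ht)) hv _ rfl,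
      hGw t (right_ne_zero_of_mul (left_ne_zero_of_mul ht)) hv _ rfl⟩

/-- The substitution that restricts polynomials to the affine subspace through `t₀` parallel to
the first `j` coordinates. -/
def restrictVar {M : ℕ} (t₀ : Fin M → ℂ) (j : ℕ) (b : Fin M) : MvPolynomial (Fin j) ℂ :=
  if hb : b.1 < j then X ⟨b, hb⟩ else C (t₀ b)

theorem eval_restrictVar_self {M : ℕ} (t₀ : Fin M → ℂ) {j : ℕ} (hj : j ≤ M) (b : Fin M) :
    eval (fun i : Fin j => t₀ (Fin.castLE hj i)) (restrictVar t₀ j b) = t₀ b := by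
  unfold restrictVar
  split_ifs <;> simp

theorem exists_extend_eval_restrictVar {M : ℕ} (t₀ : Fin M → ℂ) (j : ℕ) (t : Fin j → ℂ) :
    ∃ t' : Fin (j + 1) → ℂ, ∀ b : Fin M,
      eval t' (restrictVar t₀ (j + 1) b) = eval t (restrictVar t₀ j b) := by
  refine ⟨fun i => if hi : i.1 < j then t ⟨i, hi⟩ else if hM : i.1 < M then t₀ ⟨i, hM⟩ else 0,
    fun b => ?_⟩
  unfold restrictVar
  by_cases h1 : b.1 < j
  · rw [dif_pos h1, dif_pos (by omega)]
    simp [h1]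
  · by_cases h2 : b.1 < j + 1
    · rw [dif_neg h1, dif_pos h2]
      simp [h1]
    · rw [dif_neg h1, dif_neg h2]
      simp

theorem pderiv_restrictVar {M : ℕ} (t₀ : Fin M → ℂ) {j : ℕ} (hj : j ≤ M) (i : Fin j)
    (P : MvPolynomial (Fin M) ℂ) :
    pderiv i (aeval (restrictVar t₀ j) P) =
      aeval (restrictVar t₀ j) (pderiv (Fin.castLE hj i) P) := by
  rw [pderiv_aeval, Finset.sum_eq_single (Fin.castLE hj i)]
  · simp [restrictVar]
  · intro b _ hb
    unfold restrictVar
    split_ifs with h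
    · rw [pderiv_X_of_ne, mul_zero]
      rintro rfl
      exact hb rfl
    · rw [pderiv_C, mul_zero]
  · simp

/-- The Krull dimension of a set containing the image of a polynomial map of rank `M` into the
projective space is at least `M`. -/
theorem le_topologicalKrullDim_of_linearIndependent [Fintype σ] {M : ℕ} (S : Set (ℙ ℂ (σ → ℂ)))
    (ψ : σ → MvPolynomial (Fin M) ℂ) (t₀ : Fin M → ℂ) (g : MvPolynomial (Fin M) ℂ)
    (hg : eval t₀ g ≠ 0)
    (hS : ∀ t, eval t g ≠ 0 →
      ∃ hv : (fun s => eval t (ψ s)) ≠ 0, Projectivization.mk ℂ _ hv ∈ S)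
    (hind : LinearIndependent ℂ (Fin.cons (fun s => eval t₀ (ψ s))
      (fun b s => eval t₀ (pderiv b (ψ s))) : Fin (M + 1) → σ → ℂ)) :
    (M : WithBot ℕ∞) ≤ topologicalKrullDim S := by
  classical
  let ψr : ∀ j, σ → MvPolynomial (Fin j) ℂ := fun j s => aeval (restrictVar t₀ j) (ψ s)
  let gr : ∀ j, MvPolynomial (Fin j) ℂ := fun j => aeval (restrictVar t₀ j) g
  -- `E j` is the image of the `j`-dimensional coordinate slice through `t₀`. The closures of `E 0,
  -- …, E M` will form the chain.
  let E : ℕ → Set S := fun j => {q | ∃ t, eval t (gr j) ≠ 0 ∧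
    ∃ hv : (fun s => eval t (ψr j s)) ≠ 0, q.1 = Projectivization.mk ℂ _ hv}
  have hgr : ∀ j, j ≤ M → gr j ≠ 0 := by
    intro j hj h0
    have := congrArg (eval (fun i : Fin j => t₀ (Fin.castLE hj i))) h0
    simp only [gr, eval_aeval, eval_restrictVar_self, map_zero] at this
    exact hg this
  have hSr : ∀ j t, eval t (gr j) ≠ 0 →
      ∃ hv : (fun s => eval t (ψr j s)) ≠ 0, Projectivization.mk ℂ _ hv ∈ S := by
    intro j t ht
    simp only [gr, ψr, eval_aeval] at ht ⊢
    exact hS _ ht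
  have hE_irr : ∀ j, j ≤ M → IsIrreducible (E j) := fun j hj =>
    isIrreducible_setOf_exists_eq_mk S (ψr j) (hgr j hj) (hSr j)
  have hE_mono : ∀ j, E j ⊆ E (j + 1) := by
    rintro j q ⟨t, h1, h2⟩
    obtain ⟨t', ht'⟩ := exists_extend_eval_restrictVar t₀ j t
    refine ⟨t', ?_⟩
    simp only [gr, ψr, eval_aeval, ht'] at h1 h2 ⊢
    exact ⟨h1, h2⟩
  -- Linear coordinates in which the value of the map and its partial derivatives at `t₀` become the
  -- standard basis vectors.
  obtain ⟨ℓ, hℓ⟩ : ∃ ℓ : (σ → ℂ) →ₗ[ℂ] (Fin (M + 1) → ℂ),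
      ∀ a, ℓ ((Fin.cons (fun s => eval t₀ (ψ s))
        (fun b s => eval t₀ (pderiv b (ψ s))) : Fin (M + 1) → σ → ℂ) a) = Pi.single a 1 := by
    obtain ⟨f, hf⟩ := LinearMap.exists_leftInverse_of_injective
      (Fintype.linearCombination ℂ (Fin.cons (fun s => eval t₀ (ψ s))
        (fun b s => eval t₀ (pderiv b (ψ s))) : Fin (M + 1) → σ → ℂ))
      (LinearMap.ker_eq_bot.2 hind.fintypeLinearCombination_injective)
    refine ⟨f, fun a => ?_⟩
    have := LinearMap.congr_fun hf (Pi.single a 1)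
    rw [LinearMap.comp_apply, Fintype.linearCombination_apply_single, one_smul] at this
    exact this
  have hsum : ∀ (w : σ → ℂ) a, ∑ s, ℓ (Pi.single s 1) a * w s = ℓ w a := by
    intro w a
    conv_rhs => rw [← Finset.univ_sum_single w]
    rw [map_sum, Finset.sum_apply]
    refine Finset.sum_congr rfl fun s _ => ?_
    have : (Pi.single s (w s) : σ → ℂ) = w s • Pi.single s 1 := by
      rw [← Pi.single_smul, smul_eq_mul, mul_one]
    rw [this, map_smul, Pi.smul_apply, smul_eq_mul, mul_comm]
  -- The coordinates `ℓ` on the affine cone over `E j`; the extra variable `0` is the scaling factor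
  -- of the cone.
  let θ : ∀ j, Fin (M + 1) → MvPolynomial (Fin (j + 1)) ℂ := fun j a =>
    X 0 * rename Fin.succ (∑ s, C (ℓ (Pi.single s 1) a) * ψr j s)
  have hθ : ∀ j a (T : ℂ) (t : Fin j → ℂ), eval (Fin.cons T t : Fin (j + 1) → ℂ) (θ j a) =
      ℓ (T • fun s => eval t (ψr j s)) a := by
    intro j a T t
    have : ((Fin.cons T t : Fin (j + 1) → ℂ) ∘ Fin.succ) = t := by
      ext i
      simp
    simp only [θ, map_mul, eval_X, Fin.cons_zero, eval_rename, this, map_sum, eval_C, hsum]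
    simp
  have hne : ∀ j, j < M → ∃ P : MvPolynomial σ ℂ,
      (∀ q ∈ E j, ∀ c : ℂ, c ≠ 0 → eval (c • q.1.rep) P = 0) ∧
      ∃ q ∈ E (j + 1), ∃ c : ℂ, c ≠ 0 ∧ eval (c • q.1.rep) P ≠ 0 := by
    intro j hj
    have hj2 : j + 2 ≤ M + 1 := by omega
    -- On the cone over `E j` the first `j + 2` coordinates are polynomials in `j + 1` variables, so
    -- they satisfy a relation `P`. On the cone over `E (j + 1)` they are independent, so `P`
    -- separates the two closures.
    obtain ⟨P, hP0, hP⟩ := exists_aeval_eq_zero_of_succ (j + 1) fun a => θ j (Fin.castLE hj2 a)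
    have hP' : ∀ w : σ → ℂ, eval w (aeval (fun a : Fin (j + 2) =>
        ∑ s, C (ℓ (Pi.single s 1) (Fin.castLE hj2 a)) * X s) P) =
        eval (fun a => ℓ w (Fin.castLE hj2 a)) P := by
      intro w
      simp only [eval_aeval, map_sum, map_mul, eval_C, eval_X, hsum]
    refine ⟨aeval (fun a : Fin (j + 2) =>
      ∑ s, C (ℓ (Pi.single s 1) (Fin.castLE hj2 a)) * X s) P, ?_, ?_⟩
    · rintro q ⟨t, -, hv, hq⟩ c -
      obtain ⟨a, ha⟩ := Projectivization.exists_smul_eq_mk_rep ℂ _ hv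
      rw [hq, ← ha, hP', Units.smul_def, smul_smul]
      simp only [← hθ]
      rw [← eval_aeval, hP, map_zero]
    -- At scaling factor `1` and the point `t₀` the Jacobian matrix is the identity: the derivative
    -- in the scaling variable is the value of the map, the others are its partial derivatives, and
    -- `ℓ` sends them to basis vectors.
    · have hindep : aeval (fun a => θ (j + 1) (Fin.castLE hj2 a)) P ≠ 0 := by
        intro h0
        refine hP0 (eq_zero_of_aeval_eq_zero_of_jacobian
          (fun a => θ (j + 1) (Fin.castLE hj2 a))
          (Fin.cons 1 (fun i : Fin (j + 1) => t₀ (Fin.castLE (by omega) i))) (fun a b => ?_) P h0)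
        have hcons : ((Fin.cons 1 (fun i : Fin (j + 1) => t₀ (Fin.castLE (by omega) i)) :
            Fin (j + 2) → ℂ) ∘ Fin.succ) = fun i => t₀ (Fin.castLE (by omega) i) := by
          ext i
          simp
        refine Fin.cases ?_ (fun b => ?_) b
        · have h1 : pderiv 0 (rename Fin.succ
              (∑ s, C (ℓ (Pi.single s 1) (Fin.castLE hj2 a)) * ψr (j + 1) s)) = 0 := by
            refine pderiv_eq_zero_of_notMem_vars fun hmem => ?_
            have := vars_rename _ _ hmem
            simp at this
          have h2 : pderiv 0 (θ (j + 1) (Fin.castLE hj2 a)) = rename Fin.succ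
              (∑ s, C (ℓ (Pi.single s 1) (Fin.castLE hj2 a)) * ψr (j + 1) s) := by
            simp only [θ]
            rw [Derivation.leibniz, h1, pderiv_X_self, smul_zero, zero_add, smul_eq_mul, mul_one]
          rw [h2, eval_rename, hcons]
          simp only [map_sum, map_mul, eval_C, hsum]
          simp only [ψr, eval_aeval, eval_restrictVar_self]
          have := congrFun (hℓ 0) (Fin.castLE hj2 a)
          rw [Fin.cons_zero] at this
          rw [this, Pi.single_apply]
          exact if_congr (by rw [Fin.ext_iff, Fin.ext_iff]; rfl) rfl rfl
        · have h1 : pderiv b.succ (X 0 : MvPolynomial (Fin (j + 2)) ℂ) = 0 :=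
            pderiv_X_of_ne (Fin.succ_ne_zero b).symm
          have h2 : pderiv b.succ (θ (j + 1) (Fin.castLE hj2 a)) = X 0 * rename Fin.succ
              (∑ s, C (ℓ (Pi.single s 1) (Fin.castLE hj2 a)) * pderiv b (ψr (j + 1) s)) := by
            simp only [θ]
            rw [Derivation.leibniz, h1, smul_zero, add_zero, smul_eq_mul,
              pderiv_rename (Fin.succ_injective _), map_sum]
            simp only [pderiv_C_mul]
          rw [h2, map_mul, eval_X, Fin.cons_zero, one_mul, eval_rename, hcons]
          simp only [map_sum, map_mul, eval_C, hsum]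
          simp only [ψr, pderiv_restrictVar t₀ (show j + 1 ≤ M by omega), eval_aeval,
            eval_restrictVar_self]
          have := congrFun (hℓ (Fin.castLE (by omega) b).succ) (Fin.castLE hj2 a)
          rw [Fin.cons_succ] at this
          rw [this, Pi.single_apply]
          exact if_congr (by rw [Fin.ext_iff, Fin.ext_iff]; rfl) rfl rfl
      have hg1 : rename Fin.succ (gr (j + 1)) ≠ 0 := by
        intro h0
        exact hgr (j + 1) (by omega) (rename_injective _ (Fin.succ_injective _) (by simpa using h0))
      -- The factor `X 0` keeps the scaling parameter nonzero, so that the point found on the cone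
      -- really represents a projective point.
      obtain ⟨t, ht⟩ := exists_eval_ne_zero (mul_ne_zero (mul_ne_zero hindep hg1) (X_ne_zero 0))
      rw [map_mul, map_mul, eval_X, eval_rename] at ht
      have htg := right_ne_zero_of_mul (left_ne_zero_of_mul ht)
      obtain ⟨hv, hvS⟩ := hSr (j + 1) _ htg
      refine ⟨⟨_, hvS⟩, ⟨_, htg, hv, rfl⟩, ?_⟩
      obtain ⟨a, ha⟩ := Projectivization.exists_smul_eq_mk_rep ℂ _ hv
      refine ⟨t 0 * (a : ℂ)⁻¹, mul_ne_zero (right_ne_zero_of_mul ht) (by simp), ?_⟩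
      rw [← ha, hP', Units.smul_def, smul_smul, mul_assoc, inv_mul_cancel₀ a.ne_zero, mul_one]
      simp only [← hθ]
      rw [← eval_aeval]
      convert left_ne_zero_of_mul (left_ne_zero_of_mul ht)
      ext i
      refine Fin.cases ?_ (fun i => ?_) i <;> simp
  have hlt : ∀ j, j < M → closure (E j) ⊂ closure (E (j + 1)) := by
    intro j hj
    refine ⟨closure_mono (hE_mono j), fun hsub => ?_⟩
    obtain ⟨P, hP, q, hq, c, hc, hPq⟩ := hne j hj
    have hcl : IsClosed {q : S | ∀ c : ℂ, c ≠ 0 → eval (c • q.1.rep) P = 0} := by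
      have := (isClosed_setOf_forall_eval_eq_zero fun _ : Unit => P).preimage
        (continuous_subtype_val (p := (· ∈ S)))
      simpa using this
    have h1 : closure (E j) ⊆ {q : S | ∀ c : ℂ, c ≠ 0 → eval (c • q.1.rep) P = 0} :=
      closure_minimal hP hcl
    exact hPq (h1 (hsub (subset_closure hq)) c hc)
  let Z : Fin (M + 1) → TopologicalSpace.IrreducibleCloseds S := fun j =>
    ⟨closure (E j), (hE_irr j (by omega)).closure, isClosed_closure⟩
  have hZ : StrictMono Z := by
    rw [Fin.strictMono_iff_lt_succ]
    intro j
    exact hlt j j.2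
  have := Order.LTSeries.length_le_krullDim (LTSeries.mk M Z hZ)
  exact this

end SecantGeometry

end

noncomputable section

namespace SecantGeometry

open MvPolynomial

/-! ### Multihomogeneous polynomials -/

section Multihomogeneous

variable {r : ℕ} {n d : Fin r → ℕ}

/-- The homogeneous coordinates of `ℙ^{n₁} × ⋯ × ℙ^{n_r}`. -/
abbrev Coord (n : Fin r → ℕ) : Type := Σ i, Fin (n i + 1)

/-- `f` is homogeneous of multidegree `δ`. -/
def IsMultihomogeneous (f : MvPolynomial (Coord n) ℂ) (δ : Fin r → ℕ) : Prop :=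
  IsWeightedHomogeneous (fun ρ : Coord n => (Pi.single ρ.1 1 : Fin r → ℕ)) f δ

theorem IsMultihomogeneous.mul {f g : MvPolynomial (Coord n) ℂ} {δ ε : Fin r → ℕ}
    (hf : IsMultihomogeneous f δ) (hg : IsMultihomogeneous g ε) :
    IsMultihomogeneous (f * g) (δ + ε) :=
  IsWeightedHomogeneous.mul hf hg

theorem IsMultihomogeneous.mul_eq {f g : MvPolynomial (Coord n) ℂ} {δ ε ζ : Fin r → ℕ}
    (hf : IsMultihomogeneous f δ) (hg : IsMultihomogeneous g ε) (h : δ + ε = ζ) :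
    IsMultihomogeneous (f * g) ζ :=
  h ▸ hf.mul hg

theorem IsMultihomogeneous.sub {f g : MvPolynomial (Coord n) ℂ} {δ : Fin r → ℕ}
    (hf : IsMultihomogeneous f δ) (hg : IsMultihomogeneous g δ) :
    IsMultihomogeneous (f - g) δ :=
  IsWeightedHomogeneous.sub hf hg

theorem IsMultihomogeneous.C_mul {f : MvPolynomial (Coord n) ℂ} {δ : Fin r → ℕ}
    (hf : IsMultihomogeneous f δ) (c : ℂ) : IsMultihomogeneous (C c * f) δ :=
  IsWeightedHomogeneous.C_mul hf c

theorem IsMultihomogeneous.sum {ι : Type*} (s : Finset ι) (f : ι → MvPolynomial (Coord n) ℂ)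
    {δ : Fin r → ℕ} (hf : ∀ i ∈ s, IsMultihomogeneous (f i) δ) :
    IsMultihomogeneous (∑ i ∈ s, f i) δ :=
  IsWeightedHomogeneous.sum s f δ hf

theorem isMultihomogeneous_X (ρ : Coord n) :
    IsMultihomogeneous (X ρ : MvPolynomial (Coord n) ℂ) (Pi.single ρ.1 1) :=
  isWeightedHomogeneous_X ℂ _ ρ

/-- The linear form `x_{i,a} - c x_{i,0}`. -/
theorem isMultihomogeneous_X_sub_C_mul_X (i : Fin r) (a : Fin (n i + 1)) (c : ℂ) :
    IsMultihomogeneous (X ⟨i, a⟩ - C c * X ⟨i, 0⟩ : MvPolynomial (Coord n) ℂ) (Pi.single i 1) :=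
  (isMultihomogeneous_X ⟨i, a⟩).sub ((isMultihomogeneous_X ⟨i, 0⟩).C_mul c)

theorem weight_apply (s : Coord n →₀ ℕ) (i : Fin r) :
    Finsupp.weight (fun ρ : Coord n => (Pi.single ρ.1 1 : Fin r → ℕ)) s i =
      ∑ a, s ⟨i, a⟩ := by
  rw [Finsupp.weight_apply, Finsupp.sum_fintype _ _ (by simp), Finset.sum_apply,
    Fintype.sum_sigma, Finset.sum_eq_single i]
  · simp
  · intro j _ hj
    simp [hj.symm]
  · simp

/-- The monomial `∏ x_{i,0}^{δ_i}`, used to raise multidegrees. -/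
def fillPoly (n δ : Fin r → ℕ) : MvPolynomial (Coord n) ℂ := ∏ i, X ⟨i, 0⟩ ^ δ i

theorem isMultihomogeneous_fillPoly (δ : Fin r → ℕ) : IsMultihomogeneous (fillPoly n δ) δ := by
  have h := IsWeightedHomogeneous.prod (R := ℂ) Finset.univ
    (fun i => (X ⟨i, 0⟩ : MvPolynomial (Coord n) ℂ) ^ δ i)
    (fun i => δ i • (Pi.single i 1 : Fin r → ℕ))
    (w := fun ρ : Coord n => (Pi.single ρ.1 1 : Fin r → ℕ))
    (fun i _ => (isWeightedHomogeneous_X ℂ _ (⟨i, 0⟩ : Coord n)).pow (δ i))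
  have h2 : (∑ i, δ i • (Pi.single i 1 : Fin r → ℕ)) = δ := by
    ext j
    simp [Finset.sum_apply, Pi.single_apply]
  rw [h2] at h
  exact h

theorem eval_fillPoly (δ : Fin r → ℕ) {x : Coord n → ℂ} (hx : ∀ i, x ⟨i, 0⟩ = 1) :
    eval x (fillPoly n δ) = 1 := by
  simp [fillPoly, map_prod, hx]

theorem IsMultihomogeneous.eval_scale {f : MvPolynomial (Coord n) ℂ} {δ : Fin r → ℕ}
    (hf : IsMultihomogeneous f δ) (s : Fin r → ℂ) (x : Coord n → ℂ) :
    eval (fun ρ => s ρ.1 * x ρ) f = (∏ i, s i ^ δ i) * eval x f := by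
  rw [eval_eq', eval_eq', Finset.mul_sum]
  refine Finset.sum_congr rfl fun m hm => ?_
  have h1 := hf (mem_support_iff.1 hm)
  have h2 : ∏ ρ : Coord n, (s ρ.1 * x ρ) ^ m ρ = (∏ i, s i ^ δ i) * ∏ ρ : Coord n, x ρ ^ m ρ := by
    simp only [mul_pow, Finset.prod_mul_distrib]
    congr 1
    rw [Fintype.prod_sigma]
    refine Finset.prod_congr rfl fun i _ => ?_
    rw [← h1, weight_apply]
    exact Finset.prod_pow_eq_pow_sum Finset.univ (fun a => m ⟨i, a⟩) (s i)
  rw [h2]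
  ring

/-- The exponent vector of a monomial of multidegree `d`. -/
def expo (J : MonomialIndex n d) : Coord n →₀ ℕ :=
  Finsupp.equivFunOnFinite.symm fun ρ => Multiset.count ρ.2 (J ρ.1 : Multiset (Fin (n ρ.1 + 1)))

theorem expo_injective : Function.Injective (expo : MonomialIndex n d → Coord n →₀ ℕ) := by
  intro J K h
  funext i
  refine Subtype.ext (Multiset.ext.2 fun a => ?_)
  exact DFunLike.congr_fun h (⟨i, a⟩ : Coord n)

theorem exists_expo_eq {s : Coord n →₀ ℕ} (hs : ∀ i, ∑ a, s ⟨i, a⟩ = d i) :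
    ∃ J : MonomialIndex n d, expo J = s := by
  refine ⟨fun i => ⟨Finsupp.toMultiset (Finsupp.equivFunOnFinite.symm fun a => s ⟨i, a⟩), ?_⟩, ?_⟩
  · rw [Finsupp.card_toMultiset, Finsupp.sum_fintype _ _ (by simp)]
    exact hs i
  · ext ρ
    exact Finsupp.count_toMultiset _ _

/-- The monomials of multidegree `d`. -/
def monoPoly (J : MonomialIndex n d) : MvPolynomial (Coord n) ℂ := monomial (expo J) 1

theorem sum_expo (J : MonomialIndex n d) (i : Fin r) : ∑ a, expo J ⟨i, a⟩ = d i := by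
  have h : ∑ a, Multiset.count a (J i : Multiset (Fin (n i + 1))) =
      (J i : Multiset (Fin (n i + 1))).card := Multiset.sum_count_eq_card fun a _ => Finset.mem_univ a
  exact h.trans (J i).2

theorem isMultihomogeneous_monoPoly (J : MonomialIndex n d) :
    IsMultihomogeneous (monoPoly J) d := by
  refine isWeightedHomogeneous_monomial _ _ _ ?_
  ext i
  rw [weight_apply, sum_expo]

theorem isHomogeneous_monoPoly (J : MonomialIndex n d) :
    (monoPoly J).IsHomogeneous (∑ i, d i) := by
  refine isHomogeneous_monomial _ ?_
  rw [Finsupp.degree_eq_sum, Fintype.sum_sigma]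
  exact Finset.sum_congr rfl fun i _ => sum_expo J i

theorem eval_monoPoly (J : MonomialIndex n d) (x : Coord n → ℂ) :
    eval x (monoPoly J) = monomials n d (fun i a => x ⟨i, a⟩) J := by
  rw [monoPoly, eval_monomial, one_mul, Finsupp.prod_fintype _ _ (by simp), Fintype.prod_sigma]
  refine Finset.prod_congr rfl fun i _ => ?_
  rw [Finset.prod_multiset_map_count]
  symm
  refine Finset.prod_subset (Finset.subset_univ _) fun a _ ha => ?_
  rw [Multiset.mem_toFinset] at ha
  rw [Multiset.count_eq_zero_of_notMem ha, pow_zero]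

theorem IsMultihomogeneous.eq_sum_monoPoly {f : MvPolynomial (Coord n) ℂ}
    (hf : IsMultihomogeneous f d) :
    f = ∑ J : MonomialIndex n d, C (coeff (expo J) f) * monoPoly J := by
  ext s
  simp only [coeff_sum, coeff_C_mul, monoPoly, coeff_monomial]
  by_cases hs : coeff s f = 0
  · rw [hs, Finset.sum_eq_zero]
    intro J _
    split_ifs with h
    · rw [h, hs, zero_mul]
    · rw [mul_zero]
  · have h1 := hf hs
    obtain ⟨J, rfl⟩ := exists_expo_eq (d := d) (s := s) fun i => by rw [← h1, weight_apply]
    rw [Finset.sum_eq_single J]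
    · simp
    · intro K _ hK
      rw [if_neg (fun h => hK (expo_injective h)), mul_zero]
    · simp

/-- The pairing between points of `ℂ^σ` and polynomials, in which a polynomial of multidegree `d`
is considered as a linear form. -/
def pair : (MonomialIndex n d → ℂ) →ₗ[ℂ] MvPolynomial (Coord n) ℂ →ₗ[ℂ] ℂ :=
  ∑ J : MonomialIndex n d,
    (LinearMap.lsmul ℂ _).flip (lcoeff ℂ (expo J)) ∘ₗ LinearMap.proj J

theorem pair_apply (w : MonomialIndex n d → ℂ) (f : MvPolynomial (Coord n) ℂ) :
    pair w f = ∑ J, w J * coeff (expo J) f := by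
  simp [pair, LinearMap.sum_apply]

theorem pair_monoPoly (w : MonomialIndex n d → ℂ) (J : MonomialIndex n d) :
    pair w (monoPoly J) = w J := by
  rw [pair_apply, Finset.sum_eq_single J]
  · simp [monoPoly]
  · intro K _ hK
    rw [monoPoly, coeff_monomial, if_neg (fun h => hK (expo_injective h).symm), mul_zero]
  · simp

/-- A form of multidegree `d` is a combination of the monomials, so a functional on such forms is
determined by the vector of its values on monomials. Evaluation and differentiation at `x` are the
two functionals needed: they correspond to `vec` and `dvec`. -/
theorem pair_linearMap (L : MvPolynomial (Coord n) ℂ →ₗ[ℂ] ℂ) {f : MvPolynomial (Coord n) ℂ}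
    (hf : IsMultihomogeneous f d) :
    pair (fun J : MonomialIndex n d => L (monoPoly J)) f = L f := by
  conv_rhs => rw [hf.eq_sum_monoPoly]
  rw [pair_apply, map_sum]
  refine Finset.sum_congr rfl fun J _ => ?_
  rw [← smul_eq_C_mul, map_smul, smul_eq_mul, mul_comm]

variable (d) in
/-- The point of the affine cone over the Segre-Veronese variety with parameter `x`. -/
def vec (x : Coord n → ℂ) : MonomialIndex n d → ℂ := fun J => eval x (monoPoly J)

variable (d) in
/-- The partial derivatives of the parametrization `vec`. -/
def dvec (x : Coord n → ℂ) (ρ : Coord n) : MonomialIndex n d → ℂ :=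
  fun J => eval x (pderiv ρ (monoPoly J))

theorem pair_vec (x : Coord n → ℂ) {f : MvPolynomial (Coord n) ℂ} (hf : IsMultihomogeneous f d) :
    pair (vec d x) f = eval x f :=
  pair_linearMap (aeval x).toLinearMap hf

theorem pair_dvec (x : Coord n → ℂ) (ρ : Coord n) {f : MvPolynomial (Coord n) ℂ}
    (hf : IsMultihomogeneous f d) : pair (dvec d x ρ) f = eval x (pderiv ρ f) :=
  pair_linearMap ((aeval x).toLinearMap ∘ₗ (pderiv ρ).toLinearMap) hf

theorem vec_scale (s : Fin r → ℂ) (x : Coord n → ℂ) :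
    vec d (fun ρ => s ρ.1 * x ρ) = (∏ i, s i ^ d i) • vec d x := by
  ext J
  exact (isMultihomogeneous_monoPoly J).eval_scale s x

theorem vec_ne_zero {x : Coord n → ℂ} (hx : ∀ i, ∃ a, x ⟨i, a⟩ ≠ 0) : vec d x ≠ 0 := by
  have := monomials_ne_zero n d (fun i a => x ⟨i, a⟩) fun i => by
    obtain ⟨a, ha⟩ := hx i
    exact fun h => ha (congrFun h a)
  convert this using 1
  ext J
  exact eval_monoPoly J x

theorem mk_vec_mem {x : Coord n → ℂ} (hx : ∀ i, ∃ a, x ⟨i, a⟩ ≠ 0) (hv : vec d x ≠ 0) :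
    Projectivization.mk ℂ (vec d x) hv ∈ segreVeronese n d := by
  have h0 : ∀ i, (fun a => x ⟨i, a⟩) ≠ 0 := fun i => by
    obtain ⟨a, ha⟩ := hx i
    exact fun h => ha (congrFun h a)
  refine ⟨fun i => Projectivization.mk ℂ _ (h0 i), ?_⟩
  choose s hs using fun i => Projectivization.exists_smul_eq_mk_rep ℂ _ (h0 i)
  unfold segreVeroneseMap
  rw [Projectivization.mk_eq_mk_iff']
  refine ⟨∏ i, (s i : ℂ) ^ d i, ?_⟩
  rw [← vec_scale]
  ext J
  simp only [← hs]
  exact eval_monoPoly J _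

theorem exists_eq_mk_vec {q : ℙ ℂ (MonomialIndex n d → ℂ)} (hq : q ∈ segreVeronese n d) :
    ∃ x : Coord n → ℂ, (∀ i, ∃ a, x ⟨i, a⟩ ≠ 0) ∧
      ∃ hv : vec d x ≠ 0, q = Projectivization.mk ℂ (vec d x) hv := by
  obtain ⟨y, rfl⟩ := hq
  have hx : ∀ i, ∃ a, (fun ρ : Coord n => (y ρ.1).rep ρ.2) ⟨i, a⟩ ≠ 0 := fun i =>
    Function.ne_iff.1 (y i).rep_nonzero
  refine ⟨fun ρ => (y ρ.1).rep ρ.2, hx, vec_ne_zero hx, ?_⟩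
  unfold segreVeroneseMap
  congr 1
  ext J
  exact (eval_monoPoly J fun ρ => (y ρ.1).rep ρ.2).symm

end Multihomogeneous

end SecantGeometry

end

noncomputable section

namespace SecantGeometry

open MvPolynomial

/-! ### Charts of the Segre-Veronese variety and an upper bound for its dimension -/

/-- A chain of irreducible closed sets can be restricted to an open neighbourhood of a point of its
smallest member. All members meet this neighbourhood, so no inclusion collapses. -/
theorem topologicalKrullDim_le_of_forall_exists_isOpen {S : Type*} [TopologicalSpace S]
    {D : WithBot ℕ∞}
    (H : ∀ p : S, ∃ U : Set S, IsOpen U ∧ p ∈ U ∧ topologicalKrullDim U ≤ D) :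
    topologicalKrullDim S ≤ D := by
  refine iSup_le fun p => ?_
  obtain ⟨z, hz⟩ := (p 0).isIrreducible.nonempty
  obtain ⟨U, hU, hzU, hUD⟩ := H z
  refine le_trans ?_ hUD
  let e := TopologicalSpace.IrreducibleCloseds.orderIsoOfIsOpenEmbedding (Subtype.val : U → S)
    hU.isOpenEmbedding_subtypeVal
  unfold topologicalKrullDim
  rw [Order.krullDim_eq_of_orderIso e]
  let p' : LTSeries {V : TopologicalSpace.IrreducibleCloseds S |
      ((Subtype.val : U → S) ⁻¹' V).Nonempty} :=
    LTSeries.mk p.length (fun i => ⟨p i, ⟨z, hzU⟩, LTSeries.monotone p (Fin.zero_le i) hz⟩)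
      fun i j hij => p.strictMono hij
  exact Order.LTSeries.length_le_krullDim p'

theorem exists_eval_div_mul_pow_eq {τ σ : Type*} (k : τ → σ) (b : σ) (Q : MvPolynomial τ ℂ) :
    ∃ (R : MvPolynomial σ ℂ) (N : ℕ), ∀ w : σ → ℂ, w b ≠ 0 →
      eval (fun a => w (k a) / w b) Q * w b ^ N = eval w R := by
  induction Q using MvPolynomial.induction_on with
  | C c => exact ⟨C c, 0, fun w _ => by simp⟩
  | add p q hp hq =>
    obtain ⟨R₁, N₁, h₁⟩ := hp
    obtain ⟨R₂, N₂, h₂⟩ := hq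
    refine ⟨R₁ * X b ^ N₂ + R₂ * X b ^ N₁, N₁ + N₂, fun w hw => ?_⟩
    rw [map_add, map_add, map_mul, map_mul, ← h₁ w hw, ← h₂ w hw]
    simp only [map_pow, eval_X]
    ring
  | mul_X p a hp =>
    obtain ⟨R, N, h⟩ := hp
    refine ⟨R * X (k a), N + 1, fun w hw => ?_⟩
    rw [map_mul, map_mul, ← h w hw, eval_X, eval_X]
    field_simp
    ring

variable {r : ℕ} {n d : Fin r → ℕ}

/-- The index of the monomial `∏ x_{i,jᵢ}^{dᵢ}`. -/
def baseIdx (d : Fin r → ℕ) (j : ∀ i, Fin (n i + 1)) : MonomialIndex n d :=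
  fun i => Sym.replicate (d i) (j i)

/-- The index of the monomial obtained from `baseIdx` by replacing one variable. -/
def coordIdx (hd : ∀ i, 1 ≤ d i) (j : ∀ i, Fin (n i + 1)) (ρ : Coord n) : MonomialIndex n d :=
  Function.update (baseIdx d j) ρ.1 (Sym.mk (ρ.2 ::ₘ Multiset.replicate (d ρ.1 - 1) (j ρ.1)) (by
    rw [Multiset.card_cons, Multiset.card_replicate]
    exact Nat.sub_add_cancel (hd ρ.1)))

theorem vec_baseIdx (x : Coord n → ℂ) (j : ∀ i, Fin (n i + 1)) :
    vec d x (baseIdx d j) = ∏ i, x ⟨i, j i⟩ ^ d i := by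
  rw [vec, eval_monoPoly, monomials]
  refine Finset.prod_congr rfl fun i _ => ?_
  rw [baseIdx, Sym.coe_replicate, Multiset.map_replicate, Multiset.prod_replicate]

theorem vec_coordIdx (hd : ∀ i, 1 ≤ d i) {x : Coord n → ℂ} {j : ∀ i, Fin (n i + 1)}
    (hx : ∀ i, x ⟨i, j i⟩ = 1) (ρ : Coord n) : vec d x (coordIdx hd j ρ) = x ρ := by
  rw [vec, eval_monoPoly, monomials, Finset.prod_eq_single ρ.1]
  · rw [coordIdx, Function.update_self, Sym.coe_mk]
    simp [hx]
  · intro i _ hi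
    rw [coordIdx, Function.update_of_ne hi, baseIdx, Sym.coe_replicate, Multiset.map_replicate,
      Multiset.prod_replicate, hx, one_pow]
  · simp

/-- The coordinates of a point, normalized at the indices `j`. -/
def normalize (j : ∀ i, Fin (n i + 1)) (x : Coord n → ℂ) : Coord n → ℂ :=
  fun ρ => (x ⟨ρ.1, j ρ.1⟩)⁻¹ * x ρ

theorem normalize_apply_self {j : ∀ i, Fin (n i + 1)} {x : Coord n → ℂ}
    (hx : ∀ i, x ⟨i, j i⟩ ≠ 0) (i : Fin r) : normalize j x ⟨i, j i⟩ = 1 :=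
  inv_mul_cancel₀ (hx i)

theorem vec_normalize (j : ∀ i, Fin (n i + 1)) (x : Coord n → ℂ) :
    vec d (normalize j x) = (∏ i, (x ⟨i, j i⟩)⁻¹ ^ d i) • vec d x :=
  vec_scale (fun i => (x ⟨i, j i⟩)⁻¹) x

theorem prod_inv_pow_ne_zero {j : ∀ i, Fin (n i + 1)} {x : Coord n → ℂ}
    (hx : ∀ i, x ⟨i, j i⟩ ≠ 0) (δ : Fin r → ℕ) : (∏ i, (x ⟨i, j i⟩)⁻¹ ^ δ i) ≠ 0 :=
  Finset.prod_ne_zero_iff.2 fun i _ => pow_ne_zero _ (inv_ne_zero (hx i))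

theorem mk_vec_normalize {j : ∀ i, Fin (n i + 1)} {x : Coord n → ℂ}
    (hv : vec d x ≠ 0) (hv' : vec d (normalize j x) ≠ 0) :
    Projectivization.mk ℂ (vec d (normalize j x)) hv' = Projectivization.mk ℂ (vec d x) hv := by
  rw [Projectivization.mk_eq_mk_iff']
  exact ⟨_, (vec_normalize j x).symm⟩

theorem exists_normalized {q : ℙ ℂ (MonomialIndex n d → ℂ)} (hd : ∀ i, 1 ≤ d i)
    (hq : q ∈ segreVeronese n d) {j : ∀ i, Fin (n i + 1)} (hj : q.rep (baseIdx d j) ≠ 0) :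
    ∃ x : Coord n → ℂ, (∀ i, x ⟨i, j i⟩ = 1) ∧
      ∃ hv : vec d x ≠ 0, q = Projectivization.mk ℂ (vec d x) hv := by
  obtain ⟨x, hx, hv, rfl⟩ := exists_eq_mk_vec hq
  obtain ⟨a, ha⟩ := Projectivization.exists_smul_eq_mk_rep ℂ _ hv
  rw [← ha, Units.smul_def, Pi.smul_apply, vec_baseIdx] at hj
  have hxj : ∀ i, x ⟨i, j i⟩ ≠ 0 := by
    intro i h0
    refine right_ne_zero_of_smul hj (Finset.prod_eq_zero (Finset.mem_univ i) ?_)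
    rw [h0, zero_pow (by have := hd i; omega)]
  have hv' : vec d (normalize j x) ≠ 0 :=
    vec_ne_zero fun i => ⟨j i, by rw [normalize_apply_self hxj]; exact one_ne_zero⟩
  exact ⟨normalize j x, normalize_apply_self hxj, hv', (mk_vec_normalize hv hv').symm⟩

/-- The chart of the Segre-Veronese variety around the points with nonzero `jᵢ`-th coordinates. -/
def chart (d : Fin r → ℕ) (j : ∀ i, Fin (n i + 1)) : Set (segreVeronese n d) :=
  {q | q.1.rep (baseIdx d j) ≠ 0}

theorem isOpen_setOf_rep_apply_ne_zero {σ : Type} (b : σ) :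
    IsOpen {q : ℙ ℂ (σ → ℂ) | q.rep b ≠ 0} := by
  convert isOpen_setOf_exists_eval_ne_zero fun _ : Unit => (X b : MvPolynomial σ ℂ) using 1
  ext q
  simp only [Set.mem_ofPred_eq, eval_X, Pi.smul_apply, smul_eq_mul]
  exact ⟨fun h => ⟨(), 1, one_ne_zero, by simpa using h⟩,
    fun ⟨_, c, _, h⟩ => right_ne_zero_of_mul h⟩

theorem isOpen_chart (j : ∀ i, Fin (n i + 1)) : IsOpen (chart d j) :=
  (isOpen_setOf_rep_apply_ne_zero (baseIdx d j)).preimage continuous_subtype_val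

/-- The affine coordinates of a chart. -/
abbrev AffineCoord (j : ∀ i, Fin (n i + 1)) : Type := {ρ : Coord n // ρ.2 ≠ j ρ.1}

theorem card_affineCoord (j : ∀ i, Fin (n i + 1)) : Nat.card (AffineCoord j) = ∑ i, n i := by
  have e : AffineCoord j ≃ Σ i, {a : Fin (n i + 1) // a ≠ j i} :=
    { toFun := fun ρ => ⟨ρ.1.1, ρ.1.2, ρ.2⟩
      invFun := fun ρ => ⟨⟨ρ.1, ρ.2.1⟩, ρ.2.2⟩
      left_inv := fun _ => rfl
      right_inv := fun _ => rfl }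
  rw [Nat.card_congr e, Nat.card_eq_fintype_card, Fintype.card_sigma]
  refine Finset.sum_congr rfl fun i _ => ?_
  rw [Fintype.card_subtype_compl]
  simp

/-- The homogeneous coordinates of the point with given affine coordinates. -/
def homogCoord (j : ∀ i, Fin (n i + 1)) (z : AffineCoord j → ℂ) (ρ : Coord n) : ℂ :=
  if h : ρ.2 = j ρ.1 then 1 else z ⟨ρ, h⟩

theorem homogCoord_ne_zero (j : ∀ i, Fin (n i + 1)) (z : AffineCoord j → ℂ) (i : Fin r) :
    ∃ a, homogCoord j z ⟨i, a⟩ ≠ 0 :=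
  ⟨j i, by simp [homogCoord]⟩

/-- The affine coordinates of a point of the chart. -/
def chartMap (hd : ∀ i, 1 ≤ d i) (j : ∀ i, Fin (n i + 1)) (q : chart d j) : AffineCoord j → ℂ :=
  fun ρ => q.1.1.rep (coordIdx hd j ρ.1) / q.1.1.rep (baseIdx d j)

theorem eq_mk_vec_chartMap (hd : ∀ i, 1 ≤ d i) (j : ∀ i, Fin (n i + 1)) (q : chart d j) :
    q.1.1 = Projectivization.mk ℂ (vec d (homogCoord j (chartMap hd j q)))
      (vec_ne_zero (homogCoord_ne_zero j _)) := by
  obtain ⟨x, hx, hv, hq⟩ := exists_normalized hd q.1.2 q.2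
  have hxe : homogCoord j (chartMap hd j q) = x := by
    ext ρ
    unfold homogCoord
    split_ifs with h
    · rw [← hx ρ.1, ← h]
    · unfold chartMap
      obtain ⟨a, ha⟩ := Projectivization.exists_smul_eq_mk_rep ℂ _ hv
      rw [hq, ← ha, Units.smul_def, Pi.smul_apply, Pi.smul_apply, vec_coordIdx hd hx, vec_baseIdx]
      simp [hx]
  simp only [hxe]
  exact hq

/-- Clearing denominators turns polynomial conditions on affine coordinates into conditions on
homogeneous ones; conversely, the parametrization turns open conditions on the chart into polynomial
ones on affine coordinates. Being inducing into the spectrum of a polynomial ring in `∑ nᵢ`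
variables is enough to bound the dimension. -/
theorem isInducing_pointToPoint_chartMap (hd : ∀ i, 1 ≤ d i) (j : ∀ i, Fin (n i + 1)) :
    IsInducing (fun q : chart d j =>
      (pointToPoint (chartMap hd j q) : PrimeSpectrum (MvPolynomial (AffineCoord j) ℂ))) := by
  have hcont : Continuous (fun q : chart d j =>
      (pointToPoint (chartMap hd j q) : PrimeSpectrum (MvPolynomial (AffineCoord j) ℂ))) := by
    rw [PrimeSpectrum.isTopologicalBasis_basic_opens.continuous_iff]
    rintro _ ⟨Q, rfl⟩
    obtain ⟨R, N, hR⟩ := exists_eval_div_mul_pow_eq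
      (fun ρ : AffineCoord j => coordIdx hd j ρ.1) (baseIdx d j) Q
    have hopen := (isOpen_setOf_exists_eval_ne_zero fun _ : Unit => R).preimage
      (show Continuous fun q : chart d j => q.1.1 from
        continuous_subtype_val.comp continuous_subtype_val)
    convert hopen using 1
    ext q
    have hmem : (pointToPoint (chartMap hd j q) : PrimeSpectrum (MvPolynomial (AffineCoord j) ℂ)) ∈
        PrimeSpectrum.basicOpen Q ↔ eval (chartMap hd j q) Q ≠ 0 := by
      rw [PrimeSpectrum.mem_basicOpen]
      change Q ∉ vanishingIdeal ℂ {chartMap hd j q} ↔ _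
      rw [mem_vanishingIdeal_singleton_iff, aeval_apply_eq_eval]
    refine hmem.trans ?_
    have hscale : ∀ c : ℂ, c ≠ 0 → eval (chartMap hd j q) Q *
        (c • q.1.1.rep) (baseIdx d j) ^ N = eval (c • q.1.1.rep) R := by
      intro c hc
      have hb : (c • q.1.1.rep) (baseIdx d j) ≠ 0 := mul_ne_zero hc q.2
      rw [← hR _ hb]
      congr 2
      refine congrArg eval (funext fun ρ => ?_)
      simp only [chartMap, Pi.smul_apply, smul_eq_mul]
      rw [mul_div_mul_left _ _ hc]
    constructor
    · intro h
      refine ⟨(), 1, one_ne_zero, ?_⟩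
      rw [← hscale 1 one_ne_zero]
      exact mul_ne_zero h (pow_ne_zero _ (mul_ne_zero one_ne_zero q.2))
    · rintro ⟨_, c, hc, h⟩
      rw [← hscale c hc] at h
      exact left_ne_zero_of_mul h
  refine ⟨le_antisymm (continuous_iff_le_induced.1 hcont) fun O hO => ?_⟩
  obtain ⟨O₁, hO₁, rfl⟩ := isOpen_induced_iff.1 hO
  obtain ⟨O₂, hO₂, rfl⟩ := isOpen_induced_iff.1 hO₁
  let V : Set (AffineCoord j → ℂ) := {z | Projectivization.mk ℂ (vec d (homogCoord j z))
    (vec_ne_zero (homogCoord_ne_zero j _)) ∈ O₂}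
  have hV : IsOpen[affineZariski (AffineCoord j)] V := by
    rw [isOpen_affineZariski_iff]
    intro z hz
    obtain ⟨f, hf, hfO⟩ := isOpen_proj_iff.1 hO₂ _ _ hz
    let ext : Coord n → MvPolynomial (AffineCoord j) ℂ := fun ρ =>
      if h : ρ.2 = j ρ.1 then 1 else X ⟨ρ, h⟩
    have hext : ∀ (z : AffineCoord j → ℂ) ρ, eval z (ext ρ) = homogCoord j z ρ := by
      intro z ρ
      simp only [ext, homogCoord]
      split_ifs <;> simp
    have hev : ∀ z : AffineCoord j → ℂ,
        eval z (aeval (fun J : MonomialIndex n d => aeval ext (monoPoly J)) f) =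
          eval (vec d (homogCoord j z)) f := by
      intro z
      simp only [eval_aeval, hext]
      rfl
    refine ⟨aeval (fun J : MonomialIndex n d => aeval ext (monoPoly J)) f, ?_, fun z' hz' => ?_⟩
    · rw [hev]
      exact hf
    · rw [hev] at hz'
      exact hfO _ _ hz'
  obtain ⟨W, hW, hWV⟩ := isOpen_induced_iff.1 hV
  refine isOpen_induced_iff.2 ⟨W, hW, ?_⟩
  ext q
  have h1 : chartMap hd j q ∈ pointToPoint ⁻¹' W ↔ chartMap hd j q ∈ V := by rw [hWV]
  refine Iff.trans h1 ?_
  change Projectivization.mk ℂ _ _ ∈ O₂ ↔ q.1.1 ∈ O₂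
  rw [← eq_mk_vec_chartMap]

theorem topologicalKrullDim_segreVeronese_le (hd : ∀ i, 1 ≤ d i) :
    topologicalKrullDim (segreVeronese n d) ≤ ((∑ i, n i : ℕ) : WithBot ℕ∞) := by
  refine topologicalKrullDim_le_of_forall_exists_isOpen fun q => ?_
  obtain ⟨x, hx, hv, hq⟩ := exists_eq_mk_vec q.2
  choose j hj using hx
  refine ⟨chart d j, isOpen_chart j, ?_, ?_⟩
  · change q.1.rep (baseIdx d j) ≠ 0
    obtain ⟨a, ha⟩ := Projectivization.exists_smul_eq_mk_rep ℂ _ hv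
    rw [hq, ← ha, Units.smul_def, Pi.smul_apply, vec_baseIdx]
    exact mul_ne_zero a.ne_zero (Finset.prod_ne_zero_iff.2 fun i _ => pow_ne_zero _ (hj i))
  · refine (isInducing_pointToPoint_chartMap hd j).topologicalKrullDim_le.trans ?_
    rw [PrimeSpectrum.topologicalKrullDim_eq_ringKrullDim,
      MvPolynomial.ringKrullDim_of_isNoetherianRing, card_affineCoord,
      ringKrullDim_eq_zero_of_field, zero_add]

end SecantGeometry

end

noncomputable section

namespace SecantGeometry

open MvPolynomial

/-! ### Tangent spaces of the Segre-Veronese variety -/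

theorem eval_smul_of_isHomogeneous {σ : Type*} {f : MvPolynomial σ ℂ} {k : ℕ}
    (hf : f.IsHomogeneous k) (c : ℂ) (v : σ → ℂ) : eval (c • v) f = c ^ k * eval v f := by
  rw [eval_eq, eval_eq, Finset.mul_sum]
  refine Finset.sum_congr rfl fun m hm => ?_
  have h1 : m.degree = k := by
    rw [Finsupp.degree_eq_weight_one]
    exact hf (mem_support_iff.1 hm)
  simp only [Pi.smul_apply, smul_eq_mul, mul_pow, Finset.prod_mul_distrib,
    Finset.prod_pow_eq_pow_sum]
  rw [← h1, Finsupp.degree_apply]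
  ring

/-- The partial derivatives of a homogeneous equation scale by a nonzero factor, so any
representative may replace `rep`. -/
theorem mem_tangentSpace_mk_iff {σ : Type} [Fintype σ] (Y : Set (ℙ ℂ (σ → ℂ))) {v : σ → ℂ}
    (hv : v ≠ 0) (w : σ → ℂ) :
    w ∈ tangentSpace Y (Projectivization.mk ℂ v hv) ↔
      ∀ f ∈ homogeneousEquations Y, ∑ s, eval v (pderiv s f) * w s = 0 := by
  obtain ⟨a, ha⟩ := Projectivization.exists_smul_eq_mk_rep ℂ v hv
  simp only [tangentSpace, Submodule.mem_iInf, LinearMap.mem_ker, LinearMap.sum_apply,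
    LinearMap.smul_apply, LinearMap.proj_apply, smul_eq_mul]
  refine forall₂_congr fun f hf => ?_
  obtain ⟨⟨k, hk⟩, -⟩ := hf
  rw [← ha, Units.smul_def]
  simp only [eval_smul_of_isHomogeneous hk.pderiv, mul_assoc, ← Finset.mul_sum]
  simp

variable {r : ℕ} {n d : Fin r → ℕ}

theorem eval_vec_eq_zero {f : MvPolynomial (MonomialIndex n d) ℂ}
    (hf : f ∈ homogeneousEquations (segreVeronese n d)) {x : Coord n → ℂ}
    (hx : ∀ i, ∃ a, x ⟨i, a⟩ ≠ 0) : eval (vec d x) f = 0 := by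
  obtain ⟨⟨k, hk⟩, hf⟩ := hf
  have := hf _ (mk_vec_mem hx (vec_ne_zero hx))
  obtain ⟨a, ha⟩ := Projectivization.exists_smul_eq_mk_rep ℂ _ (vec_ne_zero (d := d) hx)
  rw [← ha, Units.smul_def, eval_smul_of_isHomogeneous hk] at this
  exact (mul_eq_zero.1 this).resolve_left (pow_ne_zero _ a.ne_zero)

theorem aeval_monoPoly_eq_zero {f : MvPolynomial (MonomialIndex n d) ℂ}
    (hf : f ∈ homogeneousEquations (segreVeronese n d)) :
    aeval (fun J : MonomialIndex n d => monoPoly J) f = 0 := by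
  -- The factor `∏ x_{i,0}` removes the parameters with a vanishing group of coordinates, which do
  -- not define points of the variety.
  have h : aeval (fun J : MonomialIndex n d => monoPoly J) f *
      ∏ i, (X ⟨i, 0⟩ : MvPolynomial (Coord n) ℂ) = 0 := by
    refine MvPolynomial.funext fun x => ?_
    rw [map_mul, map_prod, map_zero]
    simp only [eval_X]
    by_cases hx : ∏ i, x ⟨i, 0⟩ = 0
    · rw [hx, mul_zero]
    · rw [← ne_eq, Finset.prod_ne_zero_iff] at hx
      rw [eval_aeval]
      exact mul_eq_zero_of_left (eval_vec_eq_zero hf fun i => ⟨0, hx i (Finset.mem_univ i)⟩) _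
  exact (mul_eq_zero.1 h).resolve_right (Finset.prod_ne_zero_iff.2 fun i _ => X_ne_zero _)

theorem dvec_mem_tangentSpace (x : Coord n → ℂ) (hv : vec d x ≠ 0) (ρ : Coord n) :
    dvec d x ρ ∈ tangentSpace (segreVeronese n d) (Projectivization.mk ℂ (vec d x) hv) := by
  rw [mem_tangentSpace_mk_iff]
  intro f hf
  have h := pderiv_aeval (fun J : MonomialIndex n d => monoPoly J) ρ f
  rw [aeval_monoPoly_eq_zero hf, map_zero] at h
  have h2 := congrArg (eval x) h
  rw [map_zero, map_sum] at h2
  rw [h2]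
  refine Finset.sum_congr rfl fun J _ => ?_
  rw [map_mul, eval_aeval]
  rfl

/-- Euler's identity, with total degree `∑ dᵢ`. An index `i` is needed for this degree to be
nonzero. -/
theorem vec_mem_span_dvec (i : Fin r) (hd : ∀ i, 1 ≤ d i) (x : Coord n → ℂ) :
    vec d x ∈ Submodule.span ℂ (Set.range (dvec d x)) := by
  have hN : ((∑ i, d i : ℕ) : ℂ) ≠ 0 := by
    have : d i ≤ ∑ i, d i := Finset.single_le_sum (fun _ _ => Nat.zero_le _) (Finset.mem_univ i)
    have := hd i
    exact_mod_cast (by omega : (∑ i, d i) ≠ 0)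
  have h : ((∑ i, d i : ℕ) : ℂ) • vec d x = ∑ ρ, x ρ • dvec d x ρ := by
    ext J
    have := congrArg (eval x) (isHomogeneous_monoPoly J).sum_X_mul_pderiv
    rw [map_sum] at this
    simp only [map_mul, eval_X, nsmul_eq_mul, map_natCast] at this
    rw [Pi.smul_apply, smul_eq_mul, Finset.sum_apply]
    exact this.symm
  rw [← Submodule.smul_mem_iff _ hN, h]
  exact Submodule.sum_mem _ fun ρ _ =>
    Submodule.smul_mem _ _ (Submodule.subset_span (Set.mem_range_self ρ))

/-- An equation of the Segre-Veronese variety expressing the coordinate `J` through the affine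
coordinates of a chart. -/
def chartEquation (hd : ∀ i, 1 ≤ d i) (j : ∀ i, Fin (n i + 1)) (J : MonomialIndex n d) :
    MvPolynomial (MonomialIndex n d) ℂ :=
  X J * X (baseIdx d j) ^ (∑ i, d i) -
    X (baseIdx d j) * aeval (fun ρ => X (coordIdx hd j ρ)) (monoPoly J)

theorem eval_chartEquation (hd : ∀ i, 1 ≤ d i) (j : ∀ i, Fin (n i + 1)) (J : MonomialIndex n d)
    (v : MonomialIndex n d → ℂ) :
    eval v (chartEquation hd j J) = v J * v (baseIdx d j) ^ (∑ i, d i) -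
      v (baseIdx d j) * eval (fun ρ => v (coordIdx hd j ρ)) (monoPoly J) := by
  rw [chartEquation, map_sub, map_mul, map_mul, eval_aeval]
  simp

theorem isHomogeneous_chartEquation (hd : ∀ i, 1 ≤ d i) (j : ∀ i, Fin (n i + 1))
    (J : MonomialIndex n d) : (chartEquation hd j J).IsHomogeneous (1 + ∑ i, d i) := by
  refine ((isHomogeneous_X _ _).mul (isHomogeneous_X_pow _ _)).sub ((isHomogeneous_X _ _).mul ?_)
  simpa using (isHomogeneous_monoPoly J).aeval (fun ρ => X (coordIdx hd j ρ))
    (fun ρ => isHomogeneous_X ℂ _)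

theorem chartEquation_mem (hd : ∀ i, 1 ≤ d i) (j : ∀ i, Fin (n i + 1)) (J : MonomialIndex n d) :
    chartEquation hd j J ∈ homogeneousEquations (segreVeronese n d) := by
  refine ⟨⟨_, isHomogeneous_chartEquation hd j J⟩, fun q hq => ?_⟩
  -- Outside the chart both terms vanish thanks to the superfluous factor `X (baseIdx d j)`, without
  -- a density argument. The exponent `∑ dᵢ` is zero only for `r = 0`, when the ambient space has a
  -- single coordinate.
  by_cases h0 : q.rep (baseIdx d j) = 0
  · rcases Nat.eq_zero_or_pos (∑ i, d i) with hN | hN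
    · have hr : IsEmpty (Fin r) := ⟨fun i => by
        have h1 : d i ≤ ∑ i, d i :=
          Finset.single_le_sum (fun _ _ => Nat.zero_le _) (Finset.mem_univ i)
        have := hd i
        omega⟩
      have : Subsingleton (MonomialIndex n d) := inferInstance
      refine absurd (funext fun K => ?_) q.rep_nonzero
      rw [Subsingleton.elim K (baseIdx d j), h0, Pi.zero_apply]
    · rw [eval_chartEquation, h0, zero_pow (by omega)]
      ring
  · obtain ⟨x, hx, hv, hq'⟩ := exists_normalized hd hq h0
    obtain ⟨a, ha⟩ := Projectivization.exists_smul_eq_mk_rep ℂ _ hv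
    rw [hq', ← ha, Units.smul_def,
      eval_smul_of_isHomogeneous (isHomogeneous_chartEquation hd j J), eval_chartEquation,
      vec_baseIdx]
    simp only [vec_coordIdx hd hx, hx, one_pow, Finset.prod_const_one, mul_one, one_mul]
    simp [vec]

/-- Differentiating the chart equation of `J` at `v(x)`, normalized to have base coordinate `1`,
expresses `w J` through the base coordinate and the affine coordinates of `w`. Over all `J` this
writes `w` as a combination of the `dvec` and of `vec`, and the latter lies in their span by Euler's
identity. -/
theorem tangentSpace_le_span_dvec (i : Fin r) (hd : ∀ i, 1 ≤ d i) {j : ∀ i, Fin (n i + 1)}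
    {x : Coord n → ℂ} (hx : ∀ i, x ⟨i, j i⟩ = 1) (hv : vec d x ≠ 0) :
    tangentSpace (segreVeronese n d) (Projectivization.mk ℂ (vec d x) hv) ≤
      Submodule.span ℂ (Set.range (dvec d x)) := by
  classical
  intro w hw
  rw [mem_tangentSpace_mk_iff] at hw
  have hb : vec d x (baseIdx d j) = 1 := by
    rw [vec_baseIdx]
    simp [hx]
  have key : w = (∑ ρ, w (coordIdx hd j ρ) • dvec d x ρ) +
      (w (baseIdx d j) - (∑ i, d i : ℕ) * w (baseIdx d j)) • vec d x := by
    ext J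
    have h := hw _ (chartEquation_mem hd j J)
    have hder : ∀ s, eval (vec d x) (pderiv s (chartEquation hd j J)) =
        (if s = J then 1 else 0) +
          (if s = baseIdx d j then (∑ i, d i : ℕ) * vec d x J - vec d x J else 0) -
          ∑ ρ, dvec d x ρ J * (if s = coordIdx hd j ρ then 1 else 0) := by
      intro s
      have hX : ∀ K : MonomialIndex n d, eval (vec d x) (pderiv s (X K)) =
          if s = K then 1 else 0 := by
        intro K
        by_cases hK : s = K
        · rw [hK, pderiv_X_self, if_pos rfl, map_one]
        · rw [pderiv_X_of_ne (Ne.symm hK), if_neg hK, map_zero]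
      have hmono : eval x (monoPoly J) = vec d x J := rfl
      rw [chartEquation, map_sub, Derivation.leibniz, Derivation.leibniz, Derivation.leibniz_pow,
        pderiv_aeval]
      simp only [map_sub, map_add, smul_eq_mul, map_mul, map_pow, eval_X, hX, hb, one_pow, one_mul,
        eval_aeval, vec_coordIdx hd hx, map_sum, nsmul_eq_mul, map_natCast, hmono]
      simp only [dvec]
      split_ifs <;> ring
    simp only [hder, sub_mul, add_mul, ite_mul, one_mul, zero_mul, Finset.sum_sub_distrib,
      Finset.sum_add_distrib, Finset.sum_ite_eq', Finset.mem_univ, if_true,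
      Finset.sum_mul, mul_ite, mul_one, mul_zero] at h
    rw [Finset.sum_comm] at h
    simp only [Finset.sum_ite_eq', Finset.mem_univ, if_true] at h
    rw [Pi.add_apply, Finset.sum_apply, Pi.smul_apply]
    simp only [Pi.smul_apply, smul_eq_mul]
    have hcomm : ∑ ρ, w (coordIdx hd j ρ) * dvec d x ρ J =
        ∑ ρ, dvec d x ρ J * w (coordIdx hd j ρ) :=
      Finset.sum_congr rfl fun ρ _ => mul_comm _ _
    rw [hcomm]
    linear_combination h
  rw [key]
  exact Submodule.add_mem _ (Submodule.sum_mem _ fun ρ _ =>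
    Submodule.smul_mem _ _ (Submodule.subset_span (Set.mem_range_self ρ)))
    (Submodule.smul_mem _ _ (vec_mem_span_dvec i hd x))

end SecantGeometry

end

noncomputable section

namespace SecantGeometry

open MvPolynomial

/-! ### Configurations of points separated by forms of small degree -/

variable {r : ℕ} {n d : Fin r → ℕ}

/-- The points `x₁, …, x_h` are normalized, and `g₁, …, g_h` are forms of degree `t` in the
`i₁`-th group of variables with `g_l(x_k) = δ_{lk}`. -/
structure SeparatedBy (i₁ : Fin r) (t : ℕ) {h : ℕ} (x : Fin h → Coord n → ℂ)
    (g : Fin h → MvPolynomial (Coord n) ℂ) : Prop where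
  apply_zero : ∀ l i, x l ⟨i, 0⟩ = 1
  isMultihomogeneous : ∀ l, IsMultihomogeneous (g l) (Pi.single i₁ t)
  eval_eq : ∀ l k, eval (x k) (g l) = if l = k then 1 else 0

theorem eval_pderiv_mul_mul_eq_zero {σ : Type*} {u v w : MvPolynomial σ ℂ} {p : σ → ℂ}
    (hu : eval p u = 0) (hv : eval p v = 0) (ρ : σ) : eval p (pderiv ρ (u * v * w)) = 0 := by
  simp [Derivation.leibniz, hu, hv]

theorem eval_pderiv_mul_of_eval_eq_zero {σ : Type*} {u : MvPolynomial σ ℂ} {p : σ → ℂ}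
    (hu : eval p u = 0) (v : MvPolynomial σ ℂ) (ρ : σ) :
    eval p (pderiv ρ (u * v)) = eval p v * eval p (pderiv ρ u) := by
  simp [Derivation.leibniz, hu]

theorem eval_pderiv_X_sub_C_mul_X {i i' : Fin r} {a : Fin (n i + 1)} {b : Fin (n i' + 1)}
    (hb : b ≠ 0) (c : ℂ) (p : Coord n → ℂ) :
    eval p (pderiv ⟨i', b⟩ (X ⟨i, a⟩ - C c * X ⟨i, 0⟩ : MvPolynomial (Coord n) ℂ)) =
      if (⟨i', b⟩ : Coord n) = ⟨i, a⟩ then 1 else 0 := by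
  have h0 : (⟨i, 0⟩ : Coord n) ≠ ⟨i', b⟩ := by
    intro h
    obtain ⟨rfl, h⟩ := Sigma.mk.inj_iff.1 h
    exact hb (eq_of_heq h).symm
  rw [map_sub, pderiv_C_mul, pderiv_X_of_ne h0, mul_zero, sub_zero]
  split_ifs with h
  · rw [h, pderiv_X_self, map_one]
  · rw [pderiv_X_of_ne (Ne.symm h), map_zero]

variable {i₁ : Fin r} {t h : ℕ} {x : Fin h → Coord n → ℂ} {g : Fin h → MvPolynomial (Coord n) ℂ}

namespace SeparatedBy

theorem eval_self (H : SeparatedBy i₁ t x g) (l : Fin h) : eval (x l) (g l) = 1 := by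
  rw [H.eval_eq, if_pos rfl]

theorem eval_of_ne (H : SeparatedBy i₁ t x g) {l k : Fin h} (hlk : k ≠ l) :
    eval (x k) (g l) = 0 := by
  rw [H.eval_eq, if_neg hlk.symm]

theorem eval_linear_mul_eq_zero (H : SeparatedBy i₁ t x g) (l k : Fin h) (i : Fin r)
    (a : Fin (n i + 1)) :
    eval (x k) ((X ⟨i, a⟩ - C (x l ⟨i, a⟩) * X ⟨i, 0⟩) * g l) = 0 := by
  rw [map_mul]
  by_cases hk : k = l
  · subst hk
    simp [H.apply_zero]
  · rw [H.eval_of_ne hk, mul_zero]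

/-- A point near `x_l` at which all forms singular at the `x_k` are singular equals `x_l`. -/
theorem eq_of_forall_singular (H : SeparatedBy i₁ t x g) (hd : ∀ i, 1 ≤ d i)
    (ht : 2 * t + 2 ≤ d i₁) (hn : 1 ≤ n i₁) {y : Coord n → ℂ} (hy : ∀ i, y ⟨i, 0⟩ = 1)
    {l : Fin h} (hl : eval y (g l) ≠ 0)
    (hsing : ∀ f, IsMultihomogeneous f d → (∀ k ρ, eval (x k) (pderiv ρ f) = 0) →
      ∀ ρ, eval y (pderiv ρ f) = 0) : y = x l := by
  -- By Euler's identity a form singular at `y` also vanishes at `y`.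
  have hsing0 : ∀ f, IsMultihomogeneous f d → (∀ k ρ, eval (x k) (pderiv ρ f) = 0) →
      eval y f = 0 := by
    intro f hf hfx
    have h1 : Submodule.span ℂ (Set.range (dvec d y)) ≤ LinearMap.ker (pair.flip f) := by
      rw [Submodule.span_le]
      rintro _ ⟨ρ, rfl⟩
      change pair (dvec d y ρ) f = 0
      rw [pair_dvec _ _ hf]
      exact hsing f hf hfx ρ
    rw [← pair_vec y hf]
    exact h1 (vec_mem_span_dvec i₁ hd y)
  have h1 : ∀ a, y ⟨i₁, a⟩ = x l ⟨i₁, a⟩ := by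
    intro a
    let A : MvPolynomial (Coord n) ℂ := (X ⟨i₁, a⟩ - C (x l ⟨i₁, a⟩) * X ⟨i₁, 0⟩) * g l
    have hA : IsMultihomogeneous A (Pi.single i₁ 1 + Pi.single i₁ t) :=
      (isMultihomogeneous_X_sub_C_mul_X _ _ _).mul (H.isMultihomogeneous l)
    -- `A` vanishes at every `x_k`, so `A²` is singular there. Its degree `2t + 2` in the group `i₁`
    -- is what the hypothesis on `d i₁` accommodates.
    have h2 := hsing0 (A * A * fillPoly n (d - Pi.single i₁ (2 * t + 2)))
      ((hA.mul hA).mul_eq (isMultihomogeneous_fillPoly _) (by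
        ext i
        by_cases hi : i = i₁
        · subst hi
          simp
          omega
        · simp [hi]))
      fun k ρ => eval_pderiv_mul_mul_eq_zero (H.eval_linear_mul_eq_zero l k i₁ a)
        (H.eval_linear_mul_eq_zero l k i₁ a) ρ
    rw [map_mul, map_mul, eval_fillPoly _ hy, mul_one, mul_self_eq_zero] at h2
    simp only [A, map_mul, map_sub, eval_X, eval_C, hy, mul_one, mul_eq_zero, hl, or_false] at h2
    exact sub_eq_zero.1 h2
  ext ⟨i, b⟩
  by_cases hi : i = i₁
  · subst hi
    exact h1 b
  · have ha : Fin.last (n i₁) ≠ 0 := by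
      rw [Ne, Fin.ext_iff]
      simp
      omega
    let a := Fin.last (n i₁)
    let A : MvPolynomial (Coord n) ℂ := (X ⟨i₁, a⟩ - C (x l ⟨i₁, a⟩) * X ⟨i₁, 0⟩) * g l
    let B : MvPolynomial (Coord n) ℂ := (X ⟨i, b⟩ - C (x l ⟨i, b⟩) * X ⟨i, 0⟩) * g l
    have hA : IsMultihomogeneous A (Pi.single i₁ 1 + Pi.single i₁ t) :=
      (isMultihomogeneous_X_sub_C_mul_X _ _ _).mul (H.isMultihomogeneous l)
    have hB : IsMultihomogeneous B (Pi.single i 1 + Pi.single i₁ t) :=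
      (isMultihomogeneous_X_sub_C_mul_X _ _ _).mul (H.isMultihomogeneous l)
    have h2 := hsing (A * B * fillPoly n (d - (Pi.single i₁ (2 * t + 1) + Pi.single i 1)))
      ((hA.mul hB).mul_eq (isMultihomogeneous_fillPoly _) (by
        ext i'
        by_cases hi' : i' = i₁
        · subst hi'
          simp [Ne.symm hi]
          omega
        · by_cases hi2 : i' = i
          · subst hi2
            have := hd i'
            simp [hi']
            omega
          · simp [hi', hi2]))
      (fun k ρ => eval_pderiv_mul_mul_eq_zero (H.eval_linear_mul_eq_zero l k i₁ a)
        (H.eval_linear_mul_eq_zero l k i b) ρ) ⟨i₁, a⟩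
    have hL : eval y (X ⟨i₁, a⟩ - C (x l ⟨i₁, a⟩) * X ⟨i₁, 0⟩ : MvPolynomial (Coord n) ℂ) = 0 := by
      simp [hy, h1]
    have hAy : eval y A = 0 := by
      simp only [A]
      rw [map_mul, hL, zero_mul]
    have hdA : eval y (pderiv ⟨i₁, a⟩ A) = eval y (g l) := by
      simp only [A]
      rw [Derivation.leibniz, smul_eq_mul, smul_eq_mul, map_add, map_mul, map_mul, hL,
        eval_pderiv_X_sub_C_mul_X ha, if_pos rfl]
      ring
    rw [mul_assoc, eval_pderiv_mul_of_eval_eq_zero hAy, hdA, map_mul, eval_fillPoly _ hy] at h2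
    simp only [B, map_mul, map_sub, eval_X, eval_C, hy, mul_one, mul_eq_zero, hl, or_false] at h2
    exact sub_eq_zero.1 h2

/-- The tangent spaces at the points `x_l` are linearly independent and of the expected
dimension. -/
theorem eq_zero_of_sum_eq_zero (H : SeparatedBy i₁ t x g) (hd : ∀ i, 1 ≤ d i)
    (ht : 2 * t + 2 ≤ d i₁) (α : Fin h → ℂ) (β : Fin h → (Σ i, Fin (n i)) → ℂ)
    (h0 : ∑ l, α l • vec d (x l) + ∑ l, ∑ ρ, β l ρ • dvec d (x l) ⟨ρ.1, ρ.2.succ⟩ = 0) :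
    α = 0 ∧ β = 0 := by
  have hpair : ∀ f, IsMultihomogeneous f d → ∑ l, α l * eval (x l) f +
      ∑ l, ∑ ρ, β l ρ * eval (x l) (pderiv ⟨ρ.1, ρ.2.succ⟩ f) = 0 := by
    intro f hf
    have h1 := congrArg (fun w => pair w f) h0
    simp only [map_add, map_sum, map_smul, LinearMap.add_apply, LinearMap.sum_apply,
      LinearMap.smul_apply, pair_vec _ hf, pair_dvec _ _ hf, map_zero, LinearMap.zero_apply,
      smul_eq_mul] at h1
    exact h1
  have hβ : β = 0 := by
    ext l ⟨i, b⟩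
    let B : MvPolynomial (Coord n) ℂ :=
      (X ⟨i, b.succ⟩ - C (x l ⟨i, b.succ⟩) * X ⟨i, 0⟩) * g l
    have hB : IsMultihomogeneous B (Pi.single i 1 + Pi.single i₁ t) :=
      (isMultihomogeneous_X_sub_C_mul_X _ _ _).mul (H.isMultihomogeneous l)
    -- This form vanishes at all `x_k` and is singular at those with `k ≠ l`; at `x_l` its only
    -- nonzero affine partial derivative is the one in direction `(i, b)`. Pairing with it isolates
    -- the coefficient `β l ⟨i, b⟩`.
    have h1 := hpair (B * g l * fillPoly n (d - (Pi.single i₁ (2 * t) + Pi.single i 1)))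
      ((hB.mul (H.isMultihomogeneous l)).mul_eq (isMultihomogeneous_fillPoly _) (by
        ext i'
        by_cases hi' : i' = i₁
        · subst hi'
          by_cases hi2 : i' = i
          · subst hi2
            simp
            omega
          · simp [hi2]
            omega
        · by_cases hi2 : i' = i
          · subst hi2
            have := hd i'
            simp [hi']
            omega
          · simp [hi', hi2]))
    have hB0 : ∀ k, eval (x k) B = 0 := fun k => H.eval_linear_mul_eq_zero l k i b.succ
    have h2 : ∀ k (ρ : Σ i, Fin (n i)), eval (x k) (pderiv ⟨ρ.1, ρ.2.succ⟩
        (B * g l * fillPoly n (d - (Pi.single i₁ (2 * t) + Pi.single i 1)))) =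
        if k = l ∧ ρ = ⟨i, b⟩ then 1 else 0 := by
      rintro k ⟨i', b'⟩
      by_cases hk : k = l
      · subst hk
        have hL : eval (x k) (X ⟨i, b.succ⟩ - C (x k ⟨i, b.succ⟩) * X ⟨i, 0⟩ :
            MvPolynomial (Coord n) ℂ) = 0 := by
          simp [H.apply_zero]
        have hdB : eval (x k) (pderiv ⟨i', b'.succ⟩ B) =
            if (⟨i', b'⟩ : Σ i, Fin (n i)) = ⟨i, b⟩ then 1 else 0 := by
          simp only [B]
          rw [Derivation.leibniz, smul_eq_mul, smul_eq_mul, map_add, map_mul, map_mul, hL,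
            eval_pderiv_X_sub_C_mul_X (Fin.succ_ne_zero _), H.eval_self, zero_mul, zero_add,
            one_mul]
          refine if_congr ?_ rfl rfl
          rw [Sigma.mk.inj_iff, Sigma.mk.inj_iff]
          refine and_congr_right fun hii => ?_
          subst hii
          simp
        rw [mul_assoc, eval_pderiv_mul_of_eval_eq_zero (hB0 k), hdB, map_mul, eval_fillPoly _ (H.apply_zero k), H.eval_self,
          mul_one, one_mul]
        exact if_congr (by simp) rfl rfl
      · rw [if_neg (fun hh => hk hh.1)]
        exact eval_pderiv_mul_mul_eq_zero (hB0 k) (H.eval_of_ne hk) _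
    simp only [h2, map_mul, hB0, zero_mul, mul_zero, Finset.sum_const_zero, zero_add] at h1
    rw [Finset.sum_eq_single l, Finset.sum_eq_single ⟨i, b⟩] at h1
    · simpa using h1
    · intro ρ _ hρ
      simp [hρ]
    · simp
    · intro k _ hk
      simp [hk]
    · simp
  refine ⟨?_, hβ⟩
  ext l
  -- With `β = 0` known, `g_l²` isolates `α l`.
  have h1 := hpair (g l * g l * fillPoly n (d - Pi.single i₁ (2 * t)))
    (((H.isMultihomogeneous l).mul (H.isMultihomogeneous l)).mul_eq
      (isMultihomogeneous_fillPoly _) (by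
        ext i'
        by_cases hi' : i' = i₁
        · subst hi'
          simp
          omega
        · simp [hi']))
  rw [Finset.sum_eq_single l] at h1
  · simpa [hβ, H.eval_self, eval_fillPoly _ (H.apply_zero l)] using h1
  · intro k _ hk
    simp [H.eval_of_ne hk]
  · simp

theorem linearIndependent_vec (H : SeparatedBy i₁ t x g) (hd : ∀ i, 1 ≤ d i)
    (ht : 2 * t + 2 ≤ d i₁) : LinearIndependent ℂ fun l => vec d (x l) := by
  rw [Fintype.linearIndependent_iff]
  intro α hα l
  have := (H.eq_zero_of_sum_eq_zero hd ht α 0 (by simpa using hα)).1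
  rw [this, Pi.zero_apply]

end SeparatedBy

end SecantGeometry

end

noncomputable section

namespace SecantGeometry

open MvPolynomial

/-! ### Secant planes -/

/-- If the condition fails for some vectors of the span of a frame, keep their coefficients fixed
and vary the frame: it still fails on a principal open set of frames. -/
theorem isClosed_grass_setOf_forall_eval_eq_zero {σ : Type} {h N : ℕ}
    (F : MvPolynomial (Fin N × σ) ℂ) :
    IsClosed {L : Grass σ h | ∀ w : Fin N → σ → ℂ, (∀ i, w i ∈ L.1) →
      eval (fun p => w p.1 p.2) F = 0} := by
  rw [← isOpen_compl_iff]
  refine (isOpen_coinduced_affineZariski_iff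
    (fun v : {v : Fin h → σ → ℂ // LinearIndependent ℂ v} =>
      (⟨Submodule.span ℂ (Set.range v.1), by
        simpa using finrank_span_eq_card v.2⟩ : Grass σ h))
    (fun v (ij : Fin h × σ) => v.1 ij.1 ij.2)).2 ?_
  intro v hv
  obtain ⟨w, hw, hF⟩ : ∃ w : Fin N → σ → ℂ, (∀ i, w i ∈ Submodule.span ℂ (Set.range v.1)) ∧
      eval (fun p => w p.1 p.2) F ≠ 0 := by
    by_contra! hcon
    exact hv hcon
  choose a ha using fun i => (Submodule.mem_span_range_iff_exists_fun ℂ).1 (hw i)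
  have hev : ∀ v : Fin h → σ → ℂ, eval (fun ij : Fin h × σ => v ij.1 ij.2)
      (aeval (fun p : Fin N × σ => ∑ k, C (a p.1 k) * X (k, p.2)) F) =
      eval (fun p => (∑ k, a p.1 k • v k) p.2) F := by
    intro v
    rw [eval_aeval]
    congr 2
    ext p
    simp [Finset.sum_apply]
  refine ⟨aeval (fun p : Fin N × σ => ∑ k, C (a p.1 k) * X (k, p.2)) F, ?_, fun v' hv' hall => ?_⟩
  · rw [hev]
    simpa only [ha] using hF
  · rw [hev] at hv'
    exact hv' (hall (fun i => ∑ k, a i k • v'.1 k) fun i =>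
      (Submodule.mem_span_range_iff_exists_fun ℂ).2 ⟨a i, rfl⟩)

theorem Matrix.det_mul_eq_zero_of_lt {N k : ℕ} (hk : k < N) (A : Matrix (Fin N) (Fin k) ℂ)
    (B : Matrix (Fin k) (Fin N) ℂ) : (A * B).det = 0 := by
  obtain ⟨v, hv, hv0⟩ : ∃ v : Fin N → ℂ, B.mulVec v = 0 ∧ v ≠ 0 := by
    have : LinearMap.ker B.mulVecLin ≠ ⊥ :=
      LinearMap.ker_ne_bot_of_finrank_lt (by simpa using hk)
    obtain ⟨v, hv, hv0⟩ := (Submodule.ne_bot_iff _).1 this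
    exact ⟨v, hv, hv0⟩
  refine Matrix.exists_mulVec_eq_zero_iff.1 ⟨v, hv0, ?_⟩
  rw [← Matrix.mulVec_mulVec, hv, Matrix.mulVec_zero]

variable {r : ℕ} {n d : Fin r → ℕ}

/-- Since evaluation is multiplicative, the matrix factors through `ℂ^k` via the values of the `P i`
and the `Q j` at the `k` points. Each row may use its own vector `w i` of the span. -/
theorem det_pair_eq_zero {N k : ℕ} (hk : k < N) (y : Fin k → Coord n → ℂ)
    {w : Fin N → MonomialIndex n d → ℂ}
    (hw : ∀ i, w i ∈ Submodule.span ℂ (Set.range fun l => vec d (y l)))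
    {P Q : Fin N → MvPolynomial (Coord n) ℂ} (hPQ : ∀ i j, IsMultihomogeneous (P i * Q j) d) :
    Matrix.det (Matrix.of fun i j => pair (w i) (P i * Q j)) = 0 := by
  choose a ha using fun i => (Submodule.mem_span_range_iff_exists_fun ℂ).1 (hw i)
  have : (Matrix.of fun i j => pair (w i) (P i * Q j)) =
      (Matrix.of fun i l => a i l * eval (y l) (P i) : Matrix (Fin N) (Fin k) ℂ) *
        (Matrix.of fun l j => eval (y l) (Q j) : Matrix (Fin k) (Fin N) ℂ) := by
    ext i j
    rw [Matrix.mul_apply, Matrix.of_apply, ← ha]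
    simp only [map_sum, map_smul, LinearMap.sum_apply, LinearMap.smul_apply, Matrix.of_apply,
      pair_vec _ (hPQ i j), map_mul, smul_eq_mul, mul_assoc]
  rw [this, Matrix.det_mul_eq_zero_of_lt hk]

theorem submodule_mk_vec {x : Coord n → ℂ} (hv : vec d x ≠ 0) :
    (Projectivization.mk ℂ (vec d x) hv).submodule = Submodule.span ℂ {vec d x} :=
  Projectivization.submodule_mk _ _

theorem exists_iSup_submodule_eq_span {k : ℕ} {q : Fin k → ℙ ℂ (MonomialIndex n d → ℂ)}
    (hq : ∀ l, q l ∈ segreVeronese n d) : ∃ y : Fin k → Coord n → ℂ,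
      (⨆ l, (q l).submodule) = Submodule.span ℂ (Set.range fun l => vec d (y l)) := by
  choose y _ hv hqy using fun l => exists_eq_mk_vec (hq l)
  refine ⟨y, ?_⟩
  rw [Submodule.span_range_eq_iSup]
  exact iSup_congr fun l => by rw [hqy l, submodule_mk_vec]

/-- The vanishing of the determinant for all vectors of a plane is a closed condition on the plane,
so it passes from honest spans of points to their limits. -/
theorem det_pair_eq_zero_of_mem_secantPlanes {h : ℕ} {L : Grass (MonomialIndex n d) h}
    (hL : L ∈ secantPlanes (segreVeronese n d) h) {w : Fin (h + 1) → MonomialIndex n d → ℂ}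
    (hw : ∀ i, w i ∈ L.1) {P Q : Fin (h + 1) → MvPolynomial (Coord n) ℂ}
    (hPQ : ∀ i j, IsMultihomogeneous (P i * Q j) d) :
    Matrix.det (Matrix.of fun i j => pair (w i) (P i * Q j)) = 0 := by
  let F : MvPolynomial (Fin (h + 1) × MonomialIndex n d) ℂ :=
    Matrix.det (Matrix.of fun i j => ∑ J, X (i, J) * C (coeff (expo J) (P i * Q j)))
  have hF : ∀ w : Fin (h + 1) → MonomialIndex n d → ℂ, eval (fun p => w p.1 p.2) F =
      Matrix.det (Matrix.of fun i j => pair (w i) (P i * Q j)) := by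
    intro w
    simp only [F]
    rw [RingHom.map_det]
    congr 1
    ext i j
    simp [pair_apply]
  rw [← hF]
  refine closure_minimal ?_ (isClosed_grass_setOf_forall_eval_eq_zero F) hL w hw
  rintro L' ⟨q, hq, hL'⟩ w' hw'
  obtain ⟨y, hy⟩ := exists_iSup_submodule_eq_span hq
  rw [hF]
  refine det_pair_eq_zero (Nat.lt_succ_self h) y (fun i => ?_) hPQ
  rw [← hy, ← hL']
  exact hw' i

/-- Limits of secant planes satisfy the equations of the parametrized secants, which is the
hypothesis needed by `exists_open_subset_image`. -/
theorem eval_eq_zero_of_mem_secantPlanes {h : ℕ} {L : Grass (MonomialIndex n d) h}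
    (hL : L ∈ secantPlanes (segreVeronese n d) h) {P : MvPolynomial (MonomialIndex n d) ℂ}
    (hP : ∀ (c : Fin h → ℂ) (y : Fin h → Coord n → ℂ), eval (∑ l, c l • vec d (y l)) P = 0)
    {v : MonomialIndex n d → ℂ} (hv : v ∈ L.1) : eval v P = 0 := by
  let F : MvPolynomial (Fin 1 × MonomialIndex n d) ℂ := rename (fun J => (0, J)) P
  have hF : ∀ w : Fin 1 → MonomialIndex n d → ℂ, eval (fun p => w p.1 p.2) F = eval (w 0) P := by
    intro w
    simp only [F]
    rw [eval_rename]
    rfl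
  have := closure_minimal ?_ (isClosed_grass_setOf_forall_eval_eq_zero F) hL (fun _ => v)
    fun _ => hv
  · exact (hF fun _ => v).symm.trans this
  · rintro L' ⟨q, hq, hL'⟩ w' hw'
    obtain ⟨y, hy⟩ := exists_iSup_submodule_eq_span hq
    rw [hF]
    have h1 := hw' 0
    rw [hL', hy] at h1
    obtain ⟨c, hc⟩ := (Submodule.mem_span_range_iff_exists_fun ℂ).1 h1
    rw [← hc]
    exact hP c y

theorem mk_mem_secantVariety {h : ℕ} {x : Fin h → Coord n → ℂ}
    (hx : ∀ l i, ∃ a, x l ⟨i, a⟩ ≠ 0) (hind : LinearIndependent ℂ fun l => vec d (x l))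
    {v : MonomialIndex n d → ℂ} (hv : v ≠ 0)
    (hmem : v ∈ Submodule.span ℂ (Set.range fun l => vec d (x l))) :
    Projectivization.mk ℂ v hv ∈ secantVariety (segreVeronese n d) h := by
  refine ⟨(Projectivization.mk ℂ v hv, ⟨Submodule.span ℂ (Set.range fun l => vec d (x l)), by
    simpa using finrank_span_eq_card hind⟩), ⟨?_, subset_closure ?_⟩, rfl⟩
  · change (Projectivization.mk ℂ v hv).submodule ≤ _
    rw [Projectivization.submodule_mk, Submodule.span_singleton_le_iff_mem]
    exact hmem
  · refine ⟨fun l => Projectivization.mk ℂ _ (vec_ne_zero (hx l)),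
      fun l => mk_vec_mem (hx l) _, ?_⟩
    change Submodule.span ℂ _ = _
    rw [Submodule.span_range_eq_iSup]
    exact iSup_congr fun l => (submodule_mk_vec _).symm

/-! ### Secant planes through a general point -/

theorem IsMultihomogeneous.eval_congr {i₁ : Fin r} {t : ℕ} {f : MvPolynomial (Coord n) ℂ}
    (hf : IsMultihomogeneous f (Pi.single i₁ t)) {x y : Coord n → ℂ}
    (hxy : ∀ a, x ⟨i₁, a⟩ = y ⟨i₁, a⟩) : eval x f = eval y f := by
  rw [eval_eq', eval_eq']
  refine Finset.sum_congr rfl fun m hm => ?_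
  congr 1
  refine Finset.prod_congr rfl fun ρ _ => ?_
  obtain ⟨i, a⟩ := ρ
  by_cases hi : i = i₁
  · subst hi
    rw [hxy]
  · have h1 := congrFun (hf (mem_support_iff.1 hm)) i
    rw [weight_apply, Pi.single_eq_of_ne hi, Finset.sum_eq_zero_iff] at h1
    rw [h1 a (Finset.mem_univ a), pow_zero, pow_zero]

/-- Split off `s` of the `d i₁` variables that the monomial has in the group `i₁`. -/
theorem exists_monoPoly_eq_mul (i₁ : Fin r) {s : ℕ} (hs : s ≤ d i₁) (J : MonomialIndex n d) :
    ∃ A B : MvPolynomial (Coord n) ℂ, monoPoly J = A * B ∧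
      IsMultihomogeneous A (Pi.single i₁ s) ∧ IsMultihomogeneous B (d - Pi.single i₁ s) := by
  obtain ⟨S, hSJ, hS⟩ : ∃ S ≤ (J i₁ : Multiset (Fin (n i₁ + 1))), S.card = s := by
    have h1 : s ≤ (J i₁ : Multiset (Fin (n i₁ + 1))).card := hs.trans (J i₁).2.ge
    have h2 : 0 < (Multiset.powersetCard s (J i₁ : Multiset (Fin (n i₁ + 1)))).card := by
      rw [Multiset.card_powersetCard]
      exact Nat.choose_pos h1
    obtain ⟨S, hS⟩ := Multiset.card_pos_iff_exists_mem.1 h2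
    exact ⟨S, Multiset.mem_powersetCard.1 hS⟩
  let m : Coord n →₀ ℕ :=
    (Multiset.toFinsupp S).embDomain (Function.Embedding.sigmaMk (β := fun i => Fin (n i + 1)) i₁)
  have hm₁ : ∀ a, m ⟨i₁, a⟩ = Multiset.count a S := fun a =>
    (Finsupp.embDomain_apply_self _ _ a).trans (Multiset.toFinsupp_apply S a)
  have hm₀ : ∀ i, i ≠ i₁ → ∀ a, m ⟨i, a⟩ = 0 := by
    intro i hi a
    refine Finsupp.embDomain_of_notMem_range _ _ _ ?_
    rintro ⟨b, hb⟩
    exact hi (Sigma.mk.inj_iff.1 hb).1.symm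
  have hmJ : m ≤ expo J := by
    rintro ⟨i, a⟩
    by_cases hi : i = i₁
    · subst hi
      rw [hm₁]
      exact Multiset.count_le_of_le a hSJ
    · rw [hm₀ i hi]
      exact Nat.zero_le _
  have hsum : ∀ i, ∑ a, m ⟨i, a⟩ = (Pi.single i₁ s : Fin r → ℕ) i := by
    intro i
    by_cases hi : i = i₁
    · subst hi
      simp only [hm₁, Pi.single_eq_same]
      rw [← hS]
      exact Multiset.sum_count_eq_card fun a _ => Finset.mem_univ a
    · simp [hm₀ i hi, hi]
  refine ⟨monomial m 1, monomial (expo J - m) 1, ?_, ?_, ?_⟩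
  · rw [monomial_mul, add_tsub_cancel_of_le hmJ, one_mul, monoPoly]
  · refine isWeightedHomogeneous_monomial _ _ _ ?_
    ext i
    rw [weight_apply, hsum]
  · refine isWeightedHomogeneous_monomial _ _ _ ?_
    ext i
    rw [weight_apply, Pi.sub_apply, ← hsum, ← sum_expo J i]
    exact Finset.sum_tsub_distrib _ fun a _ => hmJ ⟨i, a⟩

theorem single_one_add_single (i₁ : Fin r) (t : ℕ) :
    (Pi.single i₁ 1 + Pi.single i₁ t : Fin r → ℕ) = Pi.single i₁ (t + 1) := by
  rw [← Pi.single_add, add_comm]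

variable {i₁ : Fin r} {t h : ℕ} {x : Fin h → Coord n → ℂ} {g : Fin h → MvPolynomial (Coord n) ℂ}

namespace SeparatedBy

theorem eval_X_mul (H : SeparatedBy i₁ t x g) (l k : Fin h) :
    eval (x k) (X ⟨i₁, 0⟩ * g l) = if l = k then 1 else 0 := by
  rw [map_mul, eval_X, H.apply_zero, one_mul, H.eval_eq]

theorem eval_X_mul_mul_fillPoly (H : SeparatedBy i₁ t x g) (δ : Fin r → ℕ) (l k : Fin h) :
    eval (x k) (X ⟨i₁, 0⟩ * g l * fillPoly n δ) = if l = k then 1 else 0 := by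
  rw [map_mul, H.eval_X_mul, eval_fillPoly _ (H.apply_zero k), mul_one]

theorem isMultihomogeneous_X_mul (H : SeparatedBy i₁ t x g) (l : Fin h) :
    IsMultihomogeneous (X ⟨i₁, 0⟩ * g l) (Pi.single i₁ (t + 1)) :=
  (isMultihomogeneous_X _).mul_eq (H.isMultihomogeneous l) (single_one_add_single i₁ t)

theorem isMultihomogeneous_mul_mul_fillPoly (H : SeparatedBy i₁ t x g) (ht : 2 * t + 2 ≤ d i₁)
    {f : MvPolynomial (Coord n) ℂ} (hf : IsMultihomogeneous f (Pi.single i₁ 1)) (l : Fin h) :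
    IsMultihomogeneous (f * g l * fillPoly n (d - Pi.single i₁ (2 * t + 2)))
      (d - Pi.single i₁ (t + 1)) :=
  (hf.mul (H.isMultihomogeneous l)).mul_eq (isMultihomogeneous_fillPoly _) (by
    ext i
    by_cases hi : i = i₁
    · subst hi
      simp
      omega
    · simp [hi])

theorem single_add_sub (ht : 2 * t + 2 ≤ d i₁) :
    Pi.single i₁ (t + 1) + (d - Pi.single i₁ (t + 1)) = d := by
  ext i
  by_cases hi : i = i₁
  · subst hi
    simp
    omega
  · simp [hi]

/-- A vector annihilating all products of complementary forms one of which vanishes at all the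
points `x_k` lies in the span of these points. -/
theorem mem_span_of_forall_pair_eq_zero (H : SeparatedBy i₁ t x g) (ht : 2 * t + 2 ≤ d i₁)
    {w : MonomialIndex n d → ℂ}
    (hw : ∀ A B, IsMultihomogeneous A (Pi.single i₁ (t + 1)) →
      IsMultihomogeneous B (d - Pi.single i₁ (t + 1)) →
      ((∀ k, eval (x k) A = 0) ∨ ∀ k, eval (x k) B = 0) → pair w (A * B) = 0) :
    w ∈ Submodule.span ℂ (Set.range fun l => vec d (x l)) := by
  obtain ⟨F, hF⟩ : ∃ F, F = fillPoly n (d - Pi.single i₁ (2 * t + 2)) := ⟨_, rfl⟩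
  -- `G` and `K` are families of complementary multidegrees, both dual to the points; they carry the
  -- extra factor `x_{i₁,0}` so that it can be exchanged for a linear form vanishing at one of the
  -- points.
  obtain ⟨G, hGdef⟩ : ∃ G : Fin h → MvPolynomial (Coord n) ℂ, ∀ l, G l = X ⟨i₁, 0⟩ * g l :=
    ⟨_, fun _ => rfl⟩
  obtain ⟨K, hKdef⟩ : ∃ K : Fin h → MvPolynomial (Coord n) ℂ, ∀ l, K l = X ⟨i₁, 0⟩ * g l * F :=
    ⟨_, fun _ => rfl⟩
  have hL : ∀ (b : Fin (n i₁ + 1)) (c : ℂ), IsMultihomogeneous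
      (X ⟨i₁, b⟩ - C c * X ⟨i₁, 0⟩ : MvPolynomial (Coord n) ℂ) (Pi.single i₁ 1) :=
    fun b c => isMultihomogeneous_X_sub_C_mul_X _ _ _
  have hG : ∀ l, IsMultihomogeneous (G l) (Pi.single i₁ (t + 1)) := fun l => by
    rw [hGdef]
    exact H.isMultihomogeneous_X_mul l
  have hK : ∀ l, IsMultihomogeneous (K l) (d - Pi.single i₁ (t + 1)) := fun l => by
    rw [hKdef, hF]
    exact H.isMultihomogeneous_mul_mul_fillPoly ht (isMultihomogeneous_X _) l
  have hGe : ∀ l k, eval (x k) (G l) = if l = k then 1 else 0 := fun l k => by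
    rw [hGdef, H.eval_X_mul]
  have hKe : ∀ l k, eval (x k) (K l) = if l = k then 1 else 0 := fun l k => by
    rw [hKdef, hF, H.eval_X_mul_mul_fillPoly]
  -- As `g_l` separates `x_l` from `x_k`, these differ in some coordinate `b` of the group `i₁`.
  -- Exchange `x_{i₁,0}` for a linear form through `x_l` in the first factor, or through `x_k` in
  -- the second: both products are annihilated by `w`, and their difference is a nonzero multiple of
  -- `G l * K k`.
  have hcross : ∀ l k, l ≠ k → pair w (G l * K k) = 0 := by
    intro l k hlk
    obtain ⟨b, hb⟩ : ∃ b, x l ⟨i₁, b⟩ ≠ x k ⟨i₁, b⟩ := by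
      by_contra! hall
      have := (H.isMultihomogeneous l).eval_congr hall
      rw [H.eval_self, H.eval_of_ne hlk.symm] at this
      exact one_ne_zero this
    have hA : IsMultihomogeneous ((X ⟨i₁, b⟩ - C (x l ⟨i₁, b⟩) * X ⟨i₁, 0⟩) * g l)
        (Pi.single i₁ (t + 1)) := by
      rw [← single_one_add_single i₁ t]
      exact (hL b (x l ⟨i₁, b⟩)).mul (H.isMultihomogeneous l)
    have hA0 : ∀ m, eval (x m) ((X ⟨i₁, b⟩ - C (x l ⟨i₁, b⟩) * X ⟨i₁, 0⟩) * g l) = 0 :=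
      fun m => H.eval_linear_mul_eq_zero l m i₁ b
    have h1 := hw _ (K k) hA (hK k) (Or.inl hA0)
    have h2 := hw (G l) ((X ⟨i₁, b⟩ - C (x k ⟨i₁, b⟩) * X ⟨i₁, 0⟩) * g k * F) (hG l)
      (by
        rw [hF]
        exact H.isMultihomogeneous_mul_mul_fillPoly ht (hL b _) k)
      (Or.inr fun m => by rw [map_mul, H.eval_linear_mul_eq_zero k m i₁ b, zero_mul])
    have h3 : (X ⟨i₁, b⟩ - C (x l ⟨i₁, b⟩) * X ⟨i₁, 0⟩) * g l * K k -
        G l * ((X ⟨i₁, b⟩ - C (x k ⟨i₁, b⟩) * X ⟨i₁, 0⟩) * g k * F) =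
        (x k ⟨i₁, b⟩ - x l ⟨i₁, b⟩) • (G l * K k) := by
      rw [smul_eq_C_mul, C_sub]
      rw [hGdef, hKdef]
      ring
    have h4 := congrArg (pair w) h3
    rw [map_sub, h1, h2, sub_zero, map_smul, smul_eq_mul] at h4
    exact (mul_eq_zero.1 h4.symm).resolve_left (sub_ne_zero.2 hb.symm)
  -- Modulo forms vanishing at all points, `A` is `∑ A(x_k) G k` and `B` is `∑ B(x_k) K k`; the
  -- mixed terms vanish by `hcross`. So `w` acts on products as a combination of evaluations at the
  -- points.
  have hformula : ∀ A B, IsMultihomogeneous A (Pi.single i₁ (t + 1)) →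
      IsMultihomogeneous B (d - Pi.single i₁ (t + 1)) →
      pair w (A * B) = ∑ k, pair w (G k * K k) * eval (x k) (A * B) := by
    intro A B hA hB
    have h1 := hw (A - ∑ k, C (eval (x k) A) * G k) B
      (hA.sub (IsMultihomogeneous.sum _ _ fun k _ => (hG k).C_mul _)) hB
      (Or.inl fun m => by simp [map_sub, map_sum, hGe])
    have h2 : ∀ k, pair w (G k * B) = pair w (G k * K k) * eval (x k) B := by
      intro k
      have h3 := hw (G k) (B - ∑ m, C (eval (x m) B) * K m) (hG k)
        (hB.sub (IsMultihomogeneous.sum _ _ fun k _ => (hK k).C_mul _))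
        (Or.inr fun m => by simp [map_sub, map_sum, hKe])
      rw [mul_sub, map_sub, sub_eq_zero, Finset.mul_sum, map_sum] at h3
      rw [h3, Finset.sum_eq_single k]
      · rw [mul_left_comm, ← smul_eq_C_mul, map_smul, smul_eq_mul, mul_comm]
      · intro m _ hm
        rw [mul_left_comm, ← smul_eq_C_mul, map_smul, hcross k m hm.symm, smul_zero]
      · simp
    rw [sub_mul, map_sub, sub_eq_zero, Finset.sum_mul, map_sum] at h1
    rw [h1]
    refine Finset.sum_congr rfl fun k _ => ?_
    rw [mul_assoc, ← smul_eq_C_mul, map_smul, h2, map_mul (eval (x k)), smul_eq_mul]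
    ring
  refine (Submodule.mem_span_range_iff_exists_fun ℂ).2 ⟨fun k => pair w (G k * K k), ?_⟩
  ext J
  obtain ⟨A, B, hJ, hA, hB⟩ := exists_monoPoly_eq_mul i₁ (show t + 1 ≤ d i₁ by omega) J
  rw [← pair_monoPoly w J, hJ, hformula A B hA hB, Finset.sum_apply]
  refine Finset.sum_congr rfl fun k _ => ?_
  rw [Pi.smul_apply, smul_eq_mul, vec, hJ]

/-- Take the determinant of size `h + 1` whose first row uses `w` and `A`, whose other rows use the
point `p` and the `G l`, and whose columns are `B` and the `K k`. Below the corner the first column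
is `p(G l * B) = 0`, and the remaining block is `diag(c)`; hence `w(A B) ∏ c_l = 0`. -/
theorem pair_mul_eq_zero {L : Grass (MonomialIndex n d) h}
    (hL : L ∈ secantPlanes (segreVeronese n d) h) {c : Fin h → ℂ} (hc : ∀ l, c l ≠ 0)
    (hp : ∑ l, c l • vec d (x l) ∈ L.1) {w : MonomialIndex n d → ℂ} (hw : w ∈ L.1)
    {δ ε : Fin r → ℕ} (hδε : δ + ε = d) {A B : MvPolynomial (Coord n) ℂ}
    {G K : Fin h → MvPolynomial (Coord n) ℂ} (hA : IsMultihomogeneous A δ)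
    (hG : ∀ l, IsMultihomogeneous (G l) δ) (hB : IsMultihomogeneous B ε)
    (hK : ∀ l, IsMultihomogeneous (K l) ε)
    (hGe : ∀ l k, eval (x k) (G l) = if l = k then 1 else 0)
    (hKe : ∀ l k, eval (x k) (K l) = if l = k then 1 else 0) (hB0 : ∀ k, eval (x k) B = 0) :
    pair w (A * B) = 0 := by
  let P : Fin (h + 1) → MvPolynomial (Coord n) ℂ := Fin.cons A G
  let Q : Fin (h + 1) → MvPolynomial (Coord n) ℂ := Fin.cons B K
  have hP : ∀ i, IsMultihomogeneous (P i) δ := Fin.cases hA hG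
  have hQ : ∀ i, IsMultihomogeneous (Q i) ε := Fin.cases hB hK
  let p := ∑ l, c l • vec d (x l)
  have hpair : ∀ f, IsMultihomogeneous f d → pair p f = ∑ l, c l * eval (x l) f := by
    intro f hf
    simp only [p, map_sum, map_smul, LinearMap.sum_apply, LinearMap.smul_apply, pair_vec _ hf,
      smul_eq_mul]
  have hdet := det_pair_eq_zero_of_mem_secantPlanes hL
    (w := Fin.cons w fun _ => p) (Fin.cases hw fun _ => hp) (P := P) (Q := Q)
    fun i j => (hP i).mul_eq (hQ j) hδε
  rw [Matrix.det_succ_column_zero, Finset.sum_eq_single 0] at hdet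
  · have hdiag : (Matrix.submatrix (Matrix.of fun i j =>
        pair ((Fin.cons w fun _ => p : Fin (h + 1) → MonomialIndex n d → ℂ) i) (P i * Q j))
        (Fin.succAbove 0) Fin.succ) = Matrix.diagonal c := by
      ext l k
      rw [Matrix.submatrix_apply, Matrix.of_apply, Fin.succAbove_zero, Fin.cons_succ]
      simp only [P, Q, Fin.cons_succ]
      rw [hpair _ ((hG l).mul_eq (hK k) hδε)]
      simp only [map_mul, hGe, hKe, Matrix.diagonal_apply]
      rw [Finset.sum_eq_single l]
      · by_cases hlk : l = k
        · subst hlk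
          simp
        · simp [hlk, Ne.symm hlk]
      · intro m _ hm
        simp [hm.symm]
      · simp
    rw [hdiag, Matrix.det_diagonal] at hdet
    simpa [P, Q, Finset.prod_eq_zero_iff, hc] using hdet
  · intro i _ hi
    obtain ⟨l, rfl⟩ := Fin.exists_succ_eq.2 hi
    have : pair p (G l * B) = 0 := by
      rw [hpair _ ((hG l).mul_eq hB hδε)]
      simp [hB0]
    simp [P, Q, this]
  · simp

/-- The only secant plane through a point in general position is the span of the points. -/
theorem eq_span_of_mem_secantPlanes (H : SeparatedBy i₁ t x g) (hd : ∀ i, 1 ≤ d i)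
    (ht : 2 * t + 2 ≤ d i₁) {L : Grass (MonomialIndex n d) h}
    (hL : L ∈ secantPlanes (segreVeronese n d) h) {c : Fin h → ℂ} (hc : ∀ l, c l ≠ 0)
    (hp : ∑ l, c l • vec d (x l) ∈ L.1) :
    L.1 = Submodule.span ℂ (Set.range fun l => vec d (x l)) := by
  have hle : L.1 ≤ Submodule.span ℂ (Set.range fun l => vec d (x l)) := by
    intro w hw
    refine H.mem_span_of_forall_pair_eq_zero ht fun A B hA hB hor => ?_
    -- The key vanishing is asymmetric in the two factors; the first case swaps their roles.
    -- Equality of dimensions then upgrades the inclusion to an equality.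
    rcases hor with h0 | h0
    · rw [mul_comm]
      exact pair_mul_eq_zero hL hc hp hw (by rw [add_comm, single_add_sub ht]) hB
        (H.isMultihomogeneous_mul_mul_fillPoly ht (isMultihomogeneous_X _)) hA
        H.isMultihomogeneous_X_mul (H.eval_X_mul_mul_fillPoly _) H.eval_X_mul h0
    · exact pair_mul_eq_zero hL hc hp hw (single_add_sub ht) hA
        H.isMultihomogeneous_X_mul hB
        (H.isMultihomogeneous_mul_mul_fillPoly ht (isMultihomogeneous_X _))
        H.eval_X_mul (H.eval_X_mul_mul_fillPoly _) h0
  refine Submodule.eq_of_le_of_finrank_eq hle ?_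
  rw [L.2, finrank_span_eq_card (H.linearIndependent_vec hd ht), Fintype.card_fin]

/-- For this point the `h × h` matrix of pairings is `diag(c)`, which is invertible, whereas on the
span of `k < h` points it would be singular. -/
theorem not_mem_span_of_lt (H : SeparatedBy i₁ t x g) (ht : 2 * t + 2 ≤ d i₁)
    {c : Fin h → ℂ} (hc : ∀ l, c l ≠ 0) {k : ℕ} (hk : k < h) (y : Fin k → Coord n → ℂ) :
    ∑ l, c l • vec d (x l) ∉ Submodule.span ℂ (Set.range fun l => vec d (y l)) := by
  intro hmem
  have hmul : ∀ l k, IsMultihomogeneous ((X ⟨i₁, 0⟩ * g l) *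
      (X ⟨i₁, 0⟩ * g k * fillPoly n (d - Pi.single i₁ (2 * t + 2)))) d := fun l k =>
    (H.isMultihomogeneous_X_mul l).mul_eq
      (H.isMultihomogeneous_mul_mul_fillPoly ht (isMultihomogeneous_X _) k) (single_add_sub ht)
  have hdet := det_pair_eq_zero hk y (fun _ : Fin h => hmem) hmul
  have hdiag : (Matrix.of fun l k => pair (∑ l, c l • vec d (x l)) ((X ⟨i₁, 0⟩ * g l) *
      (X ⟨i₁, 0⟩ * g k * fillPoly n (d - Pi.single i₁ (2 * t + 2))))) = Matrix.diagonal c := by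
    ext l k
    simp only [Matrix.of_apply, map_sum, map_smul, LinearMap.sum_apply, LinearMap.smul_apply,
      pair_vec _ (hmul l k), smul_eq_mul]
    simp only [map_mul (eval _) (X ⟨i₁, 0⟩ * g l), H.eval_X_mul, H.eval_X_mul_mul_fillPoly,
      Matrix.diagonal_apply]
    rw [Finset.sum_eq_single l]
    · by_cases hlk : l = k
      · subst hlk
        simp
      · simp [hlk, Ne.symm hlk]
    · intro m _ hm
      simp [hm.symm]
    · simp
  rw [hdiag, Matrix.det_diagonal, Finset.prod_eq_zero_iff] at hdet
  obtain ⟨l, -, hl⟩ := hdet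
  exact hc l hl

end SeparatedBy

end SecantGeometry

end

noncomputable section

namespace SecantGeometry

open MvPolynomial

/-! ### Genericity of separated configurations -/

variable {r : ℕ} {n d : Fin r → ℕ} {h : ℕ}

/-- Distinct monomials are linearly independent functions, so their vectors of joint values lie in
no hyperplane of `ℂ^h`; `h` of these vectors form a basis. -/
theorem exists_det_vec_ne_zero {δ : Fin r → ℕ} {a : Fin h → MonomialIndex n δ}
    (ha : Function.Injective a) : ∃ x : Fin h → Coord n → ℂ,
      Matrix.det (Matrix.of fun l k => vec δ (x l) (a k)) ≠ 0 := by
  let φ : (Coord n → ℂ) → Fin h → ℂ := fun x k => vec δ x (a k)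
  have htop : Submodule.span ℂ (Set.range φ) = ⊤ := by
    by_contra hne
    obtain ⟨f, hf0, hf⟩ := Submodule.exists_le_ker_of_lt_top _ (lt_top_iff_ne_top.2 hne)
    refine hf0 (LinearMap.pi_ext' fun k => LinearMap.ext_ring ?_)
    have hpoly : ∑ k, C (f (Pi.single k 1)) * monoPoly (a k) = 0 := by
      refine MvPolynomial.funext fun x => ?_
      have h1 : f (φ x) = 0 := hf (Submodule.subset_span ⟨x, rfl⟩)
      rw [LinearMap.pi_apply_eq_sum_univ f] at h1
      rw [map_zero, map_sum, ← h1]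
      refine Finset.sum_congr rfl fun k _ => ?_
      rw [map_mul, eval_C, smul_eq_mul, mul_comm]
      congr 2
      ext j
      simp [Pi.single_apply, eq_comm]
    have h2 := congrArg (coeff (expo (a k))) hpoly
    rw [coeff_sum, Finset.sum_eq_single k] at h2
    · simpa [monoPoly] using h2
    · intro j _ hj
      rw [coeff_C_mul, monoPoly, coeff_monomial,
        if_neg fun h => hj (ha (expo_injective h)), mul_zero]
    · simp
  obtain ⟨f, hf, -, hind⟩ := Submodule.exists_fun_fin_finrank_span_eq ℂ (Set.range φ)
  have hcard : Module.finrank ℂ (Submodule.span ℂ (Set.range φ)) = h := by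
    rw [htop, finrank_top, Module.finrank_fin_fun]
  choose x hx using hf
  refine ⟨fun l => x (Fin.cast hcard.symm l), ?_⟩
  have hind' := hind.comp _ (Fin.cast_injective hcard.symm)
  have hrow : (Matrix.of fun l k => vec δ (x (Fin.cast hcard.symm l)) (a k)).row =
      f ∘ Fin.cast hcard.symm := funext fun l => hx _
  have hunit := Matrix.linearIndependent_rows_iff_isUnit.1 (hrow ▸ hind')
  exact ((Matrix.isUnit_iff_isUnit_det _).1 hunit).ne_zero

/-- The polynomial on the space of `h`-tuples of points expressing that the points lie in the
standard chart and are separated by the monomials `a`. -/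
def separationPoly {δ : Fin r → ℕ} (a : Fin h → MonomialIndex n δ) :
    MvPolynomial (Fin h × Coord n) ℂ :=
  (∏ l, ∏ i, X (l, ⟨i, 0⟩)) *
    Matrix.det (Matrix.of fun l k => rename (Prod.mk l) (monoPoly (a k)))

theorem eval_separationPoly {δ : Fin r → ℕ} (a : Fin h → MonomialIndex n δ)
    (x : Fin h → Coord n → ℂ) : eval (fun p => x p.1 p.2) (separationPoly a) =
      (∏ l, ∏ i, x l ⟨i, 0⟩) * Matrix.det (Matrix.of fun l k => vec δ (x l) (a k)) := by
  rw [separationPoly, map_mul, RingHom.map_det]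
  simp only [map_prod, eval_X]
  congr 2
  ext l k
  simp only [RingHom.mapMatrix_apply, Matrix.map_apply, Matrix.of_apply, eval_rename]
  rfl

theorem separationPoly_ne_zero {δ : Fin r → ℕ} {a : Fin h → MonomialIndex n δ}
    (ha : Function.Injective a) : separationPoly a ≠ 0 := by
  refine mul_ne_zero (Finset.prod_ne_zero_iff.2 fun l _ => Finset.prod_ne_zero_iff.2 fun i _ =>
    X_ne_zero _) fun h0 => ?_
  obtain ⟨x, hx⟩ := exists_det_vec_ne_zero ha
  apply hx
  have := congrArg (eval fun p : Fin h × Coord n => x p.1 p.2) h0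
  rw [map_zero, RingHom.map_det] at this
  rw [← this]
  congr 1
  ext l k
  simp only [RingHom.mapMatrix_apply, Matrix.map_apply, Matrix.of_apply, eval_rename]
  rfl

theorem apply_zero_ne_zero_of_eval_separationPoly_ne_zero {δ : Fin r → ℕ}
    {a : Fin h → MonomialIndex n δ} {x : Fin h → Coord n → ℂ}
    (hx : eval (fun p => x p.1 p.2) (separationPoly a) ≠ 0) (l : Fin h) (i : Fin r) :
    x l ⟨i, 0⟩ ≠ 0 := by
  rw [eval_separationPoly] at hx
  exact Finset.prod_ne_zero_iff.1 (Finset.prod_ne_zero_iff.1 (left_ne_zero_of_mul hx) l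
    (Finset.mem_univ l)) i (Finset.mem_univ i)

/-- Normalizing the points multiplies the rows of the matrix by nonzero scalars. -/
theorem eval_separationPoly_normalize_ne_zero {δ : Fin r → ℕ}
    {a : Fin h → MonomialIndex n δ} {x : Fin h → Coord n → ℂ}
    (hx : eval (fun p => x p.1 p.2) (separationPoly a) ≠ 0) :
    eval (fun p => normalize (fun _ => 0) (x p.1) p.2) (separationPoly a) ≠ 0 := by
  have h0 := apply_zero_ne_zero_of_eval_separationPoly_ne_zero hx
  rw [eval_separationPoly a fun l => normalize (fun _ => 0) (x l)]
  refine mul_ne_zero (Finset.prod_ne_zero_iff.2 fun l _ => Finset.prod_ne_zero_iff.2 fun i _ => ?_)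
    ?_
  · rw [normalize_apply_self (j := fun _ => 0) (h0 l)]
    exact one_ne_zero
  · have h1 := Matrix.det_mul_column (fun l => ∏ i, (x l ⟨i, 0⟩)⁻¹ ^ δ i)
      (Matrix.of fun l k => vec δ (x l) (a k))
    simp only [vec_normalize, Pi.smul_apply, smul_eq_mul]
    simp only [Matrix.of_apply] at h1
    rw [h1]
    rw [eval_separationPoly] at hx
    exact mul_ne_zero (Finset.prod_ne_zero_iff.2 fun l _ =>
      prod_inv_pow_ne_zero (j := fun _ => 0) (h0 l) δ) (right_ne_zero_of_mul hx)

/-- The dual forms have as coefficients the columns of the inverse of the matrix of values of the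
monomials. -/
theorem exists_separatedBy {i₁ : Fin r} {t : ℕ} {a : Fin h → MonomialIndex n (Pi.single i₁ t)}
    {x : Fin h → Coord n → ℂ} (hx : eval (fun p => x p.1 p.2) (separationPoly a) ≠ 0) :
    ∃ g, SeparatedBy i₁ t (fun l => normalize (fun _ => 0) (x l)) g := by
  have h0 := apply_zero_ne_zero_of_eval_separationPoly_ne_zero hx
  have h1 := eval_separationPoly_normalize_ne_zero hx
  rw [eval_separationPoly a fun l => normalize (fun _ => 0) (x l)] at h1
  obtain ⟨M, hM⟩ : ∃ M : Matrix (Fin h) (Fin h) ℂ, M = Matrix.of fun l k =>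
    vec (Pi.single i₁ t) (normalize (fun _ => 0) (x l)) (a k) := ⟨_, rfl⟩
  rw [← hM] at h1
  have hunit : IsUnit M.det := isUnit_iff_ne_zero.2 (right_ne_zero_of_mul h1)
  refine ⟨fun l => ∑ k, C (M⁻¹ k l) * monoPoly (a k), fun l i => normalize_apply_self
    (j := fun _ => 0) (h0 l) i, fun l => IsMultihomogeneous.sum _ _ fun k _ =>
      (isMultihomogeneous_monoPoly _).C_mul _, fun l m => ?_⟩
  have h2 := congrFun (congrFun (Matrix.mul_nonsing_inv M hunit) m) l
  rw [Matrix.mul_apply, Matrix.one_apply] at h2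
  rw [map_sum]
  simp only [eq_comm (a := l)]
  rw [← h2]
  refine Finset.sum_congr rfl fun k _ => ?_
  rw [map_mul, eval_C, mul_comm, hM]
  rfl

/-- Monomials of multidegree concentrated in `i₁` are the monomials of degree `t` in that single
group, since the other factors have exactly one element. -/
theorem exists_injective_monomialIndex_single (i₁ : Fin r) {t : ℕ}
    (hh : h ≤ Fintype.card (Sym (Fin (n i₁ + 1)) t)) :
    ∃ a : Fin h → MonomialIndex n (Pi.single i₁ t), Function.Injective a := by
  have hcard : Fintype.card (MonomialIndex n (Pi.single i₁ t)) =
      Fintype.card (Sym (Fin (n i₁ + 1)) t) := by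
    rw [Fintype.card_pi, Finset.prod_eq_single i₁]
    · rw [Pi.single_eq_same]
    · intro i _ hi
      rw [Sym.card_sym_eq_choose, Pi.single_eq_of_ne hi, Nat.choose_zero_right]
    · simp
  obtain ⟨e⟩ := Function.Embedding.nonempty_of_card_le
    (α := Fin h) (β := MonomialIndex n (Pi.single i₁ t)) (by rw [hcard, Fintype.card_fin]; exact hh)
  exact ⟨e, e.injective⟩

end SecantGeometry

end

noncomputable section

namespace SecantGeometry

open MvPolynomial

/-! ### Tangential contact loci -/

/-- Otherwise `W` and the complement of `q` would be two open sets meeting the irreducible set `T`,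
but with no common point in it. -/
theorem eq_singleton_of_isIrreducible {Y : Type*} [TopologicalSpace Y] [T1Space Y]
    {S T W : Set Y} {q : Y} (hW : IsOpen W) (hqW : q ∈ W) (hS : S ∩ W ⊆ {q})
    (hT : IsIrreducible T) (hTS : T ⊆ S) (hqT : q ∈ T) : T = {q} := by
  refine Set.Subset.antisymm (fun p hp => ?_) (Set.singleton_subset_iff.2 hqT)
  by_contra hpq
  obtain ⟨z, hzT, hzW, hzq⟩ := hT.isPreirreducible W {q}ᶜ hW isClosed_singleton.isOpen_compl
    ⟨q, hqT, hqW⟩ ⟨p, hp, hpq⟩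
  exact hzq (hS ⟨hTS hzT, hzW⟩)

variable {r : ℕ} {n d : Fin r → ℕ} {h : ℕ}

/-- If every `q l` is isolated in the tangency locus, the components through these points are the
points themselves, and a finite set is closed. -/
theorem contactLocus_eq_range {σ : Type} [Fintype σ] {Y : Set (ℙ ℂ (σ → ℂ))}
    {q : Fin h → ℙ ℂ (σ → ℂ)} (hq : ∀ l, q l ∈ Y)
    (H : ∀ l, ∃ W : Set (ℙ ℂ (σ → ℂ)), IsOpen W ∧ q l ∈ W ∧
      tangencyLocus Y (⨆ i, tangentSpace Y (q i)) ∩ W ⊆ {q l}) :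
    contactLocus Y q = Set.range q := by
  have hmem : ∀ l, q l ∈ tangencyLocus Y (⨆ i, tangentSpace Y (q i)) :=
    fun l => ⟨hq l, le_iSup (fun i => tangentSpace Y (q i)) l⟩
  have hU : (⋃₀ {C | C ∈ componentsOf (tangencyLocus Y (⨆ i, tangentSpace Y (q i))) ∧
      ∃ i, q i ∈ C}) = Set.range q := by
    ext p
    constructor
    · rintro ⟨C, ⟨hC, l, hl⟩, hp⟩
      obtain ⟨W, hW, hqW, hSW⟩ := H l
      rw [eq_singleton_of_isIrreducible hW hqW hSW hC.1.1 hC.1.2 hl] at hp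
      exact ⟨l, hp.symm⟩
    · rintro ⟨l, rfl⟩
      obtain ⟨W, hW, hqW, hSW⟩ := H l
      refine ⟨{q l}, ⟨⟨⟨isIrreducible_singleton, Set.singleton_subset_iff.2 (hmem l)⟩,
        fun T hT hle => ?_⟩, l, rfl⟩, rfl⟩
      rw [eq_singleton_of_isIrreducible hW hqW hSW hT.1 hT.2 (hle rfl)]
  rw [contactLocus, hU, (Set.finite_range q).isClosed.closure_eq]
  exact Set.inter_eq_left.2 (Set.range_subset_iff.2 hq)

variable {i₁ : Fin r} {t : ℕ} {x : Fin h → Coord n → ℂ} {g : Fin h → MvPolynomial (Coord n) ℂ}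

namespace SeparatedBy

theorem vec_ne_zero (H : SeparatedBy i₁ t x g) (l : Fin h) : vec d (x l) ≠ 0 :=
  SecantGeometry.vec_ne_zero fun i => ⟨0, by rw [H.apply_zero]; exact one_ne_zero⟩

theorem mk_vec_mem (H : SeparatedBy i₁ t x g) (l : Fin h) (hv : vec d (x l) ≠ 0) :
    Projectivization.mk ℂ (vec d (x l)) hv ∈ segreVeronese n d :=
  SecantGeometry.mk_vec_mem (fun i => ⟨0, by rw [H.apply_zero]; exact one_ne_zero⟩) hv

theorem eq_of_tangentSpace_le (H : SeparatedBy i₁ t x g) (hd : ∀ i, 1 ≤ d i)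
    (ht : 2 * t + 2 ≤ d i₁) (hn : 1 ≤ n i₁) (hv : ∀ l, vec d (x l) ≠ 0) {y : Coord n → ℂ}
    (hy : ∀ i, y ⟨i, 0⟩ = 1) (hvy : vec d y ≠ 0) {l : Fin h} (hl : eval y (g l) ≠ 0)
    (hle : tangentSpace (segreVeronese n d) (Projectivization.mk ℂ (vec d y) hvy) ≤
      ⨆ k, tangentSpace (segreVeronese n d) (Projectivization.mk ℂ (vec d (x k)) (hv k))) :
    y = x l := by
  refine H.eq_of_forall_singular hd ht hn hy hl fun f hf hsing ρ => ?_
  have hker : (⨆ k, tangentSpace (segreVeronese n d)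
      (Projectivization.mk ℂ (vec d (x k)) (hv k))) ≤ LinearMap.ker (pair.flip f) := by
    refine iSup_le fun k => (tangentSpace_le_span_dvec (j := fun _ => 0) i₁ hd (H.apply_zero k)
      (hv k)).trans (Submodule.span_le.2 ?_)
    rintro _ ⟨ρ, rfl⟩
    change pair (dvec d (x k) ρ) f = 0
    rw [pair_dvec _ _ hf]
    exact hsing k ρ
  rw [← pair_dvec y ρ hf]
  exact hker (hle (dvec_mem_tangentSpace y hvy ρ))

/-- The tangential contact locus of a separated configuration consists of its points. -/
theorem contactLocus_eq (H : SeparatedBy i₁ t x g) (hd : ∀ i, 1 ≤ d i)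
    (ht : 2 * t + 2 ≤ d i₁) (hn : 1 ≤ n i₁) (hv : ∀ l, vec d (x l) ≠ 0) :
    contactLocus (segreVeronese n d) (fun l => Projectivization.mk ℂ (vec d (x l)) (hv l)) =
      Set.range fun l => Projectivization.mk ℂ (vec d (x l)) (hv l) := by
  -- On the standard chart the coordinates `coordIdx` of `v(y)` are those of `y` up to a common
  -- factor, so `g_l(y) ≠ 0` becomes an open condition on the projective point. Together with the
  -- chart it gives the neighbourhood isolating `x_l`.
  have hcoord : ∀ (y : Coord n → ℂ), (∀ i, y ⟨i, 0⟩ = 1) → ∀ (hvy : vec d y ≠ 0) (l : Fin h),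
      (∃ c : ℂ, c ≠ 0 ∧ eval (c • (Projectivization.mk ℂ (vec d y) hvy).rep)
        (rename (coordIdx hd fun _ => 0) (g l)) ≠ 0) ↔ eval y (g l) ≠ 0 := by
    intro y hy hvy l
    obtain ⟨b, hb⟩ := Projectivization.exists_smul_eq_mk_rep ℂ _ hvy
    have h1 : ∀ c : ℂ, eval (c • (Projectivization.mk ℂ (vec d y) hvy).rep)
        (rename (coordIdx hd fun _ => 0) (g l)) = (c * b) ^ t * eval y (g l) := by
      intro c
      have h2 : (c • (Projectivization.mk ℂ (vec d y) hvy).rep) ∘ (coordIdx hd fun _ => 0) =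
          fun ρ => (c * b) * y ρ := by
        funext ρ
        rw [← hb, Function.comp_apply, Units.smul_def, smul_smul, Pi.smul_apply,
          vec_coordIdx (j := fun _ => 0) hd hy, smul_eq_mul]
      rw [eval_rename, h2, (H.isMultihomogeneous l).eval_scale fun _ => c * b,
        Finset.prod_pow_eq_pow_sum, Finset.sum_pi_single']
      simp
    constructor
    · rintro ⟨c, -, hc⟩
      rw [h1] at hc
      exact right_ne_zero_of_mul hc
    · intro hg
      refine ⟨1, one_ne_zero, ?_⟩
      rw [h1, one_mul]
      exact mul_ne_zero (pow_ne_zero _ b.ne_zero) hg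
  have hbase : ∀ (y : Coord n → ℂ), (∀ i, y ⟨i, 0⟩ = 1) → ∀ (hvy : vec d y ≠ 0),
      (Projectivization.mk ℂ (vec d y) hvy).rep (baseIdx d fun _ => 0) ≠ 0 := by
    intro y hy hvy
    obtain ⟨b, hb⟩ := Projectivization.exists_smul_eq_mk_rep ℂ _ hvy
    rw [← hb, Units.smul_def, Pi.smul_apply, vec_baseIdx]
    simp [hy]
  refine contactLocus_eq_range (fun l => H.mk_vec_mem l (hv l)) fun l => ⟨_,
    (isOpen_setOf_rep_apply_ne_zero (baseIdx d fun _ => 0)).inter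
      (isOpen_setOf_exists_eval_ne_zero fun _ : Unit => rename (coordIdx hd fun _ => 0) (g l)),
    ⟨hbase _ (H.apply_zero l) (hv l), (), (hcoord _ (H.apply_zero l) (hv l) l).2 (by
      rw [H.eval_self]; exact one_ne_zero)⟩, ?_⟩
  rintro q ⟨⟨hqX, hqT⟩, hq0, -, hqg⟩
  obtain ⟨y, hy, hvy, rfl⟩ := exists_normalized hd hqX hq0
  have := H.eq_of_tangentSpace_le hd ht hn hv hy hvy ((hcoord y hy hvy l).1 hqg) hqT
  subst this
  rfl

theorem topologicalKrullDim_contactLocus (H : SeparatedBy i₁ t x g) (hd : ∀ i, 1 ≤ d i)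
    (ht : 2 * t + 2 ≤ d i₁) (hn : 1 ≤ n i₁) (hh : 1 ≤ h) (hv : ∀ l, vec d (x l) ≠ 0) :
    topologicalKrullDim (contactLocus (segreVeronese n d)
      fun l => Projectivization.mk ℂ (vec d (x l)) (hv l)) = 0 := by
  rw [H.contactLocus_eq hd ht hn hv]
  -- The empty space has dimension `⊥`, so `h ≥ 1` is what makes the dimension equal to `0`.
  have : Nonempty (TopologicalSpace.IrreducibleCloseds
      (Set.range fun l => Projectivization.mk ℂ (vec d (x l)) (hv l))) :=
    ⟨⟨{⟨_, ⟨⟨0, hh⟩, rfl⟩⟩}, isIrreducible_singleton, isClosed_singleton⟩⟩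
  exact le_antisymm (topologicalKrullDim_zero_of_discreteTopology _) Order.krullDim_nonneg

end SeparatedBy

/-! ### General points of Segre-Veronese varieties -/

theorem isOpen_projPow_setOf_eval_ne_zero {σ : Type} (D : MvPolynomial (Fin h × σ) ℂ) :
    IsOpen[projPowZariski σ h] {q | ∃ (w : Fin h → σ → ℂ) (hw : ∀ i, w i ≠ 0),
      q = (fun i => Projectivization.mk ℂ (w i) (hw i)) ∧ eval (fun p => w p.1 p.2) D ≠ 0} := by
  rw [isOpen_projPow_iff]
  rintro v hv ⟨w, hw, hvw, hD⟩
  choose c hc using fun i => (Projectivization.mk_eq_mk_iff ℂ _ _ (hw i) (hv i)).1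
    (congrFun hvw i).symm
  have hcomp : ∀ u : Fin h → σ → ℂ, eval (fun p => u p.1 p.2)
      (bind₁ (fun p : Fin h × σ => C (c p.1 : ℂ) * X p) D) =
        eval (fun p => (c p.1 • u p.1) p.2) D := by
    intro u
    rw [← aeval_apply_eq_eval, aeval_bind₁, ← aeval_apply_eq_eval]
    congr 2
    funext p
    simp [Units.smul_def]
  refine ⟨bind₁ (fun p : Fin h × σ => C (c p.1 : ℂ) * X p) D, ?_, fun u hu hne => ?_⟩
  · rw [hcomp]
    simp only [hc]
    exact hD
  · rw [hcomp] at hne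
    refine ⟨fun i => c i • u i, fun i => (smul_ne_zero_iff_ne _).2 (hu i), ?_, hne⟩
    funext i
    exact ((Projectivization.mk_eq_mk_iff ℂ _ _ _ _).2 ⟨c i, rfl⟩).symm

theorem mk_vec_normalize_comp {j : ∀ i, Fin (n i + 1)} (hv : ∀ l, vec d (x l) ≠ 0)
    (hv' : ∀ l, vec d (normalize j (x l)) ≠ 0) :
    (fun l => Projectivization.mk ℂ (vec d (normalize j (x l))) (hv' l)) =
      fun l => Projectivization.mk ℂ (vec d (x l)) (hv l) := by
  funext l
  exact mk_vec_normalize (hv l) (hv' l)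

theorem topologicalKrullDim_contactLocus_of_eval_separationPoly_ne_zero (hd : ∀ i, 1 ≤ d i)
    (ht : 2 * t + 2 ≤ d i₁) (hn : 1 ≤ n i₁) (hh : 1 ≤ h)
    {a : Fin h → MonomialIndex n (Pi.single i₁ t)}
    (hx : eval (fun p => x p.1 p.2) (separationPoly a) ≠ 0) (hv : ∀ l, vec d (x l) ≠ 0) :
    topologicalKrullDim (contactLocus (segreVeronese n d)
      fun l => Projectivization.mk ℂ (vec d (x l)) (hv l)) = 0 := by
  obtain ⟨g, H⟩ := exists_separatedBy hx
  have hv' : ∀ l, vec d (normalize (fun _ => 0) (x l)) ≠ 0 := H.vec_ne_zero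
  have hdim := H.topologicalKrullDim_contactLocus hd ht hn hh hv'
  rwa [mk_vec_normalize_comp hv hv'] at hdim

theorem exists_eval_uncurry_ne_zero {ι κ : Type*} {f : MvPolynomial (ι × κ) ℂ} (hf : f ≠ 0) :
    ∃ x : ι → κ → ℂ, eval (fun p => x p.1 p.2) f ≠ 0 := by
  obtain ⟨s, hs⟩ := exists_eval_ne_zero hf
  exact ⟨fun i k => s (i, k), hs⟩

theorem forGeneralPoints_topologicalKrullDim_contactLocus (hd : ∀ i, 1 ≤ d i)
    (ht : 2 * t + 2 ≤ d i₁) (hn : 1 ≤ n i₁) (hh : 1 ≤ h)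
    {a : Fin h → MonomialIndex n (Pi.single i₁ t)} (ha : Function.Injective a) :
    ForGeneralPoints (segreVeronese n d) h fun q =>
      topologicalKrullDim (contactLocus (segreVeronese n d) q) = 0 := by
  let j : ∀ i, Fin (n i + 1) := fun _ => 0
  -- The separation condition is transported to the ambient projective space: the base coordinates
  -- select the chart, and the coordinates `coordIdx` recover the parameters up to scaling.
  let D : MvPolynomial (Fin h × MonomialIndex n d) ℂ :=
    (∏ l, X (l, baseIdx d j)) * rename (fun p => (p.1, coordIdx hd j p.2)) (separationPoly a)
  have hD : ∀ w : Fin h → MonomialIndex n d → ℂ, eval (fun p => w p.1 p.2) D =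
      (∏ l, w l (baseIdx d j)) *
        eval (fun p => w p.1 (coordIdx hd j p.2)) (separationPoly a) := by
    intro w
    simp only [D, map_mul, map_prod, eval_X, eval_rename]
    rfl
  refine ⟨_, isOpen_projPow_setOf_eval_ne_zero D, ?_, ?_⟩
  · obtain ⟨z, hz⟩ := exists_eval_uncurry_ne_zero (separationPoly_ne_zero ha)
    obtain ⟨g, H⟩ := exists_separatedBy hz
    have hx := eval_separationPoly_normalize_ne_zero hz
    obtain ⟨x, hxz⟩ : ∃ x, x = fun l => normalize (fun _ => 0) (z l) := ⟨_, rfl⟩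
    rw [← hxz] at H
    simp only [← congrFun hxz] at hx
    have hv : ∀ l, vec d (x l) ≠ 0 := H.vec_ne_zero
    refine ⟨fun l => Projectivization.mk ℂ (vec d (x l)) (hv l),
      ⟨fun l => vec d (x l), hv, rfl, ?_⟩, fun l => H.mk_vec_mem l (hv l)⟩
    rw [hD fun l => vec d (x l)]
    refine mul_ne_zero (Finset.prod_ne_zero_iff.2 fun l _ => ?_) ?_
    · rw [vec_baseIdx]
      simp only [j, H.apply_zero l, one_pow, Finset.prod_const_one]
      exact one_ne_zero
    · simp only [vec_coordIdx (j := j) hd (H.apply_zero _)]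
      exact hx
  · rintro _ ⟨w, hw, rfl, hDw⟩ hX
    rw [hD] at hDw
    have hbase : ∀ l, w l (baseIdx d j) ≠ 0 := fun l =>
      Finset.prod_ne_zero_iff.1 (left_ne_zero_of_mul hDw) l (Finset.mem_univ l)
    have hrep : ∀ l, (Projectivization.mk ℂ (w l) (hw l)).rep (baseIdx d j) ≠ 0 := by
      intro l
      obtain ⟨b, hb⟩ := Projectivization.exists_smul_eq_mk_rep ℂ _ (hw l)
      rw [← hb, Units.smul_def, Pi.smul_apply]
      exact smul_ne_zero b.ne_zero (hbase l)
    choose x hx hv hq using fun l => exists_normalized hd (hX l) (hrep l)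
    choose c hc using fun l => (Projectivization.mk_eq_mk_iff ℂ _ _ (hw l) (hv l)).1 (hq l)
    have hcoord : ∀ l ρ, w l (coordIdx hd j ρ) = c l * x l ρ := by
      intro l ρ
      rw [← hc l, Units.smul_def, Pi.smul_apply, vec_coordIdx hd (hx l), smul_eq_mul]
    simp only [hcoord] at hDw
    have h1 := eval_separationPoly_normalize_ne_zero (a := a) (x := fun l ρ => c l * x l ρ)
      (right_ne_zero_of_mul hDw)
    have h2 : ∀ l, normalize (fun _ => 0) (fun ρ : Coord n => (c l : ℂ) * x l ρ) = x l := by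
      intro l
      funext ρ
      have := hx l ρ.1
      simp only [j] at this
      rw [normalize, this, mul_one, inv_mul_cancel_left₀ (c l).ne_zero]
    simp only [h2] at h1
    rw [funext hq]
    exact topologicalKrullDim_contactLocus_of_eval_separationPoly_ne_zero hd ht hn hh h1 hv

/-- An open set where the contact locus is positive-dimensional would meet the locus of separated
configurations: pulled back to the parameters, both contain principal open sets of nonzero
polynomials. -/
theorem not_isTangentiallyWeaklyDefective (hd : ∀ i, 1 ≤ d i)
    (ht : 2 * t + 2 ≤ d i₁) (hn : 1 ≤ n i₁) (hh : 1 ≤ h)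
    {a : Fin h → MonomialIndex n (Pi.single i₁ t)} (ha : Function.Injective a) :
    ¬ IsTangentiallyWeaklyDefective (segreVeronese n d) h := by
  rintro ⟨U, hU, ⟨q, hqU, hqX⟩, hpos⟩
  choose y hy hvy hqy using fun l => exists_eq_mk_vec (hqX l)
  obtain rfl : q = fun l => Projectivization.mk ℂ (vec d (y l)) (hvy l) := funext hqy
  obtain ⟨f, hf, hfU⟩ := isOpen_projPow_iff.1 hU _ hvy hqU
  let F : MvPolynomial (Fin h × Coord n) ℂ :=
    aeval (fun p : Fin h × MonomialIndex n d => rename (Prod.mk p.1) (monoPoly p.2)) f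
  have hF : ∀ z : Fin h → Coord n → ℂ, eval (fun p => z p.1 p.2) F =
      eval (fun p => vec d (z p.1) p.2) f := by
    intro z
    simp only [F, eval_aeval, eval_rename]
    rfl
  have hF0 : F ≠ 0 := fun h0 => hf (by rw [← hF, h0, map_zero])
  obtain ⟨z, hz⟩ := exists_eval_uncurry_ne_zero (mul_ne_zero hF0 (separationPoly_ne_zero ha))
  rw [map_mul, hF] at hz
  have hzs := right_ne_zero_of_mul hz
  have hz0 := apply_zero_ne_zero_of_eval_separationPoly_ne_zero hzs
  have hv : ∀ l, vec d (z l) ≠ 0 := fun l => vec_ne_zero fun i => ⟨0, hz0 l i⟩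
  have hzU := hfU (fun l => vec d (z l)) hv (left_ne_zero_of_mul hz)
  have h1 := hpos _ hzU fun l => mk_vec_mem (fun i => ⟨0, hz0 l i⟩) (hv l)
  exact h1.ne' (topologicalKrullDim_contactLocus_of_eval_separationPoly_ne_zero hd ht hn hh hzs hv)

end SecantGeometry

end

noncomputable section

namespace SecantGeometry

open MvPolynomial

/-! ### Identifiability -/

variable {r : ℕ} {n d : Fin r → ℕ} {h : ℕ}
  {i₁ : Fin r} {t : ℕ} {x : Fin h → Coord n → ℂ} {g : Fin h → MvPolynomial (Coord n) ℂ}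

namespace SeparatedBy

theorem sum_smul_vec_ne_zero (H : SeparatedBy i₁ t x g) (hd : ∀ i, 1 ≤ d i)
    (ht : 2 * t + 2 ≤ d i₁) {c : Fin h → ℂ} {l : Fin h} (hc : c l ≠ 0) :
    ∑ l, c l • vec d (x l) ≠ 0 := fun h0 =>
  hc (Fintype.linearIndependent_iff.1 (H.linearIndependent_vec hd ht) c h0 l)

theorem injective_mk_vec (H : SeparatedBy i₁ t x g) (hd : ∀ i, 1 ≤ d i)
    (ht : 2 * t + 2 ≤ d i₁) (hv : ∀ l, vec d (x l) ≠ 0) :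
    Function.Injective fun l => Projectivization.mk ℂ (vec d (x l)) (hv l) := by
  intro l k hlk
  obtain ⟨b, hb⟩ := (Projectivization.mk_eq_mk_iff' ℂ _ _ (hv l) (hv k)).1 hlk
  exact (H.linearIndependent_vec hd ht).eq_of_smul_apply_eq_smul_apply 1 b l k one_ne_zero
    (by rw [one_smul, hb])

theorem inSpanOfPoints (H : SeparatedBy i₁ t x g) (hd : ∀ i, 1 ≤ d i)
    (ht : 2 * t + 2 ≤ d i₁) (c : Fin h → ℂ) (hv : ∑ l, c l • vec d (x l) ≠ 0) :
    InSpanOfPoints (segreVeronese n d) (Projectivization.mk ℂ _ hv) h := by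
  classical
  have hv' : ∀ l, vec d (x l) ≠ 0 := H.vec_ne_zero
  refine ⟨Finset.univ.image fun l => Projectivization.mk ℂ (vec d (x l)) (hv' l), ?_, ?_, ?_⟩
  · rw [Finset.card_image_of_injective _ (H.injective_mk_vec hd ht hv'), Finset.card_univ,
      Fintype.card_fin]
  · intro q hq
    obtain ⟨l, -, rfl⟩ := Finset.mem_image.1 hq
    exact H.mk_vec_mem l (hv' l)
  · rw [Projectivization.submodule_mk, Submodule.span_singleton_le_iff_mem]
    refine Submodule.sum_mem _ fun l _ => Submodule.smul_mem _ _ ?_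
    refine Submodule.mem_iSup_of_mem (Projectivization.mk ℂ (vec d (x l)) (hv' l))
      (Submodule.mem_iSup_of_mem (Finset.mem_image_of_mem _ (Finset.mem_univ l)) ?_)
    rw [submodule_mk_vec]
    exact Submodule.mem_span_singleton_self _

theorem hasRank (H : SeparatedBy i₁ t x g) (hd : ∀ i, 1 ≤ d i)
    (ht : 2 * t + 2 ≤ d i₁) {c : Fin h → ℂ} (hc : ∀ l, c l ≠ 0)
    (hv : ∑ l, c l • vec d (x l) ≠ 0) :
    HasRank (segreVeronese n d) (Projectivization.mk ℂ _ hv) h := by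
  refine ⟨H.inSpanOfPoints hd ht c hv, ?_⟩
  rintro k hk ⟨y, rfl, hyX, hle⟩
  obtain ⟨z, hz⟩ := exists_iSup_submodule_eq_span (q := fun l => (y.equivFin.symm l).1)
    fun l => hyX _ (y.equivFin.symm l).2
  refine H.not_mem_span_of_lt ht hc hk z ?_
  rw [← hz]
  have h1 : (⨆ q ∈ y, q.submodule) ≤ ⨆ l, (y.equivFin.symm l).1.submodule := by
    refine iSup₂_le fun q hq => ?_
    have := le_iSup (fun l => (y.equivFin.symm l).1.submodule) (y.equivFin ⟨q, hq⟩)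
    simpa using this
  rw [Projectivization.submodule_mk, Submodule.span_singleton_le_iff_mem] at hle
  exact h1 hle

theorem isIdentifiableAt (H : SeparatedBy i₁ t x g) (hd : ∀ i, 1 ≤ d i)
    (ht : 2 * t + 2 ≤ d i₁) {c : Fin h → ℂ} (hc : ∀ l, c l ≠ 0)
    (hv : ∑ l, c l • vec d (x l) ≠ 0) :
    IsIdentifiableAt (segreVeronese n d) h (Projectivization.mk ℂ _ hv) := by
  refine ⟨H.hasRank hd ht hc hv, ?_⟩
  have hL : ∀ z ∈ abstractSecant (segreVeronese n d) h, z.1 = Projectivization.mk ℂ _ hv →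
      z.2.1 = Submodule.span ℂ (Set.range fun l => vec d (x l)) := by
    rintro ⟨p, L⟩ ⟨hpL, hL⟩ rfl
    rw [Projectivization.submodule_mk, Submodule.span_singleton_le_iff_mem] at hpL
    exact H.eq_span_of_mem_secantPlanes hd ht hL hc hpL
  obtain ⟨z, hz, hzp⟩ := mk_mem_secantVariety
    (fun l i => ⟨0, by rw [H.apply_zero]; exact one_ne_zero⟩) (H.linearIndependent_vec hd ht) hv
    (Submodule.sum_mem _ fun l _ => Submodule.smul_mem _ _ (Submodule.subset_span ⟨l, rfl⟩))
  exact ⟨z, ⟨hz, hzp⟩, fun z' hz' => Prod.ext (hz'.2.trans hzp.symm)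
    (Subtype.ext ((hL z' hz'.1 hz'.2).trans (hL z hz hzp).symm))⟩

end SeparatedBy

theorem exists_sum_smul_vec_normalize {j : ∀ i, Fin (n i + 1)} (hx : ∀ l i, x l ⟨i, j i⟩ ≠ 0)
    {c : Fin h → ℂ} (hc : ∀ l, c l ≠ 0) : ∃ c' : Fin h → ℂ, (∀ l, c' l ≠ 0) ∧
      ∑ l, c l • vec d (x l) = ∑ l, c' l • vec d (normalize j (x l)) := by
  refine ⟨fun l => c l * (∏ i, (x l ⟨i, j i⟩)⁻¹ ^ d i)⁻¹,
    fun l => mul_ne_zero (hc l) (inv_ne_zero (prod_inv_pow_ne_zero (hx l) d)),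
    Finset.sum_congr rfl fun l _ => ?_⟩
  rw [vec_normalize, smul_smul, inv_mul_cancel_right₀ (prod_inv_pow_ne_zero (hx l) d)]

/-- The coordinates of `c₁ v(x₁) + ⋯ + c_h v(x_h)` as polynomials in `c` and `x`. -/
def secantParam (h : ℕ) (J : MonomialIndex n d) : MvPolynomial (Fin h ⊕ Fin h × Coord n) ℂ :=
  ∑ l, X (Sum.inl l) * rename (fun ρ => Sum.inr (l, ρ)) (monoPoly J)

theorem eval_secantParam (c : Fin h → ℂ) (x : Fin h → Coord n → ℂ) (J : MonomialIndex n d) :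
    eval (Sum.elim c fun p => x p.1 p.2) (secantParam h J) = (∑ l, c l • vec d (x l)) J := by
  rw [secantParam, map_sum, Finset.sum_apply]
  refine Finset.sum_congr rfl fun l _ => ?_
  rw [map_mul, eval_X, eval_rename, Sum.elim_inl, Pi.smul_apply, smul_eq_mul]
  rfl

theorem exists_eq_sum_elim {ι κ : Type*} (s : ι ⊕ ι × κ → ℂ) :
    ∃ (c : ι → ℂ) (x : ι → κ → ℂ), s = Sum.elim c fun p => x p.1 p.2 :=
  ⟨fun i => s (Sum.inl i), fun i k => s (Sum.inr (i, k)), by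
    funext z
    rcases z with z | z <;> rfl⟩

theorem isIdentifiable_segreVeronese (hd : ∀ i, 1 ≤ d i) (ht : 2 * t + 2 ≤ d i₁) (hh : 1 ≤ h)
    {a : Fin h → MonomialIndex n (Pi.single i₁ t)} (ha : Function.Injective a) :
    IsIdentifiable (segreVeronese n d) h := by
  obtain ⟨G, hG⟩ : ∃ G : MvPolynomial (Fin h ⊕ Fin h × Coord n) ℂ,
      G = (∏ l, X (Sum.inl l)) * rename Sum.inr (separationPoly a) := ⟨_, rfl⟩
  have hG0 : G ≠ 0 := by
    rw [hG]
    exact mul_ne_zero (Finset.prod_ne_zero_iff.2 fun l _ => X_ne_zero _)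
      ((map_ne_zero_iff _ (rename_injective _ Sum.inr_injective)).2 (separationPoly_ne_zero ha))
  have hGe : ∀ (c : Fin h → ℂ) (x : Fin h → Coord n → ℂ),
      eval (Sum.elim c fun p => x p.1 p.2) G ≠ 0 →
        (∀ l, c l ≠ 0) ∧ eval (fun p => x p.1 p.2) (separationPoly a) ≠ 0 := by
    intro c x hne
    rw [hG, map_mul, map_prod, eval_rename] at hne
    simp only [eval_X, Sum.elim_inl] at hne
    exact ⟨fun l => Finset.prod_ne_zero_iff.1 (left_ne_zero_of_mul hne) l (Finset.mem_univ l),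
      right_ne_zero_of_mul hne⟩
  have hsep : ∀ (c : Fin h → ℂ) (x : Fin h → Coord n → ℂ),
      eval (Sum.elim c fun p => x p.1 p.2) G ≠ 0 →
        ∃ (c' : Fin h → ℂ) (x' : Fin h → Coord n → ℂ) (g : Fin h → MvPolynomial (Coord n) ℂ),
          (∀ l, c' l ≠ 0) ∧ SeparatedBy i₁ t x' g ∧
            ∑ l, c l • vec d (x l) = ∑ l, c' l • vec d (x' l) := by
    intro c x hne
    obtain ⟨hc, hx⟩ := hGe c x hne
    obtain ⟨g, H⟩ := exists_separatedBy hx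
    obtain ⟨c', hc', hsum⟩ := exists_sum_smul_vec_normalize (d := d) (j := fun _ => 0)
      (apply_zero_ne_zero_of_eval_separationPoly_ne_zero hx) hc
    exact ⟨c', _, g, hc', H, hsum⟩
  -- On the open set `u ≠ 0`, every point satisfying the equations of the parametrized secants, in
  -- particular every point on a limit of secant planes, is a combination with nonzero coefficients
  -- of separated points.
  obtain ⟨u, hu, himage⟩ := exists_open_subset_image
    (fun J : MonomialIndex n d => secantParam h J) hG0
  refine ⟨_, isOpen_setOf_exists_eval_ne_zero fun _ : Unit => u, ?_, ?_⟩
  · obtain ⟨s, hs⟩ := exists_eval_ne_zero (mul_ne_zero hu hG0)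
    obtain ⟨c, x, rfl⟩ := exists_eq_sum_elim s
    rw [map_mul, eval_aeval] at hs
    simp only [eval_secantParam] at hs
    obtain ⟨c', x', g, hc', H, hsum⟩ := hsep c x (right_ne_zero_of_mul hs)
    have hus := left_ne_zero_of_mul hs
    rw [hsum] at hus
    have hv := H.sum_smul_vec_ne_zero hd ht (c := c') (hc' ⟨0, hh⟩)
    obtain ⟨b, hb⟩ := Projectivization.exists_smul_eq_mk_rep ℂ _ hv
    refine ⟨Projectivization.mk ℂ _ hv, ⟨(), (b⁻¹ : ℂˣ), Units.ne_zero _, ?_⟩, mk_mem_secantVariety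
      (fun l i => ⟨0, by rw [H.apply_zero]; exact one_ne_zero⟩)
      (H.linearIndependent_vec hd ht) hv
      (Submodule.sum_mem _ fun l _ => Submodule.smul_mem _ _ (Submodule.subset_span ⟨l, rfl⟩))⟩
    -- The polynomial `u` need not be homogeneous, so the scalar is chosen to return from `rep` to
    -- the constructed vector.
    rw [← hb, ← Units.smul_def, inv_smul_smul]
    exact hus
  · rintro p ⟨⟨-, b, hb, hbu⟩, ⟨⟨p', L⟩, ⟨hpL, hL⟩, rfl⟩⟩
    simp only at hpL hbu ⊢
    have hrep : b • p'.rep ∈ L.1 := Submodule.smul_mem _ _ (hpL (by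
      rw [Projectivization.submodule_eq]
      exact Submodule.mem_span_singleton_self _))
    obtain ⟨s, hsG, hs⟩ := himage (b • p'.rep) (fun P hP =>
      eval_eq_zero_of_mem_secantPlanes hL (fun c y => by
        have := congrArg (eval (Sum.elim c fun p => y p.1 p.2)) hP
        rw [map_zero, eval_aeval] at this
        simp only [eval_secantParam] at this
        exact this) hrep) hbu
    obtain ⟨c, x, rfl⟩ := exists_eq_sum_elim s
    simp only [eval_secantParam] at hs
    obtain ⟨c', x', g, hc', H, hsum⟩ := hsep c x hsG
    have hv := H.sum_smul_vec_ne_zero hd ht (c := c') (hc' ⟨0, hh⟩)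
    have hp : Projectivization.mk ℂ _ hv = p' := by
      rw [← p'.mk_rep, Projectivization.mk_eq_mk_iff']
      exact ⟨b, by rw [← hsum]; exact (funext hs).symm⟩
    rw [← hp]
    exact H.isIdentifiableAt hd ht hc' hv

end SecantGeometry

end

noncomputable section

namespace SecantGeometry

open MvPolynomial

/-! ### Dimensions of secant varieties -/

theorem card_le_topologicalKrullDim_of_linearIndependent {σ τ : Type} [Fintype σ] [Fintype τ]
    (S : Set (ℙ ℂ (σ → ℂ))) (ψ : σ → MvPolynomial τ ℂ) (t₀ : τ → ℂ) (g : MvPolynomial τ ℂ)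
    (hg : eval t₀ g ≠ 0)
    (hS : ∀ t, eval t g ≠ 0 →
      ∃ hv : (fun s => eval t (ψ s)) ≠ 0, Projectivization.mk ℂ _ hv ∈ S)
    (hind : ∀ (α : ℂ) (β : τ → ℂ), ((α • fun s => eval t₀ (ψ s)) +
      ∑ b, β b • fun s => eval t₀ (pderiv b (ψ s))) = 0 → α = 0 ∧ β = 0) :
    (Fintype.card τ : WithBot ℕ∞) ≤ topologicalKrullDim S := by
  let e := Fintype.equivFin τ
  have heval : ∀ (s : Fin (Fintype.card τ) → ℂ) (P : MvPolynomial τ ℂ),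
      eval s (rename e P) = eval (s ∘ e) P := fun s P => eval_rename _ _ _
  refine le_topologicalKrullDim_of_linearIndependent S (fun s => rename e (ψ s))
    (t₀ ∘ e.symm) (rename e g) ?_ ?_ ?_
  · rw [heval, Function.comp_assoc, e.symm_comp_self, Function.comp_id]
    exact hg
  · intro s hs
    simp only [heval] at hs ⊢
    exact hS _ hs
  · rw [Fintype.linearIndependent_iff]
    intro c hc
    rw [Fin.sum_univ_succ] at hc
    simp only [Fin.cons_zero, Fin.cons_succ] at hc
    have h1 := hind (c 0) (fun b => c (e b).succ) (by
      rw [← hc]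
      congr 1
      · simp only [heval, Function.comp_assoc, e.symm_comp_self, Function.comp_id]
      · refine Fintype.sum_equiv e _ _ fun b => ?_
        congr 1
        funext s
        rw [pderiv_rename e.injective, heval, Function.comp_assoc, e.symm_comp_self,
          Function.comp_id])
    refine Fin.cases h1.1 fun b => ?_
    have := congrFun h1.2 (e.symm b)
    simpa using this

variable {r : ℕ} {n d : Fin r → ℕ}

/-- The parameters of `v(x₀) + c₁ v(x₁) + ⋯ + c_m v(x_m)` with normalized points `x_l`. -/
abbrev SecantCoord (n : Fin r → ℕ) (m : ℕ) : Type := Fin m ⊕ Fin (m + 1) × Σ i, Fin (n i)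

/-- Fixing the first coefficient to `1` removes the projective scaling, so the number of parameters
is the expected dimension `h ∑ nᵢ + h - 1` for `h = m + 1`. -/
theorem card_secantCoord (n : Fin r → ℕ) (m : ℕ) :
    Fintype.card (SecantCoord n m) = m + (m + 1) * ∑ i, n i := by
  simp [Fintype.card_sum, Fintype.card_prod, Fintype.card_sigma]

/-- The homogeneous coordinates of the normalized point `x_l`. -/
def affinePoint (m : ℕ) (l : Fin (m + 1)) (ρ : Coord n) : MvPolynomial (SecantCoord n m) ℂ :=
  Fin.cases 1 (fun b => X (Sum.inr (l, ⟨ρ.1, b⟩))) ρ.2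

/-- The coefficients `1, c₁, …, c_m`. -/
def affineCoeff (n : Fin r → ℕ) (m : ℕ) (l : Fin (m + 1)) : MvPolynomial (SecantCoord n m) ℂ :=
  Fin.cases 1 (fun k => X (Sum.inl k)) l

/-- The coordinates of `v(x₀) + c₁ v(x₁) + ⋯ + c_m v(x_m)`. -/
def affineSecantParam (m : ℕ) (J : MonomialIndex n d) : MvPolynomial (SecantCoord n m) ℂ :=
  ∑ l, affineCoeff n m l * aeval (affinePoint m l) (monoPoly J)

variable {m : ℕ}

theorem eval_affineSecantParam (s : SecantCoord n m → ℂ) (J : MonomialIndex n d) :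
    eval s (affineSecantParam m J) = (∑ l, eval s (affineCoeff n m l) •
      vec d fun ρ => eval s (affinePoint m l ρ)) J := by
  rw [affineSecantParam, map_sum, Finset.sum_apply]
  refine Finset.sum_congr rfl fun l _ => ?_
  rw [map_mul, eval_aeval]
  rfl

theorem pderiv_inl_affinePoint (k : Fin m) (l : Fin (m + 1)) (ρ : Coord n) :
    pderiv (Sum.inl k) (affinePoint m l ρ) = 0 := by
  obtain ⟨i, b⟩ := ρ
  refine Fin.cases ?_ (fun b => ?_) b
  · simp [affinePoint]
  · simp [affinePoint]

theorem pderiv_inr_affinePoint (l k : Fin (m + 1)) (ρ : Σ i, Fin (n i)) (ρ' : Coord n) :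
    pderiv (Sum.inr (k, ρ)) (affinePoint m l ρ') =
      if l = k ∧ ρ' = ⟨ρ.1, ρ.2.succ⟩ then 1 else 0 := by
  obtain ⟨i, b⟩ := ρ'
  obtain ⟨i', b'⟩ := ρ
  refine Fin.cases ?_ (fun b => ?_) b
  · have : ¬ (⟨i, 0⟩ : Coord n) = ⟨i', b'.succ⟩ := by
      intro h
      obtain ⟨rfl, h⟩ := Sigma.mk.inj_iff.1 h
      exact Fin.succ_ne_zero _ (eq_of_heq h).symm
    simp [affinePoint, this]
  · have hiff : (⟨i, b.succ⟩ : Coord n) = ⟨i', b'.succ⟩ ↔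
        (⟨i, b⟩ : Σ i, Fin (n i)) = ⟨i', b'⟩ := by
      rw [Sigma.mk.inj_iff, Sigma.mk.inj_iff]
      refine and_congr_right fun hii => ?_
      subst hii
      simp
    have hX : affinePoint m l (⟨i, b.succ⟩ : Coord n) = X (Sum.inr (l, ⟨i, b⟩)) := rfl
    rw [hX, pderiv_X, Pi.single_apply]
    refine if_congr ?_ rfl rfl
    rw [hiff, Sum.inr.injEq, Prod.mk.injEq]

theorem pderiv_inr_affineCoeff (l k : Fin (m + 1)) (ρ : Σ i, Fin (n i)) :
    pderiv (Sum.inr (k, ρ)) (affineCoeff n m l) = 0 := by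
  refine Fin.cases ?_ (fun l => ?_) l
  · simp [affineCoeff]
  · simp [affineCoeff]

theorem pderiv_inl_affineCoeff (l : Fin (m + 1)) (k : Fin m) :
    pderiv (Sum.inl k) (affineCoeff n m l) = if l = k.succ then 1 else 0 := by
  refine Fin.cases ?_ (fun l => ?_) l
  · simp [affineCoeff, (Fin.succ_ne_zero k).symm]
  · simp [affineCoeff, pderiv_X, Pi.single_apply]

theorem eval_pderiv_inl_affineSecantParam (s : SecantCoord n m → ℂ) (k : Fin m)
    (J : MonomialIndex n d) : eval s (pderiv (Sum.inl k) (affineSecantParam m J)) =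
      vec d (fun ρ => eval s (affinePoint m k.succ ρ)) J := by
  rw [affineSecantParam, map_sum, map_sum, Finset.sum_eq_single k.succ]
  · rw [pderiv_mul, pderiv_aeval]
    simp only [pderiv_inl_affinePoint, pderiv_inl_affineCoeff, mul_zero, Finset.sum_const_zero,
      add_zero, if_true, one_mul, eval_aeval]
    rfl
  · intro l _ hl
    rw [pderiv_mul, pderiv_aeval]
    simp [pderiv_inl_affinePoint, pderiv_inl_affineCoeff, hl]
  · simp

theorem eval_pderiv_inr_affineSecantParam (s : SecantCoord n m → ℂ) (k : Fin (m + 1))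
    (ρ : Σ i, Fin (n i)) (J : MonomialIndex n d) :
    eval s (pderiv (Sum.inr (k, ρ)) (affineSecantParam m J)) = eval s (affineCoeff n m k) *
      dvec d (fun ρ => eval s (affinePoint m k ρ)) ⟨ρ.1, ρ.2.succ⟩ J := by
  rw [affineSecantParam, map_sum, map_sum, Finset.sum_eq_single k]
  · rw [pderiv_mul, pderiv_aeval, pderiv_inr_affineCoeff, zero_mul, zero_add, map_mul,
      Finset.sum_eq_single (⟨ρ.1, ρ.2.succ⟩ : Coord n)]
    · rw [pderiv_inr_affinePoint, if_pos ⟨rfl, rfl⟩, mul_one, eval_aeval]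
      rfl
    · intro ρ' _ hρ'
      rw [pderiv_inr_affinePoint, if_neg fun h => hρ' h.2, mul_zero]
    · simp
  · intro l _ hl
    rw [pderiv_mul, pderiv_aeval, pderiv_inr_affineCoeff, zero_mul, zero_add,
      Finset.sum_eq_zero, mul_zero, map_zero]
    intro ρ' _
    rw [pderiv_inr_affinePoint, if_neg fun h => hl h.1, mul_zero]
  · simp

theorem normalize_eq_self {j : ∀ i, Fin (n i + 1)} {x : Coord n → ℂ}
    (hx : ∀ i, x ⟨i, j i⟩ = 1) : normalize j x = x := by
  funext ρ
  rw [normalize, hx, inv_one, one_mul]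

theorem eval_affinePoint_zero (s : SecantCoord n m → ℂ) (l : Fin (m + 1)) (i : Fin r) :
    eval s (affinePoint m l (⟨i, 0⟩ : Coord n)) = 1 := by
  simp [affinePoint]

variable {i₁ : Fin r} {t : ℕ}

theorem exists_mk_affineSecantParam_mem (hd : ∀ i, 1 ≤ d i) (ht : 2 * t + 2 ≤ d i₁)
    {a : Fin (m + 1) → MonomialIndex n (Pi.single i₁ t)} {s : SecantCoord n m → ℂ}
    (hs : eval (fun p => (fun l ρ => eval s (affinePoint m l ρ)) p.1 p.2)
      (separationPoly a) ≠ 0) :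
    ∃ hv : (fun J : MonomialIndex n d => eval s (affineSecantParam m J)) ≠ 0,
      Projectivization.mk ℂ _ hv ∈ secantVariety (segreVeronese n d) (m + 1) := by
  obtain ⟨g, H⟩ := exists_separatedBy (x := fun l ρ => eval s (affinePoint m l ρ)) hs
  have hnorm : (fun l => normalize (fun _ => 0) fun ρ : Coord n =>
      eval s (affinePoint m l ρ)) = fun l ρ => eval s (affinePoint m l ρ) := by
    funext l
    exact normalize_eq_self (j := fun _ => 0) (eval_affinePoint_zero s l)
  rw [hnorm] at H
  have hsum : (fun J : MonomialIndex n d => eval s (affineSecantParam m J)) =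
      ∑ l, eval s (affineCoeff n m l) • vec d fun ρ => eval s (affinePoint m l ρ) := by
    funext J
    exact eval_affineSecantParam s J
  rw [hsum]
  have hv := H.sum_smul_vec_ne_zero hd ht (c := fun l => eval s (affineCoeff n m l)) (l := 0)
    (by simp [affineCoeff])
  exact ⟨hv, mk_mem_secantVariety
    (fun l i => ⟨0, by rw [H.apply_zero]; exact one_ne_zero⟩)
    (H.linearIndependent_vec hd ht) hv
    (Submodule.sum_mem _ fun l _ => Submodule.smul_mem _ _ (Submodule.subset_span ⟨l, rfl⟩))⟩

/-- Terracini's argument: at a separated configuration with all coefficients `1`, the value and the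
partial derivatives of the parametrization are combinations of the `v(x_l)` and of the affine
tangent vectors, and these are independent by `eq_zero_of_sum_eq_zero`. -/
theorem le_topologicalKrullDim_secantVariety (hd : ∀ i, 1 ≤ d i) (ht : 2 * t + 2 ≤ d i₁)
    {a : Fin (m + 1) → MonomialIndex n (Pi.single i₁ t)} (ha : Function.Injective a) :
    ((m + (m + 1) * ∑ i, n i : ℕ) : WithBot ℕ∞) ≤
      topologicalKrullDim (secantVariety (segreVeronese n d) (m + 1)) := by
  obtain ⟨z, hz⟩ := exists_eval_uncurry_ne_zero (separationPoly_ne_zero ha)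
  have hx := eval_separationPoly_normalize_ne_zero hz
  obtain ⟨g, H⟩ := exists_separatedBy hz
  obtain ⟨x, hxz⟩ : ∃ x, x = fun l => normalize (fun _ => 0) (z l) := ⟨_, rfl⟩
  rw [← hxz] at H
  simp only [← congrFun hxz] at hx
  let t₀ : SecantCoord n m → ℂ := Sum.elim (fun _ => 1) fun p => x p.1 ⟨p.2.1, p.2.2.succ⟩
  have hpt : ∀ l, (fun ρ => eval t₀ (affinePoint m l ρ)) = x l := by
    intro l
    funext ⟨i, b⟩
    refine Fin.cases ?_ (fun b => ?_) b
    · rw [eval_affinePoint_zero, H.apply_zero]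
    · simp [affinePoint, t₀]
  have hco : ∀ l, eval t₀ (affineCoeff n m l) = 1 := by
    intro l
    refine Fin.cases ?_ (fun l => ?_) l
    · simp [affineCoeff]
    · simp [affineCoeff, t₀]
  have hge : ∀ s, eval s (aeval (fun p : Fin (m + 1) × Coord n => affinePoint m p.1 p.2)
      (separationPoly a)) = eval (fun p => (fun l ρ => eval s (affinePoint m l ρ)) p.1 p.2)
        (separationPoly a) := fun s => eval_aeval _ _ _
  rw [← card_secantCoord n m]
  refine card_le_topologicalKrullDim_of_linearIndependent _
    (fun J : MonomialIndex n d => affineSecantParam m J) t₀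
    (aeval (fun p : Fin (m + 1) × Coord n => affinePoint m p.1 p.2) (separationPoly a)) ?_ ?_ ?_
  · rw [hge]
    simp only [fun l ρ => congrFun (hpt l) ρ]
    exact hx
  · intro s hs
    exact exists_mk_affineSecantParam_mem hd ht (hge s ▸ hs)
  · intro α β h0
    have h1 : (fun J : MonomialIndex n d => eval t₀ (affineSecantParam m J)) =
        ∑ l, vec d (x l) := by
      funext J
      rw [eval_affineSecantParam]
      simp only [hpt, hco, one_smul]
    have h2 : ∀ k, (fun J : MonomialIndex n d =>
        eval t₀ (pderiv (Sum.inl k) (affineSecantParam m J))) = vec d (x k.succ) := by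
      intro k
      funext J
      rw [eval_pderiv_inl_affineSecantParam, hpt]
    have h3 : ∀ p : Fin (m + 1) × Σ i, Fin (n i), (fun J : MonomialIndex n d =>
        eval t₀ (pderiv (Sum.inr p) (affineSecantParam m J))) =
          dvec d (x p.1) ⟨p.2.1, p.2.2.succ⟩ := by
      rintro ⟨k, ρ⟩
      funext J
      rw [eval_pderiv_inr_affineSecantParam, hpt, hco, one_mul]
    rw [Fintype.sum_sum_type, h1] at h0
    simp only [h2, h3] at h0
    have h4 := H.eq_zero_of_sum_eq_zero hd ht
      -- The value of the map is `∑ v(x_l)` and the derivative in `c_k` is `v(x_k)`, so `v(x₀)` has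
      -- total coefficient `α` and the other `v(x_k)` have `α + β_k`.
      (Fin.cons α fun k => α + β (Sum.inl k)) (fun l ρ => β (Sum.inr (l, ρ))) (by
        rw [← h0, Fintype.sum_prod_type, ← add_assoc, Fin.sum_univ_succ]
        congr 1
        rw [Fin.sum_univ_succ (fun l => vec d (x l))]
        simp only [Fin.cons_zero, Fin.cons_succ, add_smul, Finset.sum_add_distrib, smul_add,
          Finset.smul_sum, add_assoc])
    have hα : α = 0 := congrFun h4.1 0
    refine ⟨hα, ?_⟩
    funext p
    rcases p with k | ⟨l, ρ⟩
    · have := congrFun h4.1 k.succ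
      rw [Fin.cons_succ, hα, zero_add] at this
      exact this
    · exact congrFun (congrFun h4.2 l) ρ

theorem not_isDefective_segreVeronese (hd : ∀ i, 1 ≤ d i) (ht : 2 * t + 2 ≤ d i₁)
    {h : ℕ} (hh : 1 ≤ h) {a : Fin h → MonomialIndex n (Pi.single i₁ t)}
    (ha : Function.Injective a) : ¬ IsDefective (segreVeronese n d) h := by
  obtain ⟨m, rfl⟩ := Nat.exists_eq_add_of_le' hh
  intro hlt
  -- The secant variety reaches the first term of the minimum, so the comparison with the dimension
  -- of the ambient space plays no role.
  have h1 := lt_of_lt_of_le hlt (min_le_left _ _)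
  have h2 := le_topologicalKrullDim_secantVariety hd ht ha
  have h3 : ((m + 1 : ℕ) : WithBot ℕ∞) * (topologicalKrullDim (segreVeronese n d) + 1) ≤
      ((m + (m + 1) * ∑ i, n i : ℕ) : WithBot ℕ∞) + 1 := by
    have h4 := topologicalKrullDim_segreVeronese_le (n := n) hd
    calc ((m + 1 : ℕ) : WithBot ℕ∞) * (topologicalKrullDim (segreVeronese n d) + 1)
        ≤ ((m + 1 : ℕ) : WithBot ℕ∞) * (((∑ i, n i : ℕ) : WithBot ℕ∞) + 1) := by gcongr
      _ = _ := by
        norm_cast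
        ring_nf
  exact absurd (h1.trans_le (h3.trans (by gcongr))) (lt_irrefl _)

end SecantGeometry

end

/-! ### The main theorem: choice of the degree `t` and of the second group of variables -/

theorem mainTheorem5 {r : ℕ} (n d : Fin (r + 2) → ℕ)
    (hn_pos : ∀ i, 1 ≤ n i) (hd_pos : ∀ i, 1 ≤ d i)
    (hn_first : n 0 = 1) (hd_first : d 0 = 1) (hn_mono : Monotone n)
    (e : ℕ) (he : IsLeast (d '' {i | i ≠ 0}) (e + 1)) :
    (∀ h : ℕ, 1 ≤ h → h < SecantGeometry.hFun (n 1 + 1) e →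
      ¬ SecantGeometry.IsTangentiallyWeaklyDefective (SecantGeometry.segreVeronese n d) h ∧
      SecantGeometry.ForGeneralPoints (SecantGeometry.segreVeronese n d) h (fun x =>
        topologicalKrullDim
          (SecantGeometry.contactLocus (SecantGeometry.segreVeronese n d) x) = 0) ∧
      SecantGeometry.IsIdentifiable (SecantGeometry.segreVeronese n d) h ∧
      ¬ SecantGeometry.IsDefective (SecantGeometry.segreVeronese n d) h) ∧
    (1 ≤ e → (fun x : ℕ => (SecantGeometry.hFun (x + 1) e : ℝ)) ~[atTop]
      (fun x : ℕ => (x : ℝ) ^ (Nat.log 2 (e + 1) - 1))) := by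
  refine ⟨fun h hh hlt => ?_, SecantGeometry.hFun_isEquivalent⟩
  rw [SecantGeometry.hFun_eq_sum_bitIndices] at hlt
  -- If `⌊(e + 1) / 2⌋` were `0`, then `h_m(e)` would be an empty sum, and no `h` could lie below
  -- it.
  obtain ⟨t, ht⟩ : ∃ t, (e + 1) / 2 = t + 1 := by
    refine Nat.exists_eq_succ_of_ne_zero fun h0 => ?_
    rw [h0] at hlt
    simp at hlt
  have hcard : h ≤ Fintype.card (Sym (Fin (n 1 + 1)) t) := by
    rw [ht] at hlt
    exact hlt.le.trans (SecantGeometry.sum_bitIndices_le_card_sym (by have := hn_pos 1; omega) t)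
  have hd1 : e + 1 ≤ d 1 := he.2 ⟨1, by simp, rfl⟩
  -- Rounding down gives `2(t + 1) ≤ e + 1`, and `e + 1` is the least of the degrees with index
  -- different from `0`, so it is at most `d 1`.
  have htd : 2 * t + 2 ≤ d 1 := by omega
  obtain ⟨a, ha⟩ := SecantGeometry.exists_injective_monomialIndex_single (n := n) 1 hcard
  exact ⟨SecantGeometry.not_isTangentiallyWeaklyDefective hd_pos htd (hn_pos 1) hh ha,
    SecantGeometry.forGeneralPoints_topologicalKrullDim_contactLocus hd_pos htd (hn_pos 1) hh ha,
    SecantGeometry.isIdentifiable_segreVeronese hd_pos htd hh ha,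
    SecantGeometry.not_isDefective_segreVeronese hd_pos htd hh ha⟩
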